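/- \textbf{Definitions.} A Boolean circuit $C=(G,W,g_0,\mu)$ is a finite directed acyclic graph with set of gates $G$, set of wires $W\subseteq G\times G$, output gate $g_0$, and a type $\mu(g)$ for each gate: input (no incoming wire), constant $0$ or $1$, NOT (exactly one incoming wire), AND, OR. It is \emph{arity-two} if AND- and OR-gates have exactly two incoming wires and constant gates have none. Every valuation $\nu:C_{\mathsf{inp}}\to\{0,1\}$ of the input gates extends uniquely to an evaluation of all gates; write $\nu(g_0)$ for the value of the output gate. Put $|C|=|G|+|W|$. A tree decomposition $T$ of $C$ is a rooted full binary tree whose nodes (bags) $b$ are labelled by sets $\mathrm{dom}(b)\subseteq G$ such that (i) for every gate $g$, any bag on the undirected path between two bags containing $g$ contains $g$, and (ii) for every gate $g$ some bag contains $g$ together with all gates that have a wire to $g$ (i.e. $T$ is a tree decomposition of the relational encoding of $C$, which has one fact for each gate together with its inputs). Its width is $\max_b|\mathrm{dom}(b)|-1$, and $|T|$ is its number of bags. A probabilistic valuation $\pi$ of $C$ gives, for each $g\in C_{\mathsf{inp}}$, a probability distribution $\pi_g$ on $\{0,1\}$ with rational values. The \emph{probability evaluation problem} for $C$ and $\pi$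 is to compute both values of \[\Pr\nolimits_{g_0}(v)=\sum_{\nu:\ \nu(g_0)=v}\ \prod_{g\in C_{\mathsf{inp}}}\pi_g(\nu(g)),\qquad v\in\{0,1\}.\] An algorithm runs in time \emph{ra-linear} in a size parameter if it runs in linear time when arithmetic operations on rationals take constant time and rationals are stored in constant space, and in polynomial time without this assumption. The machine model is a random access machine with registers and arrays of natural numbers (words) and of rationals; under the assumption every elementary operation costs one step, and words never exceed a constant times the size of the input parameter; without it, operations on rationals are charged according to the bit lengths of their operands. Accordingly $|\pi|$ is the number of rationals in $\pi$ under the assumption, and their total bit length without it. \textbf{Theorem.} There is an algorithm which, given an arity-two Boolean circuit $C$, a tree decomposition $T$ of $C$ of width $k$ (for any $k$), and a probabilistic valuation $\pi$ of $C$, solves the probability evaluation problem for $C$ and $\pi$ in time ra-linear in \[2^k\,|T|+|\pi|+|C|,\] where the algorithm, the constant of the linear bound and the polynomial of the polynomial bound do not depend on $C$, $T$, $k$ or $\pi$. -/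

import Mathlib

namespace ProbEval

/-! ## Boolean circuits -/

/-- The possible types of a gate: input, constants `0` and `1`, NOT, AND, OR. -/
inductive GateKind
  | inp
  | zero
  | one
  | neg
  | and
  | or
  deriving DecidableEq

/-- A Boolean circuit `(G, W, g₀, μ)`: a finite directed acyclic graph on the gates `G`, a wire
`(g', g)` meaning that `g'` is an input of `g`. -/
structure Circuit (G : Type) [Fintype G] [DecidableEq G] where
  /-- the set of wires -/
  wires : Finset (G × G)
  /-- the distinguished output gate -/
  out : G
  /-- the type of each gate -/
  kind : G → GateKind
  acyclic : ∀ g, ¬ Relation.TransGen (fun g' g => (g', g) ∈ wires) g g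
  inp_fanin : ∀ g, kind g = .inp → ∀ g', (g', g) ∉ wires
  neg_fanin : ∀ g, kind g = .neg → ∃! g', (g', g) ∈ wires

namespace Circuit

variable {G : Type} [Fintype G] [DecidableEq G] (C : Circuit G)

/-- The number of gates with a wire to `g`. -/
def fanin (g : G) : ℕ := (Finset.univ.filter fun g' => (g', g) ∈ C.wires).card

/-- AND- and OR-gates have fan-in exactly two, constant gates have fan-in zero. -/
def IsArityTwo : Prop :=
  (∀ g, C.kind g = .and ∨ C.kind g = .or → C.fanin g = 2) ∧
  (∀ g, C.kind g = .zero ∨ C.kind g = .one → C.fanin g = 0)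

/-- The input gates of the circuit. -/
abbrev Inp : Type := {g : G // C.kind g = .inp}

theorem wires_wf : WellFounded (fun g' g => (g', g) ∈ C.wires) := by
  have : IsTrans G (Relation.TransGen (fun g' g => (g', g) ∈ C.wires)) :=
    ⟨fun _ _ _ h h' => h.trans h'⟩
  have : Std.Irrefl (Relation.TransGen (fun g' g => (g', g) ∈ C.wires)) := ⟨C.acyclic⟩
  exact Subrelation.wf (fun h => Relation.TransGen.single h)
    (Finite.wellFounded_of_trans_of_irrefl
      (Relation.TransGen (fun g' g => (g', g) ∈ C.wires)))

open Classical in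
/-- The value of a gate, from the values of the gates that have a wire to it. -/
noncomputable def gateValue (ν : C.Inp → Bool) (g : G)
    (val : ∀ g', (g', g) ∈ C.wires → Bool) : Bool :=
  if h : C.kind g = .inp then ν ⟨g, h⟩
  else match C.kind g with
    | .inp => false -- excluded by the test above
    | .zero => false
    | .one => true
    | .neg => decide (∀ g' (h : (g', g) ∈ C.wires), val g' h = false)
    | .and => decide (∀ g' (h : (g', g) ∈ C.wires), val g' h = true)
    | .or => decide (∃ g', ∃ h : (g', g) ∈ C.wires, val g' h = true)

/-- The evaluation of the circuit on a valuation `ν` of its input gates. -/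
noncomputable def eval (ν : C.Inp → Bool) : G → Bool :=
  C.wires_wf.fix (C.gateValue ν)

theorem eval_eq (ν : C.Inp → Bool) (g : G) :
    C.eval ν g = C.gateValue ν g (fun g' _ => C.eval ν g') :=
  C.wires_wf.fix_eq _ g

/-- The size of the circuit: number of gates plus number of wires. -/
def size : ℕ := Fintype.card G + C.wires.card

end Circuit

/-! ## Probabilistic valuations and the probability evaluation problem -/

/-- A probability distribution on `{0, 1}` with rational values for every input gate. -/
structure ProbValuation {G : Type} [Fintype G] [DecidableEq G] (C : Circuit G) where
  prob : C.Inp → Bool → ℚ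
  nonneg : ∀ g v, 0 ≤ prob g v
  sum_eq_one : ∀ g, prob g false + prob g true = 1

/-- The number of bits of a rational (numerator, sign and denominator). -/
def ratBits (q : ℚ) : ℕ := Nat.size q.num.natAbs + 1 + Nat.size q.den

namespace ProbValuation

variable {G : Type} [Fintype G] [DecidableEq G] {C : Circuit G} (π : ProbValuation C)

/-- The probability that the output gate evaluates to `v` when the input gates are drawn
independently. -/
noncomputable def outProb (v : Bool) : ℚ :=
  ∑ ν : C.Inp → Bool with C.eval ν C.out = v, ∏ g, π.prob g (ν g)

/-- The size of `π` when every rational is stored in one memory cell. -/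
def cellSize (_π : ProbValuation C) : ℕ := 2 * Fintype.card C.Inp

/-- The size of `π` when rationals are written in binary. -/
def bitSize : ℕ := ∑ g : C.Inp, ∑ v : Bool, ratBits (π.prob g v)

end ProbValuation

/-! ## Relational instances and tree decompositions -/

/-- A relational instance on the domain `D`, over the signature with relation symbols `Rel` and
arities `ar`: a set of facts `R(a₁, …, aₙ)`. -/
abbrev RelInstance {Rel : Type} (ar : Rel → ℕ) (D : Type) : Type :=
  Set (Σ R : Rel, Fin (ar R) → D)

/-- A rooted ordered full binary tree on the set of nodes `V`. -/
structure FullBinTree (V : Type) where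
  root : V
  left : V → Option V
  right : V → Option V
  /-- every node has either zero or two children -/
  full : ∀ v, left v = none ↔ right v = none
  left_ne_right : ∀ u v, left u = some v → right u ≠ some v
  parent_unique : ∀ u u' v, (left u = some v ∨ right u = some v) →
    (left u' = some v ∨ right u' = some v) → u = u'
  root_no_parent : ∀ u, ¬ (left u = some root ∨ right u = some root)
  reachable : ∀ v, Relation.ReflTransGen (fun u w => left u = some w ∨ right u = some w) root v

/-- The undirected graph underlying the tree. -/
def FullBinTree.graph {V : Type} (T : FullBinTree V) : SimpleGraph V :=
  SimpleGraph.fromRel fun u v => T.left u = some v ∨ T.right u = some v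

/-- A tree decomposition, with set of bags `B`, of a relational instance `I`. -/
structure TreeDecomposition {Rel : Type} {ar : Rel → ℕ} {D : Type} (I : RelInstance ar D)
    (B : Type) extends FullBinTree B where
  /-- the set of elements in each bag -/
  dom : B → Finset D
  /-- all bags on the undirected path between two bags containing `a` contain `a` -/
  connected : ∀ (a : D) (b₁ b₂ : B), a ∈ dom b₁ → a ∈ dom b₂ →
    ∀ p : toFullBinTree.graph.Walk b₁ b₂, p.IsPath → ∀ b ∈ p.support, a ∈ dom b
  /-- every fact is covered by some bag -/
  covers : ∀ F ∈ I, ∃ b, ∀ i, F.2 i ∈ dom b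

/-- The width: the maximal size of a bag, minus one. -/
def TreeDecomposition.width {Rel : Type} {ar : Rel → ℕ} {D : Type} {I : RelInstance ar D}
    {B : Type} [Fintype B] (T : TreeDecomposition I B) : ℕ :=
  (Finset.univ.sup fun b => (T.dom b).card) - 1

/-- The arities of the signature that encodes arity-two circuits; there is one relation symbol
for every gate type, its first argument being a gate and the others the inputs of this gate. -/
def GateKind.arity : GateKind → ℕ
  | .inp => 1
  | .zero => 1
  | .one => 1
  | .neg => 2
  | .and => 3
  | .or => 3

/-- The facts of the relational encoding of a circuit. -/
inductive Circuit.IsFact {G : Type} [Fintype G] [DecidableEq G] (C : Circuit G) :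
    (Σ R : GateKind, Fin R.arity → G) → Prop
  | inp (g : G) : C.kind g = .inp → C.IsFact ⟨.inp, ![g]⟩
  | zero (g : G) : C.kind g = .zero → C.IsFact ⟨.zero, ![g]⟩
  | one (g : G) : C.kind g = .one → C.IsFact ⟨.one, ![g]⟩
  | neg (g g₁ : G) : C.kind g = .neg → (g₁, g) ∈ C.wires → C.IsFact ⟨.neg, ![g, g₁]⟩
  | and (g g₁ g₂ : G) : C.kind g = .and → (g₁, g) ∈ C.wires → (g₂, g) ∈ C.wires → g₁ ≠ g₂ →
      C.IsFact ⟨.and, ![g, g₁, g₂]⟩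
  | or (g g₁ g₂ : G) : C.kind g = .or → (g₁, g) ∈ C.wires → (g₂, g) ∈ C.wires → g₁ ≠ g₂ →
      C.IsFact ⟨.or, ![g, g₁, g₂]⟩

/-- The relational encoding of a circuit. -/
def Circuit.encoding {G : Type} [Fintype G] [DecidableEq G] (C : Circuit G) :
    RelInstance GateKind.arity G :=
  {F | C.IsFact F}

/-! ## Random access machines with rational arithmetic

A structured random access machine. Its memory has registers and arrays (random access memory
segments) of natural numbers, called words, and registers and arrays of rationals. A program
mentions finitely many of them. Arrays are addressed by words only. -/

/-- The content of the memory. -/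
structure Memory where
  /-- word registers -/
  wreg : ℕ → ℕ
  /-- word arrays: `warr a i` is cell `i` of array `a` -/
  warr : ℕ → ℕ → ℕ
  /-- rational registers -/
  qreg : ℕ → ℚ
  /-- rational arrays -/
  qarr : ℕ → ℕ → ℚ

/-- Operations on words (subtraction is truncated at `0`, and division by `0` yields `0`). -/
inductive WordOp
  | add
  | sub
  | mul
  | div
  | mod

def WordOp.apply : WordOp → ℕ → ℕ → ℕ
  | .add, x, y => x + y
  | .sub, x, y => x - y
  | .mul, x, y => x * y
  | .div, x, y => x / y
  | .mod, x, y => x % y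

/-- Word expressions: constants, registers, array cells, operations. -/
inductive WordExp
  | lit (v : ℕ)
  | reg (x : ℕ)
  | get (a : ℕ) (e : WordExp)
  | op (o : WordOp) (e f : WordExp)

namespace WordExp

def val (M : Memory) : WordExp → ℕ
  | lit v => v
  | reg x => M.wreg x
  | get a e => M.warr a (e.val M)
  | op o e f => o.apply (e.val M) (f.val M)

/-- One step for every constant, memory access and operation. -/
def cost : WordExp → ℕ
  | lit _ => 1
  | reg _ => 1
  | get _ e => 1 + e.cost
  | op _ e f => 1 + e.cost + f.cost

/-- No constant and no result of an operation exceeds the maximal word `w`. -/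
def Fits (w : ℕ) (M : Memory) : WordExp → Prop
  | lit v => v ≤ w
  | reg _ => True
  | get _ e => e.Fits w M
  | op o e f => e.Fits w M ∧ f.Fits w M ∧ o.apply (e.val M) (f.val M) ≤ w

end WordExp

/-- Operations on rationals (division by `0` yields `0`). -/
inductive RatOp
  | add
  | sub
  | mul
  | div

def RatOp.apply : RatOp → ℚ → ℚ → ℚ
  | .add, x, y => x + y
  | .sub, x, y => x - y
  | .mul, x, y => x * y
  | .div, x, y => x / y

/-- Rational expressions: constants, registers, array cells, operations. -/
inductive RatExp
  | lit (q : ℚ)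
  | reg (x : ℕ)
  | get (a : ℕ) (e : WordExp)
  | op (o : RatOp) (e f : RatExp)

namespace RatExp

def val (M : Memory) : RatExp → ℚ
  | lit q => q
  | reg x => M.qreg x
  | get a e => M.qarr a (e.val M)
  | op o e f => o.apply (e.val M) (f.val M)

/-- Cost when memory accesses and arithmetic operations on rationals take one step. -/
def cost : RatExp → ℕ
  | lit _ => 1
  | reg _ => 1
  | get _ e => 1 + e.cost
  | op _ e f => 1 + e.cost + f.cost

/-- Cost when accessing a rational takes time linear in its number of bits, and an arithmetic
operation takes time quadratic in the number of bits of its operands. -/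
def bitCost (M : Memory) : RatExp → ℕ
  | lit q => 1 + ratBits q
  | reg x => 1 + ratBits (M.qreg x)
  | get a e => 1 + e.cost + ratBits (M.qarr a (e.val M))
  | op _ e f => e.bitCost M + f.bitCost M + (1 + ratBits (e.val M) + ratBits (f.val M)) ^ 2

def Fits (w : ℕ) (M : Memory) : RatExp → Prop
  | lit _ => True
  | reg _ => True
  | get _ e => e.Fits w M
  | op _ e f => e.Fits w M ∧ f.Fits w M

end RatExp

/-- Tests. -/
inductive Test
  | lt (e f : WordExp)
  | eq (e f : WordExp)
  | isZero (e : RatExp)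

namespace Test

def Holds (M : Memory) : Test → Prop
  | lt e f => e.val M < f.val M
  | eq e f => e.val M = f.val M
  | isZero e => e.val M = 0

def cost : Test → ℕ
  | lt e f => 1 + e.cost + f.cost
  | eq e f => 1 + e.cost + f.cost
  | isZero e => 1 + e.cost

def bitCost (M : Memory) : Test → ℕ
  | lt e f => 1 + e.cost + f.cost
  | eq e f => 1 + e.cost + f.cost
  | isZero e => 1 + e.bitCost M

def Fits (w : ℕ) (M : Memory) : Test → Prop
  | lt e f => e.Fits w M ∧ f.Fits w M
  | eq e f => e.Fits w M ∧ f.Fits w M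
  | isZero e => e.Fits w M

end Test

/-- Programs: assignments to registers and array cells, and structured control flow. -/
inductive Program
  | skip
  | setW (x : ℕ) (e : WordExp)
  | putW (a : ℕ) (i e : WordExp)
  | setQ (x : ℕ) (e : RatExp)
  | putQ (a : ℕ) (i : WordExp) (e : RatExp)
  | seq (P Q : Program)
  | cond (b : Test) (P Q : Program)
  | loop (b : Test) (P : Program)

/-- `Exec w P M t r M'`: on a machine with maximal word `w`, the program `P`, started with memory
`M`, halts with memory `M'`, after time `t` when operations on rationals take constant time and
after time `r` when they are charged according to the number of bits. A computation in which a
word would exceed `w` is stuck: it does not halt. -/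
inductive Exec (w : ℕ) : Program → Memory → ℕ → ℕ → Memory → Prop
  | skip (M : Memory) : Exec w .skip M 1 1 M
  | setW (M : Memory) (x : ℕ) (e : WordExp) : e.Fits w M →
      Exec w (.setW x e) M (1 + e.cost) (1 + e.cost)
        { M with wreg := Function.update M.wreg x (e.val M) }
  | putW (M : Memory) (a : ℕ) (i e : WordExp) : i.Fits w M → e.Fits w M →
      Exec w (.putW a i e) M (1 + i.cost + e.cost) (1 + i.cost + e.cost)
        { M with
          warr := Function.update M.warr a (Function.update (M.warr a) (i.val M) (e.val M)) }
  | setQ (M : Memory) (x : ℕ) (e : RatExp) : e.Fits w M →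
      Exec w (.setQ x e) M (1 + e.cost) (1 + e.bitCost M + ratBits (e.val M))
        { M with qreg := Function.update M.qreg x (e.val M) }
  | putQ (M : Memory) (a : ℕ) (i : WordExp) (e : RatExp) : i.Fits w M → e.Fits w M →
      Exec w (.putQ a i e) M (1 + i.cost + e.cost) (1 + i.cost + e.bitCost M + ratBits (e.val M))
        { M with
          qarr := Function.update M.qarr a (Function.update (M.qarr a) (i.val M) (e.val M)) }
  | seq {M M' M'' : Memory} {P Q : Program} {t t' r r' : ℕ} :
      Exec w P M t r M' → Exec w Q M' t' r' M'' → Exec w (.seq P Q) M (t + t') (r + r') M''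
  | condTrue {M M' : Memory} {b : Test} {P Q : Program} {t r : ℕ} : b.Fits w M → b.Holds M →
      Exec w P M t r M' → Exec w (.cond b P Q) M (b.cost + t) (b.bitCost M + r) M'
  | condFalse {M M' : Memory} {b : Test} {P Q : Program} {t r : ℕ} : b.Fits w M → ¬ b.Holds M →
      Exec w Q M t r M' → Exec w (.cond b P Q) M (b.cost + t) (b.bitCost M + r) M'
  | loopDone {M : Memory} {b : Test} {P : Program} : b.Fits w M → ¬ b.Holds M →
      Exec w (.loop b P) M b.cost (b.bitCost M) M
  | loopStep {M M' M'' : Memory} {b : Test} {P : Program} {t t' r r' : ℕ} : b.Fits w M →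
      b.Holds M → Exec w P M t r M' → Exec w (.loop b P) M' t' r' M'' →
      Exec w (.loop b P) M (b.cost + t + t') (b.bitCost M + r + r') M''

/-! ## The input of the problem in memory -/

def GateKind.code : GateKind → ℕ
  | .inp => 0
  | .zero => 1
  | .one => 2
  | .neg => 3
  | .and => 4
  | .or => 5

/-- A pointer: `0` for none, `v + 1` for the node `v`. -/
def pointer {m : ℕ} : Option (Fin m) → ℕ
  | none => 0
  | some v => v + 1

/-- The array with the given entries at the indices `0, 1, …`, followed by zeros. -/
def arrayOf (l : List ℕ) (i : ℕ) : ℕ := l.getD i 0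

/-- The memory `M` contains a circuit `C` with gates `0, …, n - 1`, a tree decomposition `T` of
`C` with bags `0, …, m - 1`, and a probabilistic valuation `π` of `C`, and is zero elsewhere.
The wires, and the gates of each bag, are listed in an arbitrary order.

* word registers: `n`, number of wires, `m`, output gate, root bag;
* word arrays: gate types, sources of the wires, targets of the wires, left children,
  right children, start of the list of each bag (and the end of the last one),
  concatenation of the lists of the bags;
* rational arrays: the probabilities of `0` and of `1`, indexed by gates. -/
def Encodes {n m : ℕ} (M : Memory) (C : Circuit (Fin n)) (T : TreeDecomposition C.encoding (Fin m))
    (π : ProbValuation C) : Prop :=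
  ∃ (W : List (Fin n × Fin n)) (d : Fin m → List (Fin n)),
    W.Nodup ∧ W.toFinset = C.wires ∧ (∀ b, (d b).Nodup ∧ (d b).toFinset = T.dom b) ∧
    M.wreg = arrayOf [n, W.length, m, C.out, T.root] ∧
    M.warr 0 = arrayOf (List.ofFn fun g => (C.kind g).code) ∧
    M.warr 1 = arrayOf (W.map fun e => (e.1 : ℕ)) ∧
    M.warr 2 = arrayOf (W.map fun e => (e.2 : ℕ)) ∧
    M.warr 3 = arrayOf (List.ofFn fun b => pointer (T.left b)) ∧
    M.warr 4 = arrayOf (List.ofFn fun b => pointer (T.right b)) ∧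
    M.warr 5 = arrayOf ((List.range (m + 1)).map fun j =>
      (((List.ofFn d).take j).map List.length).sum) ∧
    M.warr 6 = arrayOf (((List.ofFn d).flatten : List (Fin n)).map Fin.val) ∧
    (∀ a, 7 ≤ a → M.warr a = fun _ => 0) ∧
    M.qreg = (fun _ => 0) ∧
    (∀ (g : Fin n) (h : C.kind g = .inp),
      M.qarr 0 g = π.prob ⟨g, h⟩ false ∧ M.qarr 1 g = π.prob ⟨g, h⟩ true) ∧
    (∀ a i, (∀ (g : Fin n), C.kind g = .inp → (g : ℕ) = i → 2 ≤ a) → M.qarr a i = 0)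

end ProbEval

/-! Introduce a Boolean variable for every gate and give each gate a factor: for an input gate its
probability, for any other gate the indicator that its value is the one dictated by its inputs; the
output gate gets the factor 0 at the value `false`. A product of all factors is nonzero only at
assignments that are evaluations of the circuit, so the sum of these products over all assignments
is the probability of the output `true` (`sum_prod_factor`). The probability of `false` is its
complement (`outProb_false`).

A factor involves only a gate and its inputs, which share a bag (`exists_cover`), so it can be
charged to one such bag (`local_factor`). The sum is then computed by message passing. The table of
a bag `b` sums, over all gates strictly below `b`, the product of the factors charged to the subtree
of `b`. It equals the product of the factors charged to `b` itself times one message per child,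
namely the child's table summed over the gates absent from `b` (`table_of_children`). Distributivity
applies because a gate that occurs both inside and outside a subtree occurs on both ends of the edge
leading to it (`mem_dom_of_mem`). The root table sums to the desired probability
(`sumOver_table_root`).

For linear time, each row of a table must cost a constant amount, independent of the width. A row is
numbered by the binary `code` of its assignment. Tables grow by doubling, one gate at a time, and
the geometric sum `sum_two_pow_mul_le` bounds the cost by the final number of rows. The gates of a
bag are ordered topologically, so that the inputs of a new gate charged to the bag are already bits
of the row number (`run_localTable`). The ordering costs quadratic time in the size of the bag,
which `succ_sq_le_two_pow` absorbs. A message is transferred by giving each row of child and parent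
a key that encodes its restriction to the shared gates; child rows with the same key are added up,
and each parent row is multiplied by the sum at its key (`run_absorbBag`).

For polynomial bit cost, every rational that occurs is a fraction over one common denominator, the
product of the denominators of the input probabilities, with value at most `2 ^ (2 * n)`; hence it
has at most `bitBound` bits (`IsFrac.ratBits_le_bitBound`). With operands of at most `β` bits,
charging by bits multiplies the running time by at most `(2 + 2 * β) ^ 2`, and the predicate `Run`
carries both costs through the program together. -/

namespace ProbEval

/-! ## Memory updates -/

namespace Memory

def setW (M : Memory) (x v : ℕ) : Memory := { M with wreg := Function.update M.wreg x v }

def putW (M : Memory) (a i v : ℕ) : Memory :=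
  { M with warr := Function.update M.warr a (Function.update (M.warr a) i v) }

def setQ (M : Memory) (x : ℕ) (q : ℚ) : Memory := { M with qreg := Function.update M.qreg x q }

def putQ (M : Memory) (a i : ℕ) (q : ℚ) : Memory :=
  { M with qarr := Function.update M.qarr a (Function.update (M.qarr a) i q) }

variable (M : Memory) (x a i v : ℕ) (q : ℚ)

@[simp] theorem wreg_setW (y : ℕ) :
    (M.setW x v).wreg y = if y = x then v else M.wreg y := by
  simp [setW, Function.update_apply]

@[simp] theorem warr_setW : (M.setW x v).warr = M.warr := rfl
@[simp] theorem qreg_setW : (M.setW x v).qreg = M.qreg := rfl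
@[simp] theorem qarr_setW : (M.setW x v).qarr = M.qarr := rfl

@[simp] theorem wreg_putW : (M.putW a i v).wreg = M.wreg := rfl

@[simp] theorem warr_putW (b j : ℕ) :
    (M.putW a i v).warr b j = if b = a ∧ j = i then v else M.warr b j := by
  by_cases h : b = a
  · subst h; simp [putW, Function.update_apply]
  · simp [putW, h]

@[simp] theorem qreg_putW : (M.putW a i v).qreg = M.qreg := rfl
@[simp] theorem qarr_putW : (M.putW a i v).qarr = M.qarr := rfl

@[simp] theorem wreg_setQ : (M.setQ x q).wreg = M.wreg := rfl
@[simp] theorem warr_setQ : (M.setQ x q).warr = M.warr := rfl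

@[simp] theorem qreg_setQ (y : ℕ) :
    (M.setQ x q).qreg y = if y = x then q else M.qreg y := by
  simp [setQ, Function.update_apply]

@[simp] theorem qarr_setQ : (M.setQ x q).qarr = M.qarr := rfl

@[simp] theorem wreg_putQ : (M.putQ a i q).wreg = M.wreg := rfl
@[simp] theorem warr_putQ : (M.putQ a i q).warr = M.warr := rfl
@[simp] theorem qreg_putQ : (M.putQ a i q).qreg = M.qreg := rfl

@[simp] theorem qarr_putQ (b j : ℕ) :
    (M.putQ a i q).qarr b j = if b = a ∧ j = i then q else M.qarr b j := by
  by_cases h : b = a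
  · subst h; simp [putQ, Function.update_apply]
  · simp [putQ, h]

end Memory

/-! ## Notation for expressions -/

namespace WordExp

instance (v : ℕ) : OfNat WordExp v := ⟨lit v⟩
instance : Add WordExp := ⟨op .add⟩
instance : Sub WordExp := ⟨op .sub⟩
instance : Mul WordExp := ⟨op .mul⟩
instance : Div WordExp := ⟨op .div⟩
instance : Mod WordExp := ⟨op .mod⟩

variable (M : Memory) (w v x a : ℕ) (e f : WordExp)

@[simp] theorem val_ofNat : (ofNat(v) : WordExp).val M = (OfNat.ofNat v : ℕ) := rfl
@[simp] theorem val_lit : (lit v).val M = v := rfl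
@[simp] theorem val_reg : (reg x).val M = M.wreg x := rfl
@[simp] theorem val_get : (get a e).val M = M.warr a (e.val M) := rfl
@[simp] theorem val_add : (e + f).val M = e.val M + f.val M := rfl
@[simp] theorem val_sub : (e - f).val M = e.val M - f.val M := rfl
@[simp] theorem val_mul : (e * f).val M = e.val M * f.val M := rfl
@[simp] theorem val_div : (e / f).val M = e.val M / f.val M := rfl
@[simp] theorem val_mod : (e % f).val M = e.val M % f.val M := rfl

@[simp] theorem fits_ofNat : (ofNat(v) : WordExp).Fits w M ↔ (OfNat.ofNat v : ℕ) ≤ w := Iff.rfl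
@[simp] theorem fits_lit : (lit v).Fits w M ↔ v ≤ w := Iff.rfl
@[simp] theorem fits_reg : (reg x).Fits w M ↔ True := Iff.rfl
@[simp] theorem fits_get : (get a e).Fits w M ↔ e.Fits w M := Iff.rfl
@[simp] theorem fits_add :
    (e + f).Fits w M ↔ e.Fits w M ∧ f.Fits w M ∧ e.val M + f.val M ≤ w := Iff.rfl
@[simp] theorem fits_sub :
    (e - f).Fits w M ↔ e.Fits w M ∧ f.Fits w M ∧ e.val M - f.val M ≤ w := Iff.rfl
@[simp] theorem fits_mul :
    (e * f).Fits w M ↔ e.Fits w M ∧ f.Fits w M ∧ e.val M * f.val M ≤ w := Iff.rfl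
@[simp] theorem fits_div :
    (e / f).Fits w M ↔ e.Fits w M ∧ f.Fits w M ∧ e.val M / f.val M ≤ w := Iff.rfl
@[simp] theorem fits_mod :
    (e % f).Fits w M ↔ e.Fits w M ∧ f.Fits w M ∧ e.val M % f.val M ≤ w := Iff.rfl

end WordExp

namespace RatExp

instance : Zero RatExp := ⟨lit 0⟩
instance : One RatExp := ⟨lit 1⟩
instance : Add RatExp := ⟨op .add⟩
instance : Sub RatExp := ⟨op .sub⟩
instance : Mul RatExp := ⟨op .mul⟩

/-- All operands that occur in the expression have at most `β` bits. -/
def Small (β : ℕ) (M : Memory) : RatExp → Prop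
  | lit q => ratBits q ≤ β
  | reg x => ratBits (M.qreg x) ≤ β
  | get a e => ratBits (M.qarr a (e.val M)) ≤ β
  | op o e f => e.Small β M ∧ f.Small β M ∧ ratBits ((op o e f).val M) ≤ β

variable (M : Memory) (w β x a : ℕ) (e f : RatExp) (g : WordExp)

@[simp] theorem val_zero : (0 : RatExp).val M = 0 := rfl
@[simp] theorem val_one : (1 : RatExp).val M = 1 := rfl
@[simp] theorem val_reg : (reg x).val M = M.qreg x := rfl
@[simp] theorem val_get : (get a g).val M = M.qarr a (g.val M) := rfl
@[simp] theorem val_add : (e + f).val M = e.val M + f.val M := rfl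
@[simp] theorem val_sub : (e - f).val M = e.val M - f.val M := rfl
@[simp] theorem val_mul : (e * f).val M = e.val M * f.val M := rfl

@[simp] theorem fits_zero : (0 : RatExp).Fits w M ↔ True := Iff.rfl
@[simp] theorem fits_one : (1 : RatExp).Fits w M ↔ True := Iff.rfl
@[simp] theorem fits_reg : (reg x).Fits w M ↔ True := Iff.rfl
@[simp] theorem fits_get : (get a g).Fits w M ↔ g.Fits w M := Iff.rfl
@[simp] theorem fits_add : (e + f).Fits w M ↔ e.Fits w M ∧ f.Fits w M := Iff.rfl
@[simp] theorem fits_sub : (e - f).Fits w M ↔ e.Fits w M ∧ f.Fits w M := Iff.rfl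
@[simp] theorem fits_mul : (e * f).Fits w M ↔ e.Fits w M ∧ f.Fits w M := Iff.rfl

@[simp] theorem small_zero : (0 : RatExp).Small β M ↔ ratBits 0 ≤ β := Iff.rfl
@[simp] theorem small_one : (1 : RatExp).Small β M ↔ ratBits 1 ≤ β := Iff.rfl
@[simp] theorem small_reg : (reg x).Small β M ↔ ratBits (M.qreg x) ≤ β := Iff.rfl
@[simp] theorem small_get :
    (get a g).Small β M ↔ ratBits (M.qarr a (g.val M)) ≤ β := Iff.rfl
@[simp] theorem small_add : (e + f).Small β M ↔
    e.Small β M ∧ f.Small β M ∧ ratBits (e.val M + f.val M) ≤ β := Iff.rfl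
@[simp] theorem small_sub : (e - f).Small β M ↔
    e.Small β M ∧ f.Small β M ∧ ratBits (e.val M - f.val M) ≤ β := Iff.rfl
@[simp] theorem small_mul : (e * f).Small β M ↔
    e.Small β M ∧ f.Small β M ∧ ratBits (e.val M * f.val M) ≤ β := Iff.rfl

variable {M β}

theorem Small.ratBits_val_le : ∀ {e : RatExp}, e.Small β M → ratBits (e.val M) ≤ β
  | lit _, h => h
  | reg _, h => h
  | get _ _, h => h
  | op _ _ _, h => h.2.2

/-- An operation on operands of at most `β` bits is charged at most `(1 + 2 * β) ^ 2`, and an access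
at most linearly in `β`, so every unit of `cost` is inflated by at most the same factor. -/
theorem Small.bitCost_le {e : RatExp} (h : e.Small β M) :
    e.bitCost M ≤ (2 + 2 * β) ^ 2 * e.cost := by
  induction e with
  | lit q => simp only [Small, bitCost, cost] at *; nlinarith
  | reg x => simp only [Small, bitCost, cost] at *; nlinarith
  | get a e =>
    simp only [Small, bitCost, cost] at *
    nlinarith [Nat.zero_le (β * e.cost), Nat.zero_le (β * β * e.cost), Nat.zero_le (β * β)]
  | op o e f he hf =>
    obtain ⟨h₁, h₂, -⟩ := h
    have h₃ := he h₁
    have h₄ := hf h₂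
    have h₅ := h₁.ratBits_val_le
    have h₆ := h₂.ratBits_val_le
    have h₇ : (1 + ratBits (e.val M) + ratBits (f.val M)) ^ 2 ≤ (2 + 2 * β) ^ 2 :=
      Nat.pow_le_pow_left (by omega) 2
    simp only [bitCost, cost]
    nlinarith

end RatExp

namespace Test

variable (M : Memory) (w : ℕ) (e f : WordExp)

@[simp] theorem holds_lt : (lt e f).Holds M ↔ e.val M < f.val M := Iff.rfl
@[simp] theorem holds_eq : (eq e f).Holds M ↔ e.val M = f.val M := Iff.rfl
@[simp] theorem fits_lt : (lt e f).Fits w M ↔ e.Fits w M ∧ f.Fits w M := Iff.rfl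
@[simp] theorem fits_eq : (eq e f).Fits w M ↔ e.Fits w M ∧ f.Fits w M := Iff.rfl

end Test

/-! ### Frame conditions -/

namespace Program

/-- Word registers that the program may write. -/
def wrW : Program → List ℕ
  | setW x _ => [x]
  | seq P Q => P.wrW ++ Q.wrW
  | cond _ P Q => P.wrW ++ Q.wrW
  | loop _ P => P.wrW
  | _ => []

/-- Word arrays that the program may write. -/
def wrA : Program → List ℕ
  | putW a _ _ => [a]
  | seq P Q => P.wrA ++ Q.wrA
  | cond _ P Q => P.wrA ++ Q.wrA
  | loop _ P => P.wrA
  | _ => []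

/-- Rational registers that the program may write. -/
def wrQ : Program → List ℕ
  | setQ x _ => [x]
  | seq P Q => P.wrQ ++ Q.wrQ
  | cond _ P Q => P.wrQ ++ Q.wrQ
  | loop _ P => P.wrQ
  | _ => []

/-- Rational arrays that the program may write. -/
def wrR : Program → List ℕ
  | putQ a _ _ => [a]
  | seq P Q => P.wrR ++ Q.wrR
  | cond _ P Q => P.wrR ++ Q.wrR
  | loop _ P => P.wrR
  | _ => []

end Program

/-- `M` and `M'` agree on everything that `P` does not write. -/
structure Same (P : Program) (M M' : Memory) : Prop where
  wreg : ∀ x, x ∉ P.wrW → M'.wreg x = M.wreg x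
  warr : ∀ a, a ∉ P.wrA → M'.warr a = M.warr a
  qreg : ∀ x, x ∉ P.wrQ → M'.qreg x = M.qreg x
  qarr : ∀ a, a ∉ P.wrR → M'.qarr a = M.qarr a

theorem Same.refl (P : Program) (M : Memory) : Same P M M :=
  ⟨fun _ _ => rfl, fun _ _ => rfl, fun _ _ => rfl, fun _ _ => rfl⟩

theorem Same.trans {P : Program} {M M' M'' : Memory} (h : Same P M M') (h' : Same P M' M'') :
    Same P M M'' :=
  ⟨fun x hx => (h'.wreg x hx).trans (h.wreg x hx), fun x hx => (h'.warr x hx).trans (h.warr x hx),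
    fun x hx => (h'.qreg x hx).trans (h.qreg x hx), fun x hx => (h'.qarr x hx).trans (h.qarr x hx)⟩

theorem Same.mono {P Q : Program} {M M' : Memory} (h : Same P M M') (hw : P.wrW ⊆ Q.wrW)
    (ha : P.wrA ⊆ Q.wrA) (hq : P.wrQ ⊆ Q.wrQ) (hr : P.wrR ⊆ Q.wrR) : Same Q M M' :=
  ⟨fun x hx => h.wreg x fun h' => hx (hw h'), fun x hx => h.warr x fun h' => hx (ha h'),
    fun x hx => h.qreg x fun h' => hx (hq h'), fun x hx => h.qarr x fun h' => hx (hr h')⟩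

/-- The frame rule. Since the written locations are a syntactic matter, invariants need to mention
only what changes; everything else is recovered by deciding nonmembership in a list. -/
theorem Exec.same {w : ℕ} {P : Program} {M M' : Memory} {t r : ℕ} (h : Exec w P M t r M') :
    Same P M M' := by
  induction h with
  | skip M => exact .refl _ _
  | setW M x e _ =>
    exact ⟨fun y hy => by simp_all [Program.wrW], fun _ _ => rfl, fun _ _ => rfl, fun _ _ => rfl⟩
  | putW M a i e _ _ =>
    exact ⟨fun _ _ => rfl, fun y hy => by simp_all [Program.wrA], fun _ _ => rfl, fun _ _ => rfl⟩
  | setQ M x e _ =>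
    exact ⟨fun _ _ => rfl, fun _ _ => rfl, fun y hy => by simp_all [Program.wrQ], fun _ _ => rfl⟩
  | putQ M a i e _ _ =>
    exact ⟨fun _ _ => rfl, fun _ _ => rfl, fun _ _ => rfl, fun y hy => by simp_all [Program.wrR]⟩
  | seq _ _ h₁ h₂ =>
    exact (h₁.mono (by simp [Program.wrW]) (by simp [Program.wrA]) (by simp [Program.wrQ])
      (by simp [Program.wrR])).trans (h₂.mono (by simp [Program.wrW]) (by simp [Program.wrA])
      (by simp [Program.wrQ]) (by simp [Program.wrR]))
  | condTrue _ _ _ h₁ =>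
    exact h₁.mono (by simp [Program.wrW]) (by simp [Program.wrA]) (by simp [Program.wrQ])
      (by simp [Program.wrR])
  | condFalse _ _ _ h₁ =>
    exact h₁.mono (by simp [Program.wrW]) (by simp [Program.wrA]) (by simp [Program.wrQ])
      (by simp [Program.wrR])
  | loopDone _ _ => exact .refl _ _
  | loopStep _ _ _ _ h₁ h₂ =>
    exact (h₁.mono (by simp [Program.wrW]) (by simp [Program.wrA]) (by simp [Program.wrQ])
      (by simp [Program.wrR])).trans h₂

/-- On a machine with maximal word `w`, the program `P` started with memory `M` halts after time at
most `T`, with a memory that satisfies `Q`, and its time with rationals charged according to the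
number of bits is larger by a factor of at most `(2 + 2 * β) ^ 2`. -/
def Run (w β : ℕ) (P : Program) (M : Memory) (T : ℕ) (Q : Memory → Prop) : Prop :=
  ∃ t r M', Exec w P M t r M' ∧ t ≤ T ∧ r ≤ (2 + 2 * β) ^ 2 * t ∧ Q M'

/-! ### Proof rules for programs with time bounds -/

namespace Run

variable {w β : ℕ} {P P' : Program} {M : Memory} {T T' : ℕ} {Q R : Memory → Prop}

theorem mono (h : Run w β P M T Q) (hT : T ≤ T') (hQ : ∀ M', Same P M M' → Q M' → R M') :
    Run w β P M T' R := by
  obtain ⟨t, r, M', h₁, h₂, h₃, h₄⟩ := h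
  exact ⟨t, r, M', h₁, h₂.trans hT, h₃, hQ _ h₁.same h₄⟩

theorem seq (h : Run w β P M T Q) (h' : ∀ M', Same P M M' → Q M' → Run w β P' M' T' R) :
    Run w β (.seq P P') M (T + T') R := by
  obtain ⟨t, r, M', h₁, h₂, h₃, h₄⟩ := h
  obtain ⟨t', r', M'', h₁', h₂', h₃', h₄'⟩ := h' M' h₁.same h₄
  exact ⟨_, _, _, h₁.seq h₁', by omega, by rw [mul_add]; omega, h₄'⟩

theorem setW {x : ℕ} {e : WordExp} (he : e.Fits w M) (hQ : Q (M.setW x (e.val M))) :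
    Run w β (.setW x e) M (1 + e.cost) Q :=
  ⟨_, _, _, .setW M x e he, le_rfl, Nat.le_mul_of_pos_left _ (by positivity), hQ⟩

theorem putW {a : ℕ} {i e : WordExp} (hi : i.Fits w M) (he : e.Fits w M)
    (hQ : Q (M.putW a (i.val M) (e.val M))) :
    Run w β (.putW a i e) M (1 + i.cost + e.cost) Q :=
  ⟨_, _, _, .putW M a i e hi he, le_rfl, Nat.le_mul_of_pos_left _ (by positivity), hQ⟩

theorem setQ {x : ℕ} {e : RatExp} (he : e.Fits w M) (hs : e.Small β M)
    (hQ : Q (M.setQ x (e.val M))) : Run w β (.setQ x e) M (1 + e.cost) Q := by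
  refine ⟨_, _, _, .setQ M x e he, le_rfl, ?_, hQ⟩
  nlinarith [hs.bitCost_le, hs.ratBits_val_le]

theorem putQ {a : ℕ} {i : WordExp} {e : RatExp} (hi : i.Fits w M) (he : e.Fits w M)
    (hs : e.Small β M) (hQ : Q (M.putQ a (i.val M) (e.val M))) :
    Run w β (.putQ a i e) M (1 + i.cost + e.cost) Q := by
  refine ⟨_, _, _, .putQ M a i e hi he, le_rfl, ?_, hQ⟩
  nlinarith [hs.bitCost_le, hs.ratBits_val_le, Nat.zero_le (β * i.cost), Nat.zero_le i.cost,
    Nat.zero_le (β * β * i.cost)]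

/-- Tests on words only. -/
def _root_.ProbEval.Test.IsWord : Test → Prop
  | .isZero _ => False
  | _ => True

theorem _root_.ProbEval.Test.IsWord.bitCost_eq {b : Test} (h : b.IsWord) (M : Memory) :
    b.bitCost M = b.cost := by
  cases b <;> first | rfl | exact h.elim

theorem cond {b : Test} (hb : b.IsWord) (hf : b.Fits w M) (h₁ : b.Holds M → Run w β P M T Q)
    (h₂ : ¬ b.Holds M → Run w β P' M T' Q) :
    Run w β (.cond b P P') M (b.cost + max T T') Q := by
  have hB : 1 ≤ (2 + 2 * β) ^ 2 := Nat.one_le_pow _ _ (by omega)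
  by_cases h : b.Holds M
  · obtain ⟨t, r, M', h₃, h₄, h₅, h₆⟩ := h₁ h
    refine ⟨_, _, _, .condTrue hf h h₃, by omega, ?_, h₆⟩
    rw [hb.bitCost_eq]; nlinarith
  · obtain ⟨t, r, M', h₃, h₄, h₅, h₆⟩ := h₂ h
    refine ⟨_, _, _, .condFalse hf h h₃, by omega, ?_, h₆⟩
    rw [hb.bitCost_eq]; nlinarith

end Run

/-! ### Loop-free programs -/

namespace Program

/-- Weakest precondition of loop-free programs. -/
def wp (w β : ℕ) : Program → Memory → (Memory → Prop) → Prop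
  | skip, M, Q => Q M
  | setW x e, M, Q => e.Fits w M ∧ Q (M.setW x (e.val M))
  | putW a i e, M, Q => (i.Fits w M ∧ e.Fits w M) ∧ Q (M.putW a (i.val M) (e.val M))
  | setQ x e, M, Q => (e.Fits w M ∧ e.Small β M) ∧ Q (M.setQ x (e.val M))
  | putQ a i e, M, Q =>
    (i.Fits w M ∧ e.Fits w M ∧ e.Small β M) ∧ Q (M.putQ a (i.val M) (e.val M))
  | seq P P', M, Q => P.wp w β M fun M' => P'.wp w β M' Q
  | cond b P P', M, Q =>
    (b.IsWord ∧ b.Fits w M) ∧ (b.Holds M → P.wp w β M Q) ∧ (¬ b.Holds M → P'.wp w β M Q)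
  | loop _ _, _, _ => False

/-- Running time of loop-free programs. -/
def maxCost : Program → ℕ
  | skip => 1
  | setW _ e => 1 + e.cost
  | putW _ i e => 1 + i.cost + e.cost
  | setQ _ e => 1 + e.cost
  | putQ _ i e => 1 + i.cost + e.cost
  | seq P P' => P.maxCost + P'.maxCost
  | cond b P P' => b.cost + max P.maxCost P'.maxCost
  | loop _ _ => 0

end Program

theorem Run.of_wp {w β : ℕ} {P : Program} {M : Memory} {Q : Memory → Prop} (h : P.wp w β M Q) :
    Run w β P M P.maxCost Q := by
  induction P generalizing M Q with
  | skip => exact ⟨_, _, _, .skip M, le_rfl, Nat.le_mul_of_pos_left _ (by positivity), h⟩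
  | setW x e => exact .setW h.1 h.2
  | putW a i e => exact .putW h.1.1 h.1.2 h.2
  | setQ x e => exact .setQ h.1.1 h.1.2 h.2
  | putQ a i e => exact .putQ h.1.1 h.1.2.1 h.1.2.2 h.2
  | seq P P' h₁ h₂ => exact (h₁ h).seq fun _ _ h' => h₂ h'
  | cond b P P' h₁ h₂ => exact .cond h.1.1 h.1.2 (fun hb => h₁ (h.2.1 hb)) fun hb => h₂ (h.2.2 hb)
  | loop => exact h.elim

theorem Run.straight {w β c : ℕ} {P : Program} {M : Memory} {Q : Memory → Prop}
    (hc : P.maxCost ≤ c) (h : P.wp w β M Q) : Run w β P M c Q :=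
  (Run.of_wp h).mono hc fun _ _ h => h

theorem Run.step {w β : ℕ} {P P' : Program} {M : Memory} {T : ℕ} {Q : Memory → Prop} (c T' : ℕ)
    (hc : P.maxCost ≤ c) (hT : c + T' ≤ T) (h : P.wp w β M fun M' => Run w β P' M' T' Q) :
    Run w β (.seq P P') M T Q :=
  ((Run.of_wp h).seq fun _ _ h' => h').mono (by omega) fun _ _ h => h

theorem Run.andThen {w β : ℕ} {P P' : Program} {M : Memory} {T T₁ : ℕ}
    {Q R : Memory → Prop} (T₂ : ℕ) (h : Run w β P M T₁ Q) (hT : T₁ + T₂ ≤ T)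
    (h' : ∀ M', Same P M M' → Q M' → Run w β P' M' T₂ R) : Run w β (.seq P P') M T R :=
  (h.seq h').mono hT fun _ _ h => h

/-- `for i = 0, …, N - 1 do P`, where the registers `i` and `N` are not written by `P`. -/
def forLoop (i N : ℕ) (P : Program) : Program :=
  .seq (.setW i 0) (.loop (.lt (.reg i) (.reg N)) (.seq P (.setW i (.reg i + 1))))

/-- The invariant is required after the counter has been advanced. Each round costs 3 for the test
and 4 for the increment besides the body; the 5 is 2 for the initialization and 3 for the final
test. -/
theorem Run.forLoop {w β i N K : ℕ} {P : Program} {M : Memory} (I : ℕ → Memory → Prop)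
    (T : ℕ → ℕ) (hi : i ∉ P.wrW) (hN : N ∉ P.wrW) (hiN : i ≠ N) (hK : M.wreg N = K)
    (hKw : K < w) (h₀ : I 0 (M.setW i 0))
    (hstep : ∀ j < K, ∀ M', Same (ProbEval.forLoop i N P) M M' → M'.wreg i = j → M'.wreg N = K →
      I j M' → Run w β P M' (T j) fun M'' => I (j + 1) (M''.setW i (j + 1))) :
    Run w β (ProbEval.forLoop i N P) M (5 + ∑ j ∈ Finset.range K, (T j + 7)) (I K) := by
  have hB : 1 ≤ (2 + 2 * β) ^ 2 := Nat.one_le_pow _ _ (by omega)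
  have key : ∀ d j, j + d = K → ∀ M', Same (ProbEval.forLoop i N P) M M' → M'.wreg i = j →
      I j M' → Run w β (.loop (.lt (.reg i) (.reg N)) (.seq P (.setW i (.reg i + 1)))) M'
        (3 + ∑ j ∈ Finset.Ico j K, (T j + 7)) (I K) := by
    intro d
    induction d with
    | zero =>
      intro j hj M' hs hMi hI
      have hMN : M'.wreg N = K := by
        rw [← hK]; apply hs.wreg
        simp [ProbEval.forLoop, Program.wrW, hN, hiN.symm]
      have hj' : j = K := by omega
      subst hj'
      refine ⟨_, _, _, .loopDone ⟨trivial, trivial⟩ (by simp [hMi, hMN]), ?_, ?_, hI⟩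
      · show 3 ≤ _
        omega
      · exact Nat.le_mul_of_pos_left _ hB
    | succ d ih =>
      intro j hj M' hs hMi hI
      have hMN : M'.wreg N = K := by
        rw [← hK]; apply hs.wreg
        simp [ProbEval.forLoop, Program.wrW, hN, hiN.symm]
      obtain ⟨t, r, M₁, h₁, h₂, h₃, h₄⟩ := hstep j (by omega) M' hs hMi hMN hI
      have hM₁ : M₁.wreg i = j := by rw [h₁.same.wreg i hi, hMi]
      have h₅ : Exec w (.seq P (.setW i (.reg i + 1))) M' (t + 4) (r + 4) (M₁.setW i (j + 1)) := by
        refine h₁.seq ?_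
        have := Exec.setW (w := w) M₁ i (.reg i + 1) (by simp [hM₁]; omega)
        simp only [WordExp.val_add, WordExp.val_reg, WordExp.val_ofNat, hM₁] at this
        exact this
      have h₆ : Same (ProbEval.forLoop i N P) M (M₁.setW i (j + 1)) := by
        refine hs.trans (h₅.same.mono ?_ ?_ ?_ ?_) <;>
        simp [ProbEval.forLoop, Program.wrW, Program.wrA, Program.wrQ, Program.wrR]
      obtain ⟨t', r', M₂, g₁, g₂, g₃, g₄⟩ := ih (j + 1) (by omega) _ h₆ (by simp) h₄
      refine ⟨_, _, _, .loopStep ⟨trivial, trivial⟩ (by simp [hMi, hMN]; omega) h₅ g₁, ?_, ?_, g₄⟩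
      · rw [Finset.sum_eq_sum_Ico_succ_bot (by omega)]
        show 3 + (t + 4) + t' ≤ _
        omega
      · show 3 + (r + 4) + r' ≤ (2 + 2 * β) ^ 2 * (3 + (t + 4) + t')
        nlinarith
  have h := key K 0 (by omega) (M.setW i 0)
    (by
      refine ⟨fun y hy => ?_, fun _ _ => rfl, fun _ _ => rfl, fun _ _ => rfl⟩
      simp [ProbEval.forLoop, Program.wrW] at hy
      simp [hy]) (by simp) h₀
  rw [← Finset.range_eq_Ico] at h
  have h' := (Run.setW (w := w) (β := β) (M := M) (x := i) (e := 0) (Q := fun M' => M' = M.setW i 0)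
    (by simp) rfl).seq (T' := _) (R := I K) (fun M' _ hM' => hM' ▸ h)
  exact h'.mono (by show 2 + _ ≤ _; omega) fun _ _ h => h

theorem Run.forLoop_const {w β i N K T : ℕ} {P : Program} {M : Memory} (I : ℕ → Memory → Prop)
    (hi : i ∉ P.wrW) (hN : N ∉ P.wrW) (hiN : i ≠ N) (hK : M.wreg N = K)
    (hKw : K < w) (h₀ : I 0 (M.setW i 0))
    (hstep : ∀ j < K, ∀ M', Same (ProbEval.forLoop i N P) M M' → M'.wreg i = j → M'.wreg N = K →
      I j M' → Run w β P M' T fun M'' => I (j + 1) (M''.setW i (j + 1))) :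
    Run w β (ProbEval.forLoop i N P) M (5 + K * (T + 7)) (I K) := by
  have h := Run.forLoop I (fun _ => T) hi hN hiN hK hKw h₀ hstep
  simpa using h

end ProbEval

namespace ProbEval

/-! ## The algorithm -/

section Algorithm

open WordExp (reg get)

infixr:60 " ;; " => Program.seq

/-- Arrays `7` and `8` receive pointers to the last two sources of wires to each gate. -/
def collectInputs : Program :=
  forLoop 5 1
    (.setW 11 (get 2 (reg 5)) ;;
    -- A two-place stack per target: the previous source moves to array `8` before the new one
    -- enters array `7`.
    .putW 8 (reg 11) (get 7 (reg 11)) ;;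
    .putW 7 (reg 11) (get 1 (reg 5) + 1))

/-- Array `9` receives the bags in breadth-first order. -/
def orderBags : Program :=
  .putW 9 0 (reg 4) ;;
  .setW 12 1 ;;
  forLoop 5 2
    (.setW 6 (get 9 (reg 5)) ;;
    -- Testing the left pointer suffices, since the tree is full.
    .cond (.lt 0 (get 3 (reg 6)))
      (.putW 9 (reg 12) (get 3 (reg 6) - 1) ;;
      .putW 9 (reg 12 + 1) (get 4 (reg 6) - 1) ;;
      .setW 12 (reg 12 + 2))
      .skip)

/-- Mark the gates of the current bag in array `11`. -/
def markBag : Program :=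
  forLoop 9 8 (.putW 11 (get 6 (reg 7 + reg 9) + 1) 1)

/-- Append the gate at position `reg 9` of the current bag to the sorted list if it is not there
and its inputs in the bag are there. -/
def tryPlace : Program :=
  .setW 11 (get 6 (reg 7 + reg 9)) ;;
  -- Marks: 0 for a gate outside the bag, 1 for a gate of the bag not yet placed, 2 for a placed
  -- gate. Only an input with mark 1 blocks the gate.
  .cond (.eq (get 11 (reg 11 + 1)) 1)
    (.cond (.eq (get 11 (get 7 (reg 11))) 1) .skip
      (.cond (.eq (get 11 (get 8 (reg 11))) 1) .skip
        (.putW 10 (reg 7 + reg 12) (reg 11) ;;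
        .putW 11 (reg 11 + 1) 2 ;;
        .setW 12 (reg 12 + 1))))
    .skip

/-- Sort the gates of the current bag topologically, into array `10`. -/
def sortBag : Program :=
  -- As many rounds as gates suffice, because every round places at least one gate while some gate
  -- is missing.
  .setW 12 0 ;; forLoop 10 8 (forLoop 9 8 tryPlace)

/-- Assign to the current bag the gates whose inputs lie in the bag. -/
def assignGates : Program :=
  forLoop 9 8
    (.setW 11 (get 6 (reg 7 + reg 9)) ;;
    .cond (.eq (get 11 (get 7 (reg 11))) 0) .skip
      (.cond (.eq (get 11 (get 8 (reg 11))) 0) .skip (.putW 14 (reg 11) (reg 5 + 1))))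

/-- Clear the marks of the gates of the current bag in array `11`. -/
def unmarkBag : Program :=
  forLoop 9 8 (.putW 11 (get 6 (reg 7 + reg 9) + 1) 0)

/-- Sort all bags and assign each gate to a bag. -/
def prepareBags : Program :=
  -- Marks are shifted by one, so a null pointer reads cell `0`. The value 2 there makes an absent
  -- input count as placed and as belonging to the bag.
  .putW 11 0 2 ;;
  forLoop 5 2
    ((.setW 7 (get 5 (reg 5)) ;; .setW 8 (get 5 (reg 5 + 1) - reg 7)) ;;
    markBag ;; sortBag ;; assignGates ;; unmarkBag)

/-- Array `12` receives the weights of the gates of the current bag in the indices of its table. -/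
def setWeights : Program :=
  .setW 12 1 ;;
  forLoop 9 8 (.putW 12 (get 10 (reg 7 + reg 9) + 1) (reg 12) ;; .setW 12 (reg 12 + reg 12))

/-- Clear array `12`. -/
def clearWeights : Program :=
  forLoop 9 8 (.putW 12 (get 10 (reg 7 + reg 9) + 1) 0)

/-- The value expected at gate `reg 11`, which is not an input, in the row `reg 10`. -/
def expectedValue : Program :=
  -- Dividing by the weight `2 ^ p` extracts bit `p` of the row. For an absent input the weight in
  -- cell `0` is 0, and division by 0 yields the bit 0.
  .setW 18 (reg 10 / get 12 (get 7 (reg 11)) % 2) ;;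
  .setW 19 (reg 10 / get 12 (get 8 (reg 11)) % 2) ;;
  .cond (.eq (get 0 (reg 11)) 1) (.setW 13 0)
    (.cond (.eq (get 0 (reg 11)) 2) (.setW 13 1)
      (.cond (.eq (get 0 (reg 11)) 3) (.setW 13 (1 - reg 18))
        (.cond (.eq (get 0 (reg 11)) 4) (.setW 13 (reg 18 * reg 19))
          -- Disjunction of two bits: sums 0, 1, 2 are sent to 0, 1, 1.
          (.setW 13 ((reg 18 + reg 19 + 1) / 2)))))

/-- The factors of gate `reg 11` in the row `reg 10`, for the values `0` and `1` of the gate. -/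
def gateFactor : Program :=
  .cond (.eq (get 14 (reg 11)) (reg 6 + 1))
    (.cond (.eq (get 0 (reg 11)) 0)
      (.setQ 2 (.get 0 (reg 11)) ;; .setQ 3 (.get 1 (reg 11)))
      (expectedValue ;;
      .cond (.eq (reg 13) 0) (.setQ 2 1 ;; .setQ 3 0) (.setQ 2 0 ;; .setQ 3 1)) ;;
    .cond (.eq (reg 11) (reg 3)) (.setQ 2 0) .skip)
    (.setQ 2 1 ;; .setQ 3 1)

/-- The table of the current bag, at `reg 14`, receives the products of the factors of the gates
that are assigned to the bag. -/
def localTable : Program :=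
  (.putQ 2 (reg 14) 1 ;; .setW 12 1) ;;
  forLoop 9 8
    (.setW 11 (get 10 (reg 7 + reg 9)) ;;
    forLoop 10 12
      (gateFactor ;;
      -- The row for the value 1 of the new gate comes first, because it reads the old row, which
      -- the row for the value 0 then overwrites.
      .putQ 2 (reg 14 + reg 12 + reg 10) (.get 2 (reg 14 + reg 10) * .reg 3) ;;
      .putQ 2 (reg 14 + reg 10) (.get 2 (reg 14 + reg 10) * .reg 2)) ;;
    .setW 12 (reg 12 + reg 12))

/-- Array `16` receives the keys of the rows of the bag whose list starts at `reg 21` and has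
`reg 22` entries. -/
def fillKeys : Program :=
  (.putW 16 0 0 ;; .setW 12 1) ;;
  forLoop 9 22
    ((.setW 11 (get 10 (reg 21 + reg 9)) ;;
      -- The weight in the parent times the mark for the child: nonzero exactly at the gates that
      -- both bags contain.
      .setW 13 (get 12 (reg 11 + 1) * get 13 (reg 11 + 1))) ;;
    forLoop 10 12 (.putW 16 (reg 12 + reg 10) (get 16 (reg 10) + reg 13)) ;;
    .setW 12 (reg 12 + reg 12))

/-- Write `v` in array `13` for the gates of the bag whose list starts at `reg 16`. -/
def markChild (v : WordExp) : Program :=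
  forLoop 9 17 (.putW 13 (get 10 (reg 16 + reg 9) + 1) v)

/-- Rational array `3` receives the sums of the rows of the table at `reg 18` with the same key. -/
def sumRows : Program :=
  -- Only the cells at keys that occur are cleared; the others may hold leftovers of earlier
  -- messages, but are never read.
  forLoop 9 12 (.putQ 3 (get 16 (reg 9)) 0) ;;
  forLoop 9 12
    (.putQ 3 (get 16 (reg 9)) (.get 3 (get 16 (reg 9)) + .get 2 (reg 18 + reg 9)))

/-- Multiply the rows of the table at `reg 14` by the entries of rational array `3`. -/
def multiplyRows : Program :=
  forLoop 9 12
    (.putQ 2 (reg 14 + reg 9) (.get 2 (reg 14 + reg 9) * .get 3 (get 16 (reg 9))))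

/-- Multiply the table of the current bag by the message of its child `reg 15`. -/
def absorbBag : Program :=
  (.setW 16 (get 5 (reg 15)) ;; .setW 17 (get 5 (reg 15 + 1) - reg 16) ;;
    .setW 18 (get 15 (reg 15)) ;; .setW 21 (reg 16) ;; .setW 22 (reg 17)) ;;
  markChild 1 ;; fillKeys ;; sumRows ;;
  (.setW 21 (reg 7) ;; .setW 22 (reg 8)) ;;
  fillKeys ;; multiplyRows ;; markChild 0

/-- Multiply the table of the current bag by the message of the child to which array `a` points. -/
def absorbChild (a : ℕ) : Program :=
  .cond (.lt 0 (get a (reg 6))) (.setW 15 (get a (reg 6) - 1) ;; absorbBag) .skip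

/-- Compute the table of the bag `reg 6`. -/
def processBag : Program :=
  (.setW 7 (get 5 (reg 6)) ;; .setW 8 (get 5 (reg 6 + 1) - reg 7) ;;
    .putW 15 (reg 6) (reg 20) ;; .setW 14 (reg 20)) ;;
  setWeights ;;
  .setW 20 (reg 20 + reg 12) ;;
  localTable ;; absorbChild 3 ;; absorbChild 4 ;; clearWeights

/-- Compute the tables of all bags, children before parents. -/
def processBags : Program :=
  -- Breadth-first order read backwards, so that children precede parents.
  forLoop 5 2 (.setW 6 (get 9 (reg 2 - 1 - reg 5)) ;; processBag)

/-- Sum the table at `reg 14`. -/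
def sumTable : Program :=
  forLoop 9 12 (.setQ 1 (.reg 1 + .get 2 (reg 14 + reg 9))) ;;
  .setQ 0 (1 - .reg 1)

/-- The algorithm for the probability evaluation problem. -/
def evalProgram : Program :=
  collectInputs ;; orderBags ;; prepareBags ;; processBags ;; sumTable

end Algorithm

end ProbEval

namespace ProbEval

/-! ## Assignments of lists as numbers -/

section Code

variable {α : Type}

/-- The number whose binary digits are the values of the elements of the list. -/
def code : List α → (α → Bool) → ℕ
  | [], _ => 0
  | g :: L, x => (x g).toNat + 2 * code L x

theorem code_append_singleton (L : List α) (g : α) (x : α → Bool) :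
    code (L ++ [g]) x = code L x + 2 ^ L.length * (x g).toNat := by
  induction L with
  | nil => simp [code]
  | cons a L ih => simp only [List.cons_append, code, ih, List.length_cons]; ring

theorem code_lt (L : List α) (x : α → Bool) : code L x < 2 ^ L.length := by
  induction L with
  | nil => simp [code]
  | cons a L ih =>
    have := Bool.toNat_lt (x a)
    simp only [code, List.length_cons, pow_succ]
    omega

theorem code_congr {L : List α} {x y : α → Bool} (h : ∀ g ∈ L, x g = y g) :
    code L x = code L y := by
  induction L with
  | nil => rfl
  | cons a L ih => simp only [code, h a (by simp), ih fun g hg => h g (by simp [hg])]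

/-- This is how the program reads the value of a gate off a row number. -/
theorem code_div_mod (L : List α) (x : α → Bool) (p : ℕ) (h : p < L.length) :
    code L x / 2 ^ p % 2 = (x L[p]).toNat := by
  induction L generalizing p with
  | nil => simp at h
  | cons a L ih =>
    have := Bool.toNat_lt (x a)
    cases p with
    | zero => simp only [code, pow_zero, Nat.div_one, List.getElem_cons_zero]; omega
    | succ p =>
      simp only [code, pow_succ', ← Nat.div_div_eq_div_mul, List.getElem_cons_succ]
      rw [show ((x a).toNat + 2 * code L x) / 2 = code L x by omega]
      exact ih p (by simpa using h)

theorem eq_of_code_eq {L : List α} {x y : α → Bool} (h : code L x = code L y) :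
    ∀ g ∈ L, x g = y g := by
  intro g hg
  obtain ⟨p, hp, rfl⟩ := List.getElem_of_mem hg
  have h₁ := code_div_mod L x p hp
  rw [h, code_div_mod L y p hp] at h₁
  revert h₁
  cases x L[p] <;> cases y L[p] <;> simp

theorem exists_code [DecidableEq α] {L : List α} (hL : L.Nodup) (x₀ : α → Bool) {j : ℕ}
    (hj : j < 2 ^ L.length) : ∃ x, (∀ g ∉ L, x g = x₀ g) ∧ code L x = j := by
  induction L generalizing j with
  | nil => exact ⟨x₀, fun _ _ => rfl, by simpa [code] using (by simpa using hj : j = 0).symm⟩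
  | cons a L ih =>
    obtain ⟨ha, hL⟩ := List.nodup_cons.1 hL
    rw [List.length_cons, pow_succ] at hj
    obtain ⟨x, hx, hc⟩ := ih hL (j := j / 2) (by omega)
    refine ⟨Function.update x a (decide (j % 2 = 1)), fun g hg => ?_, ?_⟩
    · simp only [List.mem_cons, not_or] at hg
      rw [Function.update_of_ne hg.1, hx g hg.2]
    · have : code L (Function.update x a (decide (j % 2 = 1))) = code L x :=
        code_congr fun g hg => Function.update_of_ne (fun h : g = a => ha (h ▸ hg)) _ _
      simp only [code, this, hc, Function.update_self]
      rcases Nat.mod_two_eq_zero_or_one j with h | h <;> simp [h] <;> omega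

/-- The factor `c` is there for the induction: passing to the tail of the list doubles all weights.
-/
theorem mul_code_eq_sum [DecidableEq α] {L : List α} (hL : L.Nodup) (x : α → Bool) (c : ℕ)
    (pw : α → ℕ) (h : ∀ (p : ℕ) (hp : p < L.length), pw L[p] = c * 2 ^ p) :
    c * code L x = ∑ g ∈ L.toFinset, if x g then pw g else 0 := by
  induction L generalizing c with
  | nil => simp [code]
  | cons a L ih =>
    obtain ⟨ha, hL⟩ := List.nodup_cons.1 hL
    rw [List.toFinset_cons, Finset.sum_insert (by simpa using ha), ← ih hL (2 * c) fun p hp => by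
      have := h (p + 1) (by simpa using hp)
      rw [List.getElem_cons_succ] at this
      rw [this]; ring]
    have := h 0 (by simp)
    simp only [List.getElem_cons_zero, pow_zero, mul_one] at this
    cases hx : x a <;> simp [code, hx, this] <;> ring

theorem code_eq_sum [DecidableEq α] {L : List α} (hL : L.Nodup) (x : α → Bool)
    (pw : α → ℕ) (h : ∀ (p : ℕ) (hp : p < L.length), pw L[p] = 2 ^ p) :
    code L x = ∑ g ∈ L.toFinset, if x g then pw g else 0 := by
  rw [← mul_code_eq_sum hL x 1 pw (by simpa using h), one_mul]

end Code

/-! ## Sums over the values of some variables -/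

section SumOver

variable {α : Type} [Fintype α] [DecidableEq α]

/-- The sum of `f` over all assignments that agree with `x` outside `U`. -/
def sumOver (U : Finset α) (f : (α → Bool) → ℚ) (x : α → Bool) : ℚ :=
  ∑ y with ∀ g ∉ U, y g = x g, f y

/-- `f` does not depend on the variables in `U`. -/
def Indep (f : (α → Bool) → ℚ) (U : Finset α) : Prop :=
  ∀ x y, (∀ g ∉ U, x g = y g) → f x = f y

theorem sumOver_empty (f : (α → Bool) → ℚ) (x : α → Bool) : sumOver ∅ f x = f x := by
  have : (Finset.univ.filter fun y : α → Bool => ∀ g ∉ (∅ : Finset α), y g = x g) = {x} := by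
    ext y; simp [funext_iff]
  rw [sumOver, this, Finset.sum_singleton]

theorem sumOver_univ (f : (α → Bool) → ℚ) (x : α → Bool) :
    sumOver Finset.univ f x = ∑ y, f y := by
  simp [sumOver]

theorem sumOver_mul {f h : (α → Bool) → ℚ} {U : Finset α} (hh : Indep h U) (x : α → Bool) :
    sumOver U (fun y => f y * h y) x = sumOver U f x * h x := by
  rw [sumOver, sumOver, Finset.sum_mul]
  refine Finset.sum_congr rfl fun y hy => ?_
  rw [hh y x (Finset.mem_filter.1 hy).2]

/-- Assignments that agree with `x` outside `U'` correspond to those that agree with `y` there, by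
keeping the values on `U'`; corresponding assignments differ only where `x` and `y` do. -/
theorem Indep.sumOver {f : (α → Bool) → ℚ} {U : Finset α} (hf : Indep f U) (U' : Finset α) :
    Indep (sumOver U' f) U := by
  intro x y hxy
  refine Finset.sum_bij' (fun z _ g => if g ∈ U' then z g else y g)
    (fun z _ g => if g ∈ U' then z g else x g) ?_ ?_ ?_ ?_ ?_
  · intro z _; simp +contextual
  · intro z _; simp +contextual
  · intro z hz; funext g
    by_cases h : g ∈ U'
    · simp [h]
    · simp [h, (Finset.mem_filter.1 hz).2 g h]
  · intro z hz; funext g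
    by_cases h : g ∈ U'
    · simp [h]
    · simp [h, (Finset.mem_filter.1 hz).2 g h]
  · intro z hz
    refine hf _ _ fun g hg => ?_
    by_cases h : g ∈ U'
    · simp [h]
    · simp [h, (Finset.mem_filter.1 hz).2 g h, hxy g hg]

/-- Because the two sets are disjoint, the intermediate assignment is determined by the final one:
it takes the values of the latter on `U` and those of `x` elsewhere. -/
theorem sumOver_sumOver {U U' : Finset α} (hU : Disjoint U U') (f : (α → Bool) → ℚ)
    (x : α → Bool) : sumOver U (sumOver U' f) x = sumOver (U ∪ U') f x := by
  simp only [sumOver]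
  rw [Finset.sum_sigma']
  refine Finset.sum_bij' (fun p _ => p.2) (fun z _ => ⟨fun g => if g ∈ U then z g else x g, z⟩)
    ?_ ?_ ?_ ?_ ?_
  · rintro ⟨y, z⟩ h
    simp only [Finset.mem_sigma, Finset.mem_filter, Finset.mem_univ, true_and,
      Finset.mem_union, not_or] at h ⊢
    exact fun g hg => (h.2 g hg.2).trans (h.1 g hg.1)
  · intro z h
    simp only [Finset.mem_sigma, Finset.mem_filter, Finset.mem_univ, true_and,
      Finset.mem_union, not_or] at h ⊢
    refine ⟨fun g hg => if_neg hg, fun g hg => ?_⟩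
    by_cases h' : g ∈ U
    · simp [h']
    · simp [h', h g ⟨h', hg⟩]
  · rintro ⟨y, z⟩ h
    simp only [Finset.mem_sigma, Finset.mem_filter, Finset.mem_univ, true_and] at h
    have : (fun g => if g ∈ U then z g else x g) = y := by
      funext g
      by_cases h' : g ∈ U
      · rw [if_pos h', h.2 g (Finset.disjoint_left.1 hU h')]
      · rw [if_neg h', h.1 g h']
    simp [this]
  · intro z h; rfl
  · intro p h; rfl

/-- Distributivity: each function is constant along the variables that the other one sums out. This
is what lets messages be computed separately for each child. -/
theorem sumOver_mul_sumOver {U U' : Finset α} (hU : Disjoint U U') {f f' : (α → Bool) → ℚ}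
    (hf : Indep f U') (hf' : Indep f' U) (x : α → Bool) :
    sumOver U f x * sumOver U' f' x = sumOver (U ∪ U') (fun y => f y * f' y) x := by
  rw [← sumOver_sumOver hU, ← sumOver_mul (hf'.sumOver U')]
  congr 1
  funext y
  simp only [mul_comm (f _)]
  exact (sumOver_mul hf y).symm

/-- Row numbers are in bijection with the assignments of the listed variables, the remaining ones
being frozen at `x`. It connects loops over rows with sums over assignments. -/
theorem sum_code {L : List α} (hL : L.Nodup) (F : ℕ → ℚ) (x : α → Bool) :
    ∑ j ∈ Finset.range (2 ^ L.length), F j = sumOver L.toFinset (fun y => F (code L y)) x := by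
  symm
  refine Finset.sum_nbij (code L) ?_ ?_ ?_ ?_
  · intro y _; simpa using code_lt L y
  · intro y hy z hz h
    simp only [Finset.coe_filter, Finset.mem_univ, true_and, Set.mem_ofPred_eq,
      List.mem_toFinset] at hy hz
    funext g
    by_cases hg : g ∈ L
    · exact eq_of_code_eq h g hg
    · rw [hy g hg, hz g hg]
  · intro j hj
    obtain ⟨y, hy, hc⟩ := exists_code hL x (by simpa using hj)
    exact ⟨y, by simpa using hy, hc⟩
  · intro y _; rfl

end SumOver

/-! ## Trees -/

namespace FullBinTree

variable {V : Type} (T : FullBinTree V)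

/-- `v` is a child of `u`. -/
def Child (u v : V) : Prop := T.left u = some v ∨ T.right u = some v

variable {T}

/-- Induction along the path from the root: the root has no parent, and since parents are unique, a
cycle through a node also passes through its parent. -/
theorem not_transGen_self (v : V) : ¬ Relation.TransGen T.Child v v := by
  induction T.reachable v with
  | refl =>
    intro h
    obtain ⟨u, -, hu⟩ := Relation.TransGen.tail'_iff.1 h
    exact T.root_no_parent u hu
  | tail _ h₁ ih =>
    intro h
    obtain ⟨u, hu, hu'⟩ := Relation.TransGen.tail'_iff.1 h
    rw [T.parent_unique u _ _ hu' h₁] at hu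
    exact ih (Relation.TransGen.head' h₁ hu)

variable [Fintype V]

open Classical in
/-- The descendants of a node, with the node itself. -/
noncomputable def desc (T : FullBinTree V) (u : V) : Finset V :=
  Finset.univ.filter (Relation.ReflTransGen T.Child u)

theorem mem_desc {u v : V} : v ∈ T.desc u ↔ Relation.ReflTransGen T.Child u v := by
  simp [desc]

theorem self_mem_desc (u : V) : u ∈ T.desc u := mem_desc.2 .refl

theorem mem_desc_iff {u v : V} : v ∈ T.desc u ↔ v = u ∨ ∃ w, T.Child u w ∧ v ∈ T.desc w := by
  rw [mem_desc, Relation.ReflTransGen.cases_head_iff]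
  simp [mem_desc, eq_comm]

theorem notMem_desc_of_child {u v : V} (h : T.Child u v) : u ∉ T.desc v := fun h' =>
  not_transGen_self u (Relation.TransGen.head' h (mem_desc.1 h'))

/-- The only edge that leaves the descendants of a node leads to its parent. -/
theorem eq_or_mem_desc {u v w : V} (hv : v ∈ T.desc u) (hw : T.Child w v) :
    v = u ∨ w ∈ T.desc u := by
  rcases Relation.ReflTransGen.cases_tail (mem_desc.1 hv) with h | ⟨w', h, h'⟩
  · exact .inl h
  · rw [T.parent_unique w w' v hw h']; exact .inr (mem_desc.2 h)

/-- Climbing from a common descendant, one stays below `w` until `v` is reached; then `v = w`, or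
the parent `u` would lie below its own child. -/
theorem disjoint_desc {u v w : V} (hv : T.Child u v) (hw : T.Child u w) (hvw : v ≠ w) :
    Disjoint (T.desc v) (T.desc w) := by
  rw [Finset.disjoint_left]
  intro a ha
  rw [mem_desc] at ha
  induction ha with
  | refl =>
    intro h
    rcases eq_or_mem_desc h hv with h | h
    · exact hvw h
    · exact notMem_desc_of_child hw h
  | tail h₁ h₂ ih =>
    intro h
    rcases eq_or_mem_desc h h₂ with rfl | h
    · rw [T.parent_unique _ _ _ h₂ hw] at h₁
      exact notMem_desc_of_child hv (mem_desc.2 h₁)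
    · exact ih h

theorem desc_root : T.desc T.root = Finset.univ :=
  Finset.eq_univ_of_forall fun v => mem_desc.2 (T.reachable v)

omit [Fintype V] in
theorem reachable_graph (u v : V) : T.graph.Reachable u v := by
  have key : ∀ v, T.graph.Reachable T.root v := by
    intro v
    induction T.reachable v with
    | refl => exact .refl _
    | @tail a b _ h ih =>
      refine ih.trans (SimpleGraph.Adj.reachable ?_)
      refine (SimpleGraph.fromRel_adj _ _ _).2 ⟨?_, .inl h⟩
      rintro rfl
      exact not_transGen_self a (.single h)
  exact (key u).symm.trans (key v)

end FullBinTree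

namespace TreeDecomposition

variable {Rel : Type} {ar : Rel → ℕ} {D : Type} {I : RelInstance ar D} {B : Type} [Fintype B]
  (T : TreeDecomposition I B)

/-- A path from inside the subtree of `l` to the outside must use the edge between `l` and `b`, the
only one leaving the subtree. The connectivity axiom then puts `a` into both ends. -/
theorem mem_dom_of_mem {a : D} {b l c₁ c₂ : B} (hl : T.Child b l) (h₁ : c₁ ∈ T.desc l)
    (h₂ : c₂ ∉ T.desc l) (ha₁ : a ∈ T.dom c₁) (ha₂ : a ∈ T.dom c₂) :
    a ∈ T.dom b ∧ a ∈ T.dom l := by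
  obtain ⟨p, hp⟩ := (T.reachable_graph c₁ c₂).exists_isPath
  obtain ⟨d, hd, hd₁, hd₂⟩ := p.exists_boundary_dart (T.desc l) h₁ h₂
  have hc := T.connected a c₁ c₂ ha₁ ha₂ p hp
  obtain ⟨-, h | h⟩ := (SimpleGraph.fromRel_adj _ _ _).1 d.adj
  · exact absurd (FullBinTree.mem_desc.2 ((FullBinTree.mem_desc.1 hd₁).tail h)) hd₂
  · rcases FullBinTree.eq_or_mem_desc hd₁ h with h' | h'
    · have : d.snd = b := T.parent_unique _ _ l (h' ▸ h) hl
      exact ⟨this ▸ hc _ (p.dart_snd_mem_support_of_mem_darts hd),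
        h' ▸ hc _ (p.dart_fst_mem_support_of_mem_darts hd)⟩
    · exact absurd h' hd₂

end TreeDecomposition

/-! ## Tables of the bags -/

section Tables

variable {Rel : Type} {ar : Rel → ℕ} {D : Type} [Fintype D] [DecidableEq D]
  {I : RelInstance ar D} {B : Type} [Fintype B] [DecidableEq B] (T : TreeDecomposition I B)
  (asg : D → B) (fac : D → (D → Bool) → ℚ)

/-- The product of the factors that are assigned to the bags in `A`. -/
def prodOf (A : Finset B) (x : D → Bool) : ℚ := ∏ g with asg g ∈ A, fac g x

/-- The elements of the bags below `b`. -/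
noncomputable def below (b : B) : Finset D := (T.desc b).biUnion T.dom

/-- The table of the bag `b`. -/
noncomputable def table (b : B) : (D → Bool) → ℚ :=
  sumOver (below T b \ T.dom b) (prodOf asg fac (T.desc b))

/-- Each factor depends only on the bag to which it is assigned. -/
def Local : Prop :=
  ∀ g x y, (∀ g' ∈ T.dom (asg g), x g' = y g') → fac g x = fac g y

variable {T asg fac}

omit [DecidableEq D] [Fintype B] in
theorem Local.indep (h : Local T asg fac) {A : Finset B} {U : Finset D}
    (hU : ∀ b ∈ A, Disjoint (T.dom b) U) : Indep (prodOf asg fac A) U := fun x y hxy =>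
  Finset.prod_congr rfl fun g hg => h g x y fun g' hg' => hxy g' fun hg'' =>
    Finset.disjoint_left.1 (hU _ (Finset.mem_filter.1 hg).2) hg' hg''

omit [Fintype B] in
theorem prodOf_union {A A' : Finset B} (h : Disjoint A A') (x : D → Bool) :
    prodOf asg fac (A ∪ A') x = prodOf asg fac A x * prodOf asg fac A' x := by
  rw [prodOf, prodOf, prodOf, ← Finset.prod_union]
  · congr 1; ext g; simp
  · rw [Finset.disjoint_left]
    intro g hg hg'
    exact Finset.disjoint_left.1 h (Finset.mem_filter.1 hg).2 (Finset.mem_filter.1 hg').2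

omit [Fintype D] [DecidableEq B] in
theorem mem_below {b : B} {g : D} : g ∈ below T b ↔ ∃ c ∈ T.desc b, g ∈ T.dom c := by
  simp [below]

omit [Fintype D] [DecidableEq B] in
theorem dom_subset_below {b c : B} (h : c ∈ T.desc b) : T.dom c ⊆ below T b := fun _ hg =>
  mem_below.2 ⟨c, h, hg⟩

/-- The message of a child. -/
theorem sumOver_table {b l : B} (hl : T.Child b l) :
    sumOver (T.dom l \ T.dom b) (table T asg fac l) =
      sumOver (below T l \ T.dom b) (prodOf asg fac (T.desc l)) := by
  funext x
  have h₁ : Disjoint (T.dom l \ T.dom b) (below T l \ T.dom l) := by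
    rw [Finset.disjoint_left]
    intro g hg hg'
    exact (Finset.mem_sdiff.1 hg').2 (Finset.mem_sdiff.1 hg).1
  have h₂ : T.dom l \ T.dom b ∪ below T l \ T.dom l = below T l \ T.dom b := by
    ext g
    simp only [Finset.mem_union, Finset.mem_sdiff]
    constructor
    · rintro (h | h)
      · exact ⟨dom_subset_below (FullBinTree.self_mem_desc l) h.1, h.2⟩
      · refine ⟨h.1, fun hb => h.2 ?_⟩
        obtain ⟨c, hc, hg⟩ := mem_below.1 h.1
        -- A gate from the subtree of `l` that also occurs in `b`, outside this subtree, must occur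
        -- in `l`. So nothing that `b` retains has been summed out in the table of `l`.
        exact (T.mem_dom_of_mem hl hc (FullBinTree.notMem_desc_of_child hl) hg hb).2
    · intro h
      by_cases h' : g ∈ T.dom l
      · exact .inl ⟨h', h.2⟩
      · exact .inr ⟨h.1, h'⟩
  rw [table, sumOver_sumOver h₁, h₂]

/-- Multiplication by the message of a child `l` of `b`, where `A` consists of bags outside the
subtree of `l`. -/
theorem sumOver_mul_message (h : Local T asg fac) {b l : B} (hl : T.Child b l) {A : Finset B}
    (hA : ∀ a ∈ A, a ∉ T.desc l) {U : Finset D} (hU : Disjoint U (below T l)) (x : D → Bool) :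
    sumOver U (prodOf asg fac A) x * sumOver (T.dom l \ T.dom b) (table T asg fac l) x =
      sumOver (U ∪ below T l \ T.dom b) (prodOf asg fac (A ∪ T.desc l)) x := by
  rw [sumOver_table hl, sumOver_mul_sumOver]
  · congr 1
    funext y
    exact (prodOf_union (Finset.disjoint_left.2 hA) y).symm
  · exact hU.mono_right Finset.sdiff_subset
  -- The gates summed out by the message are absent from `b`, so by connectivity they occur in no
  -- bag of `A`.
  · refine h.indep fun a ha => Finset.disjoint_left.2 fun g hg hg' => ?_
    obtain ⟨hg₁, hg₂⟩ := Finset.mem_sdiff.1 hg'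
    obtain ⟨c, hc, hg₃⟩ := mem_below.1 hg₁
    exact hg₂ (T.mem_dom_of_mem hl hc (hA a ha) hg₃ hg).1
  · refine h.indep fun a ha => Finset.disjoint_left.2 fun g hg hg' => ?_
    exact Finset.disjoint_left.1 hU hg' (dom_subset_below ha hg)

theorem table_of_leaf {b : B} (hb : ∀ c, ¬ T.Child b c) :
    table T asg fac b = prodOf asg fac {b} := by
  have h : T.desc b = {b} := by
    ext c
    rw [FullBinTree.mem_desc_iff, Finset.mem_singleton]
    exact ⟨fun h => h.resolve_right fun ⟨w, hw, _⟩ => hb w hw, .inl⟩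
  funext x
  rw [table, below, h, Finset.singleton_biUnion, sdiff_self, Finset.bot_eq_empty, sumOver_empty]

/-- The table of a bag without the message of its right child. -/
theorem prodOf_mul_message (h : Local T asg fac) {b l : B} (hl : T.Child b l) (x : D → Bool) :
    prodOf asg fac {b} x * sumOver (T.dom l \ T.dom b) (table T asg fac l) x =
      sumOver (below T l \ T.dom b) (prodOf asg fac ({b} ∪ T.desc l)) x := by
  have := sumOver_mul_message h hl (A := {b}) (U := ∅)
    (by simpa using FullBinTree.notMem_desc_of_child hl) (Finset.disjoint_empty_left _) x
  rwa [sumOver_empty, Finset.empty_union] at this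

/-- The recursion of the dynamic program. The subtree of `b` is the disjoint union of `b` and the
two child subtrees, and a gate common to both child subtrees lies in `b`; hence the sets of gates
summed out below `l` and below `r` are disjoint. -/
theorem table_of_children (h : Local T asg fac) {b l r : B} (hl : T.left b = some l)
    (hr : T.right b = some r) (x : D → Bool) :
    prodOf asg fac {b} x * sumOver (T.dom l \ T.dom b) (table T asg fac l) x *
      sumOver (T.dom r \ T.dom b) (table T asg fac r) x = table T asg fac b x := by
  have hl' : T.Child b l := .inl hl
  have hr' : T.Child b r := .inr hr
  have hlr : l ≠ r := by rintro rfl; exact T.left_ne_right b l hl hr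
  have hd := FullBinTree.disjoint_desc hl' hr' hlr
  have hdesc : T.desc b = {b} ∪ T.desc l ∪ T.desc r := by
    ext c
    rw [FullBinTree.mem_desc_iff]
    simp only [FullBinTree.Child, hl, hr, Option.some.injEq, Finset.mem_union,
      Finset.mem_singleton]
    constructor
    · rintro (h | ⟨w, rfl | rfl, h⟩) <;> tauto
    · rintro ((h | h) | h)
      · exact .inl h
      · exact .inr ⟨l, .inl rfl, h⟩
      · exact .inr ⟨r, .inr rfl, h⟩
  rw [prodOf_mul_message h hl', sumOver_mul_message h hr', table, hdesc]
  · congr 1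
    simp only [below, hdesc]
    ext g
    simp only [Finset.mem_union, Finset.mem_sdiff, Finset.mem_biUnion, Finset.mem_singleton]
    constructor
    · rintro (⟨⟨c, hc, hg⟩, hg'⟩ | ⟨⟨c, hc, hg⟩, hg'⟩)
      · exact ⟨⟨c, .inl (.inr hc), hg⟩, hg'⟩
      · exact ⟨⟨c, .inr hc, hg⟩, hg'⟩
    · rintro ⟨⟨c, (rfl | hc) | hc, hg⟩, hg'⟩
      · exact absurd hg hg'
      · exact .inl ⟨⟨c, hc, hg⟩, hg'⟩
      · exact .inr ⟨⟨c, hc, hg⟩, hg'⟩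
  · intro a ha
    rcases Finset.mem_union.1 ha with ha | ha
    · rw [Finset.mem_singleton.1 ha]; exact FullBinTree.notMem_desc_of_child hr'
    · exact Finset.disjoint_left.1 hd ha
  · rw [Finset.disjoint_left]
    intro g hg hg'
    obtain ⟨hg₁, hg₂⟩ := Finset.mem_sdiff.1 hg
    obtain ⟨c, hc, hgc⟩ := mem_below.1 hg₁
    obtain ⟨c', hc', hgc'⟩ := mem_below.1 hg'
    exact hg₂ (T.mem_dom_of_mem hl' hc (Finset.disjoint_right.1 hd hc') hgc hgc').1

/-- The gates of the root and those summed out below it are together all gates, and every factor is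
charged to some bag. -/
theorem sumOver_table_root (hcov : ∀ g, ∃ b, g ∈ T.dom b) (x : D → Bool) :
    sumOver (T.dom T.root) (table T asg fac T.root) x = ∑ y, ∏ g, fac g y := by
  rw [table, sumOver_sumOver Finset.disjoint_sdiff]
  have h : T.dom T.root ∪ below T T.root \ T.dom T.root = Finset.univ := by
    rw [Finset.union_sdiff_of_subset (dom_subset_below (FullBinTree.self_mem_desc _))]
    refine Finset.eq_univ_of_forall fun g => ?_
    obtain ⟨b, hb⟩ := hcov g
    exact mem_below.2 ⟨b, by simp [FullBinTree.desc_root], hb⟩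
  rw [h, sumOver_univ, FullBinTree.desc_root]
  simp [prodOf]

end Tables

end ProbEval

namespace ProbEval

/-! ## Factors of gates -/

/-- The value of a gate that is not an input, from the values of its (at most two) inputs. -/
def GateKind.expected : GateKind → Bool → Bool → Bool
  | .inp, _, _ => false
  | .zero, _, _ => false
  | .one, _, _ => true
  | .neg, x, _ => !x
  | .and, x, y => x && y
  | .or, x, y => x || y

/-- The value at an optional gate, `false` if there is none. -/
def valueAt {α : Type} (x : α → Bool) (o : Option α) : Bool := o.elim false x

section Factors

variable {n : ℕ} (C : Circuit (Fin n)) (ins : Fin n → List (Fin n))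

/-- `ins g` lists the gates with a wire to `g`. -/
structure Inputs : Prop where
  nodup : ∀ g, (ins g).Nodup
  mem : ∀ g g', g' ∈ ins g ↔ (g', g) ∈ C.wires

variable {C ins}

theorem Inputs.length (h : Inputs C ins) (g : Fin n) : (ins g).length = C.fanin g := by
  rw [← List.toFinset_card_of_nodup (h.nodup g), Circuit.fanin]
  congr 1
  ext g'
  simp [h.mem]

theorem Inputs.length_neg (h : Inputs C ins) {g : Fin n} (hg : C.kind g = .neg) :
    (ins g).length = 1 := by
  obtain ⟨g', hg', hu⟩ := C.neg_fanin g hg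
  rw [h.length, Circuit.fanin, Finset.card_eq_one]
  refine ⟨g', ?_⟩
  ext g''
  simp only [Finset.mem_filter, Finset.mem_univ, true_and, Finset.mem_singleton]
  exact ⟨hu g'', fun h => h ▸ hg'⟩

theorem Inputs.eq_nil (h : Inputs C ins) {g : Fin n} (hg : C.kind g = .inp) : ins g = [] :=
  List.eq_nil_iff_forall_not_mem.2 fun g' hg' => C.inp_fanin g hg g' ((h.mem g g').1 hg')

theorem Inputs.length_le (h : Inputs C ins) (hC : C.IsArityTwo) (g : Fin n) :
    (ins g).length ≤ 2 := by
  cases hg : C.kind g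
  · simp [h.eq_nil hg]
  · rw [h.length, hC.2 g (.inl hg)]; omega
  · rw [h.length, hC.2 g (.inr hg)]; omega
  · rw [h.length_neg hg]; omega
  · rw [h.length, hC.1 g (.inl hg)]
  · rw [h.length, hC.1 g (.inr hg)]

/-- The order in which the inputs are listed does not matter, since conjunction and disjunction are
symmetric. -/
theorem Inputs.gateValue_eq (h : Inputs C ins) (hC : C.IsArityTwo) (ν : C.Inp → Bool)
    (x : Fin n → Bool) {g : Fin n} (hg : C.kind g ≠ .inp) :
    C.gateValue ν g (fun g' _ => x g') =
      (C.kind g).expected (valueAt x (ins g)[0]?) (valueAt x (ins g)[1]?) := by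
  rw [Circuit.gateValue, dif_neg hg]
  have hm := h.mem g
  cases hk : C.kind g
  · exact absurd hk hg
  · rfl
  · rfl
  · obtain ⟨a, ha⟩ := List.length_eq_one_iff.1 (h.length_neg hk)
    simp only [ha, List.mem_singleton] at hm
    simp [← hm, ha, GateKind.expected, valueAt]
  · obtain ⟨a, b, ha⟩ := List.length_eq_two.1 ((h.length g).trans (hC.1 g (.inl hk)))
    simp only [ha, List.mem_cons, List.not_mem_nil, or_false] at hm
    simp [← hm, ha, GateKind.expected, valueAt]
  · obtain ⟨a, b, ha⟩ := List.length_eq_two.1 ((h.length g).trans (hC.1 g (.inr hk)))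
    simp only [ha, List.mem_cons, List.not_mem_nil, or_false] at hm
    simp [← hm, ha, GateKind.expected, valueAt]

variable (π : ProbValuation C) (ins)

/-- The factor of the gate `g` with value `v`, where the inputs have the values in `x`; the output
gate must be `true`. -/
def gateWeight (g : Fin n) (v : Bool) (x : Fin n → Bool) : ℚ :=
  if g = C.out ∧ v = false then 0
  else if h : C.kind g = .inp then π.prob ⟨g, h⟩ v
  else if v = (C.kind g).expected (valueAt x (ins g)[0]?) (valueAt x (ins g)[1]?) then 1 else 0

/-- The factor of the gate `g` in the assignment `x`. -/
def factor (g : Fin n) (x : Fin n → Bool) : ℚ := gateWeight ins π g (x g) x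

variable {ins}

theorem valueAt_congr {x y : Fin n → Bool} {l : List (Fin n)} (h : ∀ g ∈ l, x g = y g) (i : ℕ) :
    valueAt x l[i]? = valueAt y l[i]? := by
  cases hi : l[i]? with
  | none => rfl
  | some a => exact h a (List.mem_of_getElem? hi)

theorem gateWeight_congr {x y : Fin n → Bool} (g : Fin n) (v : Bool)
    (h : ∀ g' ∈ ins g, x g' = y g') : gateWeight ins π g v x = gateWeight ins π g v y := by
  simp only [gateWeight, valueAt_congr h]

theorem eval_inp (ν : C.Inp → Bool) (g : C.Inp) : C.eval ν g.1 = ν g := by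
  rw [Circuit.eval_eq, Circuit.gateValue, dif_pos g.2]

/-- A nonzero product forces every gate to have the value computed from its inputs, hence the
assignment is an evaluation with output `true`. Evaluation is injective on valuations, and at such
an evaluation the product is the probability of the valuation. -/
theorem sum_prod_factor (h : Inputs C ins) (hC : C.IsArityTwo) :
    ∑ x, ∏ g, factor ins π g x = π.outProb true := by
  symm
  refine Finset.sum_of_injOn C.eval ?_ (by simp) ?_ ?_
  · intro ν _ ν' _ hν
    funext g
    rw [← eval_inp ν g, ← eval_inp ν' g, hν]
  · intro x _ hx
    by_contra hne
    apply hx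
    rw [← ne_eq, Finset.prod_ne_zero_iff] at hne
    have hout : x C.out = true := by
      have := hne C.out (Finset.mem_univ _)
      by_contra hf
      simp [factor, gateWeight, hf] at this
    -- Well-founded induction along the wires: local consistency at every gate determines the
    -- assignment from its input gates.
    have heq : ∀ g, x g = C.eval (fun g => x g.1) g := by
      intro g
      induction g using C.wires_wf.induction with
      | _ g ih =>
        by_cases hg : C.kind g = .inp
        · exact (eval_inp (fun g : C.Inp => x g.1) ⟨g, hg⟩).symm
        · have := hne g (Finset.mem_univ _)
          rw [factor, gateWeight] at this
          split_ifs at this with h₁ h₂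
          · exact absurd rfl this
          · rw [Circuit.eval_eq, h.gateValue_eq hC _ _ hg, h₂]
            rw [valueAt_congr (fun g' hg' => ih g' ((h.mem g g').1 hg')) 0,
              valueAt_congr (fun g' hg' => ih g' ((h.mem g g').1 hg')) 1]
          · exact absurd rfl this
    refine ⟨fun g => x g.1, ?_, (funext heq).symm⟩
    simp [← heq, hout]
  · intro ν hν
    have hν : C.eval ν C.out = true := by simpa using hν
    rw [← Fintype.prod_subtype_mul_prod_subtype (fun g => C.kind g = .inp)]
    have h₁ : ∏ g : {g // ¬ C.kind g = .inp}, factor ins π g.1 (C.eval ν) = 1 := by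
      refine Finset.prod_eq_one fun g _ => ?_
      have hg : C.eval ν g.1 = _ := (C.eval_eq ν g.1).trans (h.gateValue_eq hC ν _ g.2)
      rw [factor, gateWeight, if_neg, dif_neg g.2, if_pos hg]
      rintro ⟨h₂, h₃⟩
      rw [h₂, hν] at h₃
      cases h₃
    rw [h₁, mul_one]
    refine Finset.prod_congr rfl fun g _ => ?_
    rw [factor, gateWeight, if_neg, dif_pos g.2, eval_inp]
    rintro ⟨h₂, h₃⟩
    rw [h₂, hν] at h₃
    cases h₃

/-- The product distribution has total mass 1: the sum of products factors into one sum per input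
gate. Hence a single computation, for the output `true`, suffices. -/
theorem outProb_false : π.outProb false = 1 - π.outProb true := by
  have h₁ : π.outProb false + π.outProb true = ∑ ν : C.Inp → Bool, ∏ g, π.prob g (ν g) := by
    rw [← Finset.sum_filter_add_sum_filter_not Finset.univ (fun ν => C.eval ν C.out = false)]
    simp [ProbValuation.outProb]
  have h₂ : ∑ ν : C.Inp → Bool, ∏ g, π.prob g (ν g) = ∏ g, ∑ v, π.prob g v := by
    rw [Finset.prod_univ_sum, Fintype.piFinset_univ]
  have h₃ : ∏ g, ∑ v, π.prob g v = 1 := Finset.prod_eq_one fun g _ => by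
    rw [Fintype.sum_bool, add_comm, π.sum_eq_one]
  linarith

theorem outProb_nonneg (v : Bool) : 0 ≤ π.outProb v :=
  Finset.sum_nonneg fun _ _ => Finset.prod_nonneg fun _ _ => π.nonneg _ _

/-- The fact that encodes `g` lists `g` with all its inputs. For binary gates the fact requires
distinct inputs, which holds as the list of inputs has no duplicates. -/
theorem exists_cover (h : Inputs C ins) (hC : C.IsArityTwo) {B : Type}
    (T : TreeDecomposition C.encoding B) (g : Fin n) :
    ∃ b, g ∈ T.dom b ∧ ∀ g' ∈ ins g, g' ∈ T.dom b := by
  have hm := h.mem g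
  have hnd := h.nodup g
  cases hk : C.kind g
  · obtain ⟨b, hb⟩ := T.covers _ (Circuit.IsFact.inp g hk)
    exact ⟨b, hb (0 : Fin 1), by simp [h.eq_nil hk]⟩
  · obtain ⟨b, hb⟩ := T.covers _ (Circuit.IsFact.zero g hk)
    have := List.length_eq_zero_iff.1 ((h.length g).trans (hC.2 g (.inl hk)))
    exact ⟨b, hb (0 : Fin 1), by simp [this]⟩
  · obtain ⟨b, hb⟩ := T.covers _ (Circuit.IsFact.one g hk)
    have := List.length_eq_zero_iff.1 ((h.length g).trans (hC.2 g (.inr hk)))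
    exact ⟨b, hb (0 : Fin 1), by simp [this]⟩
  · obtain ⟨a, ha⟩ := List.length_eq_one_iff.1 (h.length_neg hk)
    rw [ha] at hm
    obtain ⟨b, hb⟩ := T.covers _ (Circuit.IsFact.neg g a hk ((hm a).1 (by simp)))
    exact ⟨b, hb (0 : Fin 2), by simpa [ha] using hb (1 : Fin 2)⟩
  · obtain ⟨a, a', ha⟩ := List.length_eq_two.1 ((h.length g).trans (hC.1 g (.inl hk)))
    rw [ha] at hm hnd
    obtain ⟨b, hb⟩ := T.covers _ (Circuit.IsFact.and g a a' hk ((hm a).1 (by simp))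
      ((hm a').1 (by simp)) (by simpa using hnd))
    exact ⟨b, hb (0 : Fin 3), by simpa [ha] using ⟨hb (1 : Fin 3), hb (2 : Fin 3)⟩⟩
  · obtain ⟨a, a', ha⟩ := List.length_eq_two.1 ((h.length g).trans (hC.1 g (.inr hk)))
    rw [ha] at hm hnd
    obtain ⟨b, hb⟩ := T.covers _ (Circuit.IsFact.or g a a' hk ((hm a).1 (by simp))
      ((hm a').1 (by simp)) (by simpa using hnd))
    exact ⟨b, hb (0 : Fin 3), by simpa [ha] using ⟨hb (1 : Fin 3), hb (2 : Fin 3)⟩⟩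

theorem local_factor {B : Type} {T : TreeDecomposition C.encoding B} {asg : Fin n → B}
    (h : ∀ g, g ∈ T.dom (asg g) ∧ ∀ g' ∈ ins g, g' ∈ T.dom (asg g)) :
    Local T asg (factor ins π) := by
  intro g x y hxy
  rw [factor, factor, hxy g (h g).1]
  exact gateWeight_congr π g _ fun g' hg' => hxy g' ((h g).2 g' hg')

end Factors

/-! ## Sizes of rationals -/

/-- `q` is a fraction with denominator `D` and value at most `N`. -/
def IsFrac (D N : ℕ) (q : ℚ) : Prop := ∃ a : ℕ, q * D = a ∧ a ≤ N * D

/-- Reduction to lowest terms only shrinks numerator and denominator. The numerator takes at most `e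
+ d + 1` bits, the sign 1 and the denominator `d + 1`. -/
theorem IsFrac.ratBits_le {D N d e : ℕ} {q : ℚ} (h : IsFrac D N q) (hD : 0 < D) (hd : D ≤ 2 ^ d)
    (hN : N ≤ 2 ^ e) : ratBits q ≤ e + 2 * d + 3 := by
  obtain ⟨a, ha, hle⟩ := h
  have hq : q = (a : ℚ) / (D : ℚ) := by
    rw [← ha, mul_div_cancel_right₀]; exact_mod_cast hD.ne'
  have h₁ : q.den ∣ D := by
    have := Rat.den_dvd a D
    rw [← Rat.intCast_div_eq_divInt, Int.cast_natCast, Int.cast_natCast, ← hq] at this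
    exact_mod_cast this
  have h₂ : q.den ≤ D := Nat.le_of_dvd hD h₁
  have h₃ : q.num.natAbs * D = a * q.den := by
    have h₄ : (q.num : ℚ) * D = a * q.den := by
      rw [← ha, ← Rat.mul_den_eq_num q]; ring
    have h₅ : q.num * D = a * q.den := by exact_mod_cast h₄
    have h₆ := congrArg Int.natAbs h₅
    simpa [Int.natAbs_mul] using h₆
  have h₄ : q.num.natAbs ≤ a := by
    refine Nat.le_of_mul_le_mul_right (c := D) ?_ hD
    rw [h₃]; exact Nat.mul_le_mul_left _ h₂
  have h₅ : Nat.size q.num.natAbs ≤ e + d + 1 := by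
    rw [Nat.size_le]
    calc q.num.natAbs ≤ N * D := h₄.trans hle
      _ ≤ 2 ^ e * 2 ^ d := Nat.mul_le_mul hN hd
      _ < 2 ^ (e + d + 1) := by
        rw [← pow_add]; exact Nat.pow_lt_pow_right (by norm_num) (by omega)
  have h₆ : Nat.size q.den ≤ d + 1 := by
    rw [Nat.size_le]
    exact (h₂.trans hd).trans_lt (Nat.pow_lt_pow_right (by norm_num) (by omega))
  rw [ratBits]
  omega

theorem IsFrac.sum {ι : Type} {D N : ℕ} {s : Finset ι} {f : ι → ℚ}
    (h : ∀ i ∈ s, IsFrac D N (f i)) : IsFrac D (s.card * N) (∑ i ∈ s, f i) := by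
  choose! a ha using h
  refine ⟨∑ i ∈ s, a i, ?_, ?_⟩
  · rw [Finset.sum_mul, Nat.cast_sum]
    exact Finset.sum_congr rfl fun i hi => (ha i hi).1
  · rw [mul_assoc, ← smul_eq_mul, ← Finset.sum_const]
    exact Finset.sum_le_sum fun i hi => (ha i hi).2

theorem IsFrac.mono {D N N' : ℕ} {q : ℚ} (h : IsFrac D N q) (hN : N ≤ N') : IsFrac D N' q := by
  obtain ⟨a, ha, hle⟩ := h
  exact ⟨a, ha, hle.trans (Nat.mul_le_mul_right _ hN)⟩

section Bits

variable {n : ℕ} {C : Circuit (Fin n)} {ins : Fin n → List (Fin n)} (π : ProbValuation C)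

/-- A denominator for the factors of the gate `g`. -/
def gateDen (g : Fin n) : ℕ :=
  if h : C.kind g = .inp then (π.prob ⟨g, h⟩ false).den * (π.prob ⟨g, h⟩ true).den else 1

/-- A common denominator for all products of factors. -/
def commonDen : ℕ := ∏ g, gateDen π g

theorem gateDen_pos (g : Fin n) : 0 < gateDen π g := by
  unfold gateDen
  split
  · exact Nat.mul_pos (Rat.den_pos _) (Rat.den_pos _)
  · exact one_pos

theorem commonDen_pos : 0 < commonDen π := Finset.prod_pos fun g _ => gateDen_pos π g

theorem commonDen_le : commonDen π ≤ 2 ^ π.bitSize := by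
  have h : ∏ g : {g // ¬ C.kind g = .inp}, gateDen π g.1 = 1 :=
    Finset.prod_eq_one fun g _ => by rw [gateDen, dif_neg g.2]
  rw [commonDen, ← Fintype.prod_subtype_mul_prod_subtype (fun g => C.kind g = .inp), h, mul_one,
    ProbValuation.bitSize, ← Finset.prod_pow_eq_pow_sum]
  refine Finset.prod_le_prod' fun g _ => ?_
  rw [gateDen, dif_pos g.2, Fintype.sum_bool, add_comm, pow_add]
  have key : ∀ q : ℚ, q.den ≤ 2 ^ ratBits q := fun q =>
    (Nat.lt_size_self q.den).le.trans (Nat.pow_le_pow_right (by norm_num) (by rw [ratBits]; omega))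
  exact Nat.mul_le_mul (key _) (key _)

theorem prob_le_one (g : C.Inp) (v : Bool) : π.prob g v ≤ 1 := by
  have h₁ := π.nonneg g true
  have h₂ := π.nonneg g false
  have h₃ := π.sum_eq_one g
  cases v <;> linarith

/-- The denominator of an input gate is the product of the denominators of both its probabilities,
so that it serves for either value. -/
theorem isFrac_gateWeight (g : Fin n) (v : Bool) (x : Fin n → Bool) :
    IsFrac (gateDen π g) 1 (gateWeight ins π g v x) := by
  have h₀ : IsFrac (gateDen π g) 1 0 := ⟨0, by simp, by simp⟩
  have h₁ : IsFrac (gateDen π g) 1 1 := ⟨gateDen π g, by simp, by simp⟩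
  unfold gateWeight
  split
  · exact h₀
  · split
    · rename_i h
      have key : ∀ q : ℚ, 0 ≤ q → q ≤ 1 → ∀ d, 0 < d → IsFrac (q.den * d) 1 q := by
        intro q hq hq' d hd
        have hnum : (q.num.natAbs : ℚ) = q.num := by
          have : 0 ≤ q.num := Rat.num_nonneg.2 hq
          rw [Nat.cast_natAbs, abs_of_nonneg this]
        refine ⟨q.num.natAbs * d, ?_, ?_⟩
        · push_cast
          rw [hnum, ← Rat.mul_den_eq_num q]; ring
        · rw [one_mul]
          refine Nat.mul_le_mul_right _ ?_
          have : (q.num : ℚ) ≤ q.den := by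
            rw [← Rat.mul_den_eq_num q]
            nlinarith [(Nat.cast_pos (α := ℚ)).2 q.den_pos]
          rw [← hnum] at this
          exact_mod_cast this
      rw [gateDen, dif_pos h]
      cases v
      · exact key _ (π.nonneg _ _) (prob_le_one π _ _) _ (Rat.den_pos _)
      · rw [mul_comm]
        exact key _ (π.nonneg _ _) (prob_le_one π _ _) _ (Rat.den_pos _)
    · split
      · exact h₁
      · exact h₀

theorem isFrac_prod (s : Finset (Fin n)) (x : Fin n → Bool) :
    IsFrac (commonDen π) 1 (∏ g ∈ s, factor ins π g x) := by
  choose a ha using fun g => isFrac_gateWeight (ins := ins) π g (x g) x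
  -- Gates outside `s` contribute their denominators to the numerator, which brings all partial
  -- products over the same common denominator.
  refine ⟨(∏ g ∈ s, a g) * ∏ g ∈ Finset.univ \ s, gateDen π g, ?_, ?_⟩
  · rw [commonDen, ← Finset.prod_sdiff (Finset.subset_univ s)]
    push_cast
    rw [← Finset.prod_congr rfl fun g _ => (ha g).1, Finset.prod_mul_distrib]
    simp only [factor]
    ring
  · rw [commonDen, ← Finset.prod_sdiff (Finset.subset_univ s), one_mul, mul_comm]
    refine Nat.mul_le_mul_left _ (Finset.prod_le_prod' fun g _ => ?_)
    simpa using (ha g).2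

/-- Each of the at most `2 ^ n` summands is a fraction over the common denominator with value at
most 1, so summation does not enlarge the denominator. -/
theorem isFrac_sumOver {B : Type} [DecidableEq B] (asg : Fin n → B) (A : Finset B)
    (U : Finset (Fin n)) (x : Fin n → Bool) :
    IsFrac (commonDen π) (2 ^ n) (sumOver U (prodOf asg (factor ins π) A) x) := by
  refine (IsFrac.sum (N := 1) fun y _ => isFrac_prod π _ y).mono ?_
  rw [mul_one]
  refine (Finset.card_le_univ _).trans ?_
  simp

/-- A bound on the number of bits of all rationals in the computation. -/
def bitBound : ℕ := 2 * n + 2 * π.bitSize + 3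

theorem IsFrac.ratBits_le_bitBound {q : ℚ} (h : IsFrac (commonDen π) (2 ^ (2 * n)) q) :
    ratBits q ≤ bitBound π :=
  h.ratBits_le (commonDen_pos π) (commonDen_le π) le_rfl

theorem ratBits_zero_le : ratBits 0 ≤ bitBound π := by
  simp [ratBits, bitBound]

theorem ratBits_one_le : ratBits 1 ≤ bitBound π := by
  simp [ratBits, bitBound]

theorem ratBits_prob_le (g : C.Inp) (v : Bool) : ratBits (π.prob g v) ≤ bitBound π := by
  have h₁ : ratBits (π.prob g v) ≤ ∑ v, ratBits (π.prob g v) :=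
    Finset.single_le_sum (f := fun v => ratBits (π.prob g v)) (fun _ _ => Nat.zero_le _)
      (Finset.mem_univ v)
  have h₂ : ∑ v, ratBits (π.prob g v) ≤ π.bitSize :=
    Finset.single_le_sum (f := fun g => ∑ v, ratBits (π.prob g v)) (fun _ _ => Nat.zero_le _)
      (Finset.mem_univ g)
  rw [bitBound]
  omega

end Bits

end ProbEval

namespace ProbEval

theorem arrayOf_eq {l : List ℕ} {i v : ℕ} (h : l[i]? = some v) : arrayOf l i = v := by
  simp [arrayOf, h]

/-! ## Collecting the inputs of the gates -/

/-- The sources of the wires in `W` to `g`, last wire first. -/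
def sources {n : ℕ} (W : List (Fin n × Fin n)) (g : Fin n) : List (Fin n) :=
  ((W.filter fun e => e.2 = g).map Prod.fst).reverse

theorem sources_append {n : ℕ} (W : List (Fin n × Fin n)) (e : Fin n × Fin n) (g : Fin n) :
    sources (W ++ [e]) g = if e.2 = g then e.1 :: sources W g else sources W g := by
  by_cases h : e.2 = g <;> simp [sources, h]

theorem inputs_sources {n : ℕ} {C : Circuit (Fin n)} {W : List (Fin n × Fin n)} (hW : W.Nodup)
    (h : W.toFinset = C.wires) : Inputs C (sources W) where
  nodup g := by
    rw [sources, List.nodup_reverse]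
    refine (List.nodup_map_iff_inj_on (hW.filter _)).2 ?_
    rintro ⟨a, b⟩ hx ⟨c, d⟩ hy hxy
    simp only [List.mem_filter, decide_eq_true_eq] at hx hy
    simp_all
  mem g g' := by
    simp [sources, ← h]

theorem run_collectInputs {w β n : ℕ} {M : Memory} {W : List (Fin n × Fin n)}
    (h₁ : M.wreg 1 = W.length) (ha₁ : M.warr 1 = arrayOf (W.map fun e => (e.1 : ℕ)))
    (ha₂ : M.warr 2 = arrayOf (W.map fun e => (e.2 : ℕ)))
    (ha₇ : M.warr 7 = fun _ => 0) (ha₈ : M.warr 8 = fun _ => 0) (hw : W.length < w)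
    (hn : n ≤ w) :
    Run w β collectInputs M (5 + W.length * 30) fun M' => ∀ g : Fin n,
      M'.warr 7 g = pointer (sources W g)[0]? ∧ M'.warr 8 g = pointer (sources W g)[1]? := by
  have h := Run.forLoop_const (w := w) (β := β) (i := 5) (N := 1) (T := 23) (M := M)
    (P := .setW 11 (.get 2 (.reg 5)) ;; .putW 8 (.reg 11) (.get 7 (.reg 11)) ;;
      .putW 7 (.reg 11) (.get 1 (.reg 5) + 1))
    (fun e M' => ∀ g : Fin n, M'.warr 7 g = pointer (sources (W.take e) g)[0]? ∧
      M'.warr 8 g = pointer (sources (W.take e) g)[1]?)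
    (by decide) (by decide) (by decide) h₁ hw (by simp [ha₇, ha₈, sources, pointer]) ?_
  · exact h.mono (by omega) fun M' _ h => by simpa using h
  · intro e he M' hs hi hN hI
    refine Run.straight (by decide) ?_
    have e₁ : M'.warr 1 e = W[e].1 := by
      rw [hs.warr 1 (by decide), ha₁]; exact arrayOf_eq (by simp [he])
    have e₂ : M'.warr 2 e = W[e].2 := by
      rw [hs.warr 2 (by decide), ha₂]; exact arrayOf_eq (by simp [he])
    have e₃ : sources (W.take (e + 1)) = sources (W.take e ++ [W[e]]) := by
      rw [List.take_succ_eq_append_getElem he]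
    have := W[e].1.isLt
    simp only [Program.wp, WordExp.fits_get, WordExp.fits_reg, WordExp.val_get, WordExp.val_reg,
      hi, e₂, Memory.wreg_setW, e₃, sources_append]
    refine ⟨trivial, ⟨trivial, trivial⟩, ⟨trivial, ?_⟩, fun g => ?_⟩
    · simp [hi, e₁]; omega
    · by_cases hg : W[e].2 = g
      · simp [hi, e₁, hg, pointer, (hI g).1]
      · have hg' : ¬ (g : ℕ) = (W[e].2 : ℕ) := fun h => hg (Fin.ext h.symm)
        simp [hg, hg', (hI g)]

/-! ## Ordering the bags -/

/-- `Q` lists all nodes, parents before children. -/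
structure IsOrder {m : ℕ} (T : FullBinTree (Fin m)) (Q : List (Fin m)) : Prop where
  nodup : Q.Nodup
  length : Q.length = m
  root : Q[0]? = some T.root
  child : ∀ (i : ℕ) (b c : Fin m), Q[i]? = some b → T.Child b c → ∃ j, i < j ∧ Q[j]? = some c

theorem length_le_of_nodup {m : ℕ} {Q : List (Fin m)} (h : Q.Nodup) : Q.length ≤ m := by
  simpa using h.length_le_card

theorem length_eq_of_forall_mem {m : ℕ} {Q : List (Fin m)} (h : ∀ b, b ∈ Q) : m ≤ Q.length := by
  have h₁ : Q.toFinset = Finset.univ := Finset.eq_univ_of_forall fun b => by simp [h b]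
  have := Q.toFinset_card_le
  simpa [h₁] using this

theorem run_orderBags {w β m : ℕ} {M : Memory} {T : FullBinTree (Fin m)}
    (h₂ : M.wreg 2 = m) (h₄ : M.wreg 4 = T.root)
    (ha₃ : ∀ b : Fin m, M.warr 3 b = pointer (T.left b))
    (ha₄ : ∀ b : Fin m, M.warr 4 b = pointer (T.right b)) (hw : m + 2 ≤ w) :
    Run w β orderBags M (10 + m * 50) fun M' => ∃ Q, IsOrder T Q ∧
      ∀ (i : ℕ) (b : Fin m), Q[i]? = some b → M'.warr 9 i = b := by
  have hroot := T.root.isLt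
  refine Run.step 3 (7 + m * 50) (by decide) (by omega) ?_
  simp only [Program.wp, WordExp.fits_ofNat, WordExp.fits_reg, WordExp.val_ofNat, WordExp.val_reg,
    h₄]
  refine ⟨⟨by omega, trivial⟩, Run.step 2 (5 + m * (40 + 7)) (by decide) (by omega) ?_⟩
  simp only [Program.wp, WordExp.fits_ofNat, WordExp.val_ofNat]
  refine ⟨by omega, ?_⟩
  refine (Run.forLoop_const (T := 40) (K := m)
    (fun i M' => ∃ Q : List (Fin m), Q.Nodup ∧ M'.wreg 12 = Q.length ∧ Q[0]? = some T.root ∧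
      (∀ (j : ℕ) (b : Fin m), Q[j]? = some b → M'.warr 9 j = b) ∧ i ≤ Q.length ∧
      (∀ c ∈ Q, c = T.root ∨ ∃ (j : ℕ) (b : Fin m), j < i ∧ Q[j]? = some b ∧ T.Child b c) ∧
      (∀ (j : ℕ) (b c : Fin m), j < i → Q[j]? = some b → T.Child b c → ∃ j' : ℕ, j < j' ∧ Q[j']? = some c))
    (by decide) (by decide) (by decide) (by simp [h₂]) (by omega) ?_ ?_).mono le_rfl ?_
  · refine ⟨[T.root], by simp, by simp, by simp, ?_, by simp, by simp, by simp⟩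
    intro j b hj
    rcases j with _ | j
    · simp at hj; simp [hj]
    · simp at hj
  · rintro i him M' hs hi hN ⟨Q, hnd, hlen, hr, hQ, hle, hmem, hch⟩
    -- The queue cannot run empty early: if every listed bag has been expanded, the list contains
    -- the root and is closed under children, so it contains all `m` bags.
    have hiQ : i < Q.length := by
      by_contra hge
      have hall : ∀ b, b ∈ Q := by
        intro b
        induction T.reachable b with
        | refl => exact List.mem_of_getElem? hr
        | @tail a c _ hac ih =>
          obtain ⟨j, hj, rfl⟩ := List.getElem_of_mem ih
          obtain ⟨j', -, hj'⟩ := hch j _ c (by omega) (List.getElem?_eq_getElem hj) hac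
          exact List.mem_of_getElem? hj'
      have := length_eq_of_forall_mem hall
      omega
    have hQi : Q[i]? = some Q[i] := List.getElem?_eq_getElem hiQ
    obtain ⟨b, hb⟩ : ∃ b, b = Q[i] := ⟨_, rfl⟩
    rw [← hb] at hQi
    have e₉ : M'.warr 9 i = b := hQ i b hQi
    have e₃ : M'.warr 3 b = pointer (T.left b) := by
      rw [hs.warr 3 (by decide)]; simpa using ha₃ b
    have e₄ : M'.warr 4 b = pointer (T.right b) := by
      rw [hs.warr 4 (by decide)]; simpa using ha₄ b
    have hlm := length_le_of_nodup hnd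
    cases hl : T.left b with
    | none =>
      have hr' := (T.full b).1 hl
      have hc : ∀ c, ¬ T.Child b c := by simp [FullBinTree.Child, hl, hr']
      refine (Run.of_wp (Q := fun M'' => M'' = M'.setW 6 b) ?_).mono (by decide) ?_
      · simp [Program.wp, Test.IsWord, hi, e₉, e₃, hl, pointer]
      · rintro _ - rfl
        refine ⟨Q, hnd, by simpa using hlen, hr, by simpa using hQ, hiQ, fun c hc' => ?_, ?_⟩
        · rcases hmem c hc' with h | ⟨j, b', hj, h⟩
          · exact .inl h
          · exact .inr ⟨j, b', by omega, h⟩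
        · intro j b' c hj hj' hc'
          by_cases hji : j = i
          · subst hji
            rw [hQi] at hj'
            cases hj'
            exact absurd hc' (hc c)
          · exact hch j b' c (by omega) hj' hc'
    | some l =>
      obtain ⟨r, hr'⟩ : ∃ r, T.right b = some r := by
        cases h : T.right b with
        | none => rw [(T.full b).2 h] at hl; cases hl
        | some r => exact ⟨r, rfl⟩
      have hlr : l ≠ r := by rintro rfl; exact T.left_ne_right b l hl hr'
      have hc : ∀ c, T.Child b c ↔ c = l ∨ c = r := by
        simp [FullBinTree.Child, hl, hr', eq_comm]
      -- A listed child would have entered as the root or as a child of a bag expanded earlier. The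
      -- root has no parent, and uniqueness of parents identifies that earlier bag with `b`.
      have hnew : ∀ c, T.Child b c → c ∉ Q := by
        intro c hc' hcQ
        rcases hmem c hcQ with rfl | ⟨j, b', hj, hj', h'⟩
        · exact T.root_no_parent b hc'
        · rw [T.parent_unique b' b c h' hc', ← hQi] at hj'
          exact hj.ne ((List.getElem?_inj (by omega) hnd).1 hj')
      have hnl := hnew l (.inl hl)
      have hnr := hnew r (.inr hr')
      have hnd' : (Q ++ [l, r]).Nodup := by
        simp only [List.nodup_append, hnd, List.nodup_cons, List.mem_cons, List.not_mem_nil,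
          or_false, hlr, not_false_eq_true, List.nodup_nil, and_self, true_and]
        rintro a ha b (rfl | rfl) rfl
        · exact hnl ha
        · exact hnr ha
      have hlm' := length_le_of_nodup hnd'
      rw [List.length_append, List.length_cons, List.length_cons, List.length_nil] at hlm'
      have hll := l.isLt
      have hrr := r.isLt
      refine (Run.of_wp (Q := fun M'' => M'' = (((M'.setW 6 b).putW 9 Q.length l).putW 9
        (Q.length + 1) r).setW 12 (Q.length + 2)) ?_).mono (by decide) ?_
      · simp [Program.wp, Test.IsWord, hi, e₉, e₃, e₄, hl, hr', pointer, hlen]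
        omega
      · rintro _ - rfl
        have hold : ∀ (j : ℕ) (b : Fin m), Q[j]? = some b → (Q ++ [l, r])[j]? = some b :=
          fun j b h => by
            rw [List.getElem?_append_left]
            · exact h
            · exact (List.getElem?_eq_some_iff.1 h).1
        refine ⟨Q ++ [l, r], hnd', by simp, hold _ _ hr, ?_, by simp; omega, ?_, ?_⟩
        · intro j c hj
          by_cases hjQ : j < Q.length
          · rw [List.getElem?_append_left hjQ] at hj
            have h₁ : j ≠ Q.length := by omega
            have h₂ : j ≠ Q.length + 1 := by omega
            simpa [h₁, h₂] using hQ j c hj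
          · rw [List.getElem?_append_right (by omega)] at hj
            obtain ⟨d, rfl⟩ : ∃ d, j = Q.length + d := ⟨j - Q.length, by omega⟩
            rw [Nat.add_sub_cancel_left] at hj
            rcases d with _ | _ | d
            · simp at hj; simp [hj]
            · simp at hj; simp [hj]
            · simp at hj
        · intro c hcQ
          rcases List.mem_append.1 hcQ with h | h
          · rcases hmem c h with h | ⟨j, b', hj, hj', h⟩
            · exact .inl h
            · exact .inr ⟨j, b', by omega, hold _ _ hj', h⟩
          · exact .inr ⟨i, b, by omega, hold _ _ hQi, (hc c).2 (by simpa using h)⟩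
        · intro j b' c hj hj' hc'
          by_cases hji : j = i
          · subst hji
            rw [hold _ _ hQi] at hj'
            cases hj'
            rcases (hc c).1 hc' with rfl | rfl
            · exact ⟨Q.length, by omega, by simp⟩
            · exact ⟨Q.length + 1, by omega, by simp⟩
          · rw [List.getElem?_append_left (by omega)] at hj'
            obtain ⟨j', hj₁, hj₂⟩ := hch j b' c (by omega) hj' hc'
            exact ⟨j', hj₁, hold _ _ hj₂⟩
  · rintro M' - ⟨Q, hnd, hlen, hr, hQ, hle, -, hch⟩
    have := length_le_of_nodup hnd
    refine ⟨Q, ⟨hnd, by omega, hr, fun i b c hi hc => hch i b c ?_ hi hc⟩, hQ⟩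
    have := (List.getElem?_eq_some_iff.1 hi).1
    omega

end ProbEval

namespace ProbEval

/-! ## Marking the gates of a list -/

theorem run_mark {w β n a a' s N v : ℕ} {M : Memory} {L : List (Fin n)} (ha : a' ≠ a)
    (hs : s ≠ 9) (hN : N ≠ 9) (hMN : M.wreg N = L.length)
    (hL : ∀ (i : ℕ) (g : Fin n), L[i]? = some g → M.warr a' (M.wreg s + i) = g)
    (hw : M.wreg s + L.length < w) (hn : n ≤ w) (hv : v ≤ w) :
    Run w β (forLoop 9 N (.putW a (.get a' (.reg s + .reg 9) + 1) (.lit v))) M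
      (5 + L.length * 15) fun M' => (∀ g ∈ L, M'.warr a (g + 1) = v) ∧
        ∀ j : ℕ, (∀ g ∈ L, j ≠ g + 1) → M'.warr a j = M.warr a j := by
  refine (Run.forLoop_const (T := 8) (K := L.length)
    (fun i M' => (∀ g ∈ L.take i, M'.warr a (g + 1) = v) ∧
      ∀ j : ℕ, (∀ g ∈ L.take i, j ≠ g + 1) → M'.warr a j = M.warr a j)
    (by simp [Program.wrW]) (by simp [Program.wrW]) hN.symm hMN (by omega) (by simp) ?_).mono
    (by omega) fun M' _ h => by simpa using h
  rintro i hi M' hs' hi' - ⟨hI₁, hI₂⟩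
  have e₁ : M'.wreg s = M.wreg s := hs'.wreg s (by simp [Program.wrW, forLoop, hs])
  have e₂ : M'.warr a' = M.warr a' := hs'.warr a' (by simp [Program.wrA, forLoop, ha])
  have e₃ : M'.warr a' (M.wreg s + i) = L[i] := by
    rw [e₂]; exact hL i _ (List.getElem?_eq_getElem hi)
  have hg := L[i].isLt
  refine Run.straight (c := 8) le_rfl ?_
  rw [List.take_succ_eq_append_getElem hi]
  simp only [Program.wp, WordExp.fits_get, WordExp.fits_add, WordExp.fits_reg, WordExp.val_get,
    WordExp.val_add, WordExp.val_reg, WordExp.fits_ofNat, WordExp.val_ofNat, e₁, hi', e₃,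
    WordExp.fits_lit, WordExp.val_lit, List.mem_append, List.mem_singleton, Memory.warr_setW,
    Memory.warr_putW, true_and]
  refine ⟨⟨⟨by omega, by omega, by omega⟩, hv⟩, ?_, ?_⟩
  · rintro g (h | rfl)
    · simp [hI₁ g h]
    · simp
  · intro j hj
    rw [if_neg (hj _ (.inr rfl)), hI₂ j fun g hg => hj g (.inl hg)]

/-! ## Sorting the bags -/

/-- The arrays `7` and `8` point to the inputs of each gate. -/
def HasInputs {n : ℕ} (M : Memory) (ins : Fin n → List (Fin n)) : Prop :=
  ∀ g : Fin n, M.warr 7 g = pointer (ins g)[0]? ∧ M.warr 8 g = pointer (ins g)[1]?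

theorem mem_iff_of_length_le_two {α : Type} {l : List α} (h : l.length ≤ 2) (a : α) :
    a ∈ l ↔ l[0]? = some a ∨ l[1]? = some a := by
  rcases l with _ | ⟨b, _ | ⟨c, _ | ⟨d, l⟩⟩⟩
  · simp
  · simp [eq_comm]
  · simp [eq_comm]
  · simp at h

/-- In the list `L` of the gates of a bag, the inputs of a gate precede the gate. -/
structure IsSorted {n : ℕ} (ins : Fin n → List (Fin n)) (dom : Finset (Fin n))
    (L : List (Fin n)) : Prop where
  nodup : L.Nodup
  toFinset : L.toFinset = dom
  sorted : ∀ (i : ℕ) (g g' : Fin n), L[i]? = some g → g' ∈ ins g → g' ∈ dom → g' ∈ L.take i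

/-- The state of the algorithm that sorts the bag with the gates `D`, listed from address `s`,
when `L` has been sorted. -/
structure SortState {n : ℕ} (ins : Fin n → List (Fin n)) (D : List (Fin n)) (s : ℕ)
    (M₀ M : Memory) (L : List (Fin n)) : Prop where
  nodup : L.Nodup
  subset : L ⊆ D
  sorted : ∀ (i : ℕ) (g g' : Fin n), L[i]? = some g → g' ∈ ins g → g' ∈ D → g' ∈ L.take i
  count : M.wreg 12 = L.length
  entry : ∀ (i : ℕ) (g : Fin n), L[i]? = some g → M.warr 10 (s + i) = g
  before : ∀ j < s, M.warr 10 j = M₀.warr 10 j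
  zero : M.warr 11 0 = 2
  mark : ∀ g : Fin n, M.warr 11 (g + 1) = if g ∈ L then 2 else if g ∈ D then 1 else 0
  rest : ∀ j, n < j → M.warr 11 j = M₀.warr 11 j

theorem SortState.setW {n : ℕ} {ins : Fin n → List (Fin n)} {D L : List (Fin n)} {s x v : ℕ}
    {M₀ M : Memory} (h : SortState ins D s M₀ M L) (hx : x ≠ 12) :
    SortState ins D s M₀ (M.setW x v) L :=
  ⟨h.nodup, h.subset, h.sorted, by simp [h.count, hx.symm], h.entry, h.before, h.zero, h.mark,
    h.rest⟩

/-- The pointer to an existing gate is the address of its mark, and the null pointer reads the 2 in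
cell `0`; the test for mark 1 thus detects exactly the unplaced inputs inside the bag. -/
theorem SortState.mark_pointer {n : ℕ} {ins : Fin n → List (Fin n)} {D L : List (Fin n)} {s : ℕ}
    {M₀ M : Memory} (h : SortState ins D s M₀ M L) (o : Option (Fin n)) :
    M.warr 11 (pointer o) = 1 ↔ ∃ g, o = some g ∧ g ∈ D ∧ g ∉ L := by
  cases o with
  | none => simp [pointer, h.zero]
  | some g =>
    simp only [pointer, h.mark, Option.some.injEq, exists_eq_left']
    split_ifs <;> simp_all

theorem SortState.append {n : ℕ} {ins : Fin n → List (Fin n)} {D L : List (Fin n)} {s : ℕ}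
    {M₀ M : Memory} (h : SortState ins D s M₀ M L) {g : Fin n} (hgD : g ∈ D) (hgL : g ∉ L)
    (hg : ∀ g' ∈ ins g, g' ∈ D → g' ∈ L) :
    SortState ins D s M₀ (((M.putW 10 (s + L.length) g).putW 11 (g + 1) 2).setW 12
      (L.length + 1)) (L ++ [g]) where
  nodup := by
    simp only [List.nodup_append, h.nodup, List.nodup_singleton, true_and, List.mem_singleton]
    rintro a ha b rfl rfl
    exact hgL ha
  subset := List.append_subset.2 ⟨h.subset, by simpa using hgD⟩
  sorted i a g' hi hg' hD := by
    by_cases hiL : i < L.length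
    · rw [List.getElem?_append_left hiL] at hi
      rw [List.take_append_of_le_length hiL.le]
      exact h.sorted i a g' hi hg' hD
    · have : i = L.length := by
        have := (List.getElem?_eq_some_iff.1 hi).1
        simp at this; omega
      subst this
      simp only [List.getElem?_concat_length, Option.some.injEq] at hi
      subst hi
      simpa using hg g' hg' hD
  count := by simp
  entry i a hi := by
    by_cases hiL : i < L.length
    · rw [List.getElem?_append_left hiL] at hi
      simpa [hiL.ne] using h.entry i a hi
    · have : i = L.length := by
        have := (List.getElem?_eq_some_iff.1 hi).1
        simp at this; omega
      subst this
      simp only [List.getElem?_concat_length, Option.some.injEq] at hi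
      simp [hi]
  before j hj := by
    have : j ≠ s + L.length := by omega
    simpa [this] using h.before j hj
  zero := by simpa using h.zero
  mark a := by
    by_cases hag : a = g
    · simp [hag]
    · have : (a : ℕ) ≠ g := fun h => hag (Fin.ext h)
      simpa [hag, this] using h.mark a
  rest j hj := by
    have : j ≠ g + 1 := by have := g.isLt; omega
    simpa [this] using h.rest j hj

section Prepare

variable {w β n : ℕ} {C : Circuit (Fin n)} {ins : Fin n → List (Fin n)}

theorem run_tryPlace (hins : Inputs C ins) (hC : C.IsArityTwo) {M M₀ : Memory}
    {D L : List (Fin n)} {s i : ℕ}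
    (h₇ : M.wreg 7 = s) (h₉ : M.wreg 9 = i) {g : Fin n} (hg : D[i]? = some g)
    (hA₆ : M.warr 6 (s + i) = g) (hA : HasInputs M ins) (h : SortState ins D s M₀ M L)
    (hw : s + D.length + 2 ≤ w) (hn : n ≤ w) :
    Run w β tryPlace M 40 fun M' => ∃ L', SortState ins D s M₀ M' L' ∧ L ⊆ L' ∧
      L.length ≤ L'.length ∧ ((∀ g' ∈ ins g, g' ∈ D → g' ∈ L) → g ∈ L') := by
  have hgn := g.isLt
  have hgD : g ∈ D := List.mem_of_getElem? hg
  have hi := (List.getElem?_eq_some_iff.1 hg).1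
  have e₇ := (hA g).1
  have e₈ := (hA g).2
  have hst := h.setW (x := 11) (v := g) (by decide)
  have hlen : L.length ≤ D.length := h.nodup.subperm h.subset |>.length_le
  have hmem := mem_iff_of_length_le_two (hins.length_le hC g)
  have hkeep : ∀ {Q : Prop}, (g ∈ L ∨ ¬ Q) →
      ∃ L', SortState ins D s M₀ (M.setW 11 g) L' ∧ L ⊆ L' ∧ L.length ≤ L'.length ∧
        (Q → g ∈ L') :=
    fun hQ => ⟨L, hst, fun _ h => h, le_rfl, fun h => hQ.resolve_right fun h' => h' h⟩
  refine Run.straight (by decide) ?_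
  simp only [tryPlace, Program.wp, WordExp.fits_get, WordExp.fits_add, WordExp.fits_reg,
    WordExp.val_get, WordExp.val_add, WordExp.val_reg, WordExp.fits_ofNat, WordExp.val_ofNat, h₇,
    h₉, hA₆, Test.IsWord, Test.fits_eq, Test.holds_eq, Memory.wreg_setW, Memory.warr_setW, e₇, e₈,
    h.mark_pointer, true_and, and_true, if_true]
  refine ⟨by omega, ⟨by omega, by omega⟩, fun h₁ => ⟨by omega, ?_, fun h₂ => ⟨by omega, ?_,
    fun h₃ => ?_⟩⟩, ?_⟩
  · rintro ⟨g', ho, hD, hL⟩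
    exact hkeep (.inr fun hQ => hL (hQ g' ((hmem g').2 (.inl ho)) hD))
  · rintro ⟨g', ho, hD, hL⟩
    exact hkeep (.inr fun hQ => hL (hQ g' ((hmem g').2 (.inr ho)) hD))
  · have hgL : g ∉ L := by
      intro hgL
      rw [h.mark, if_pos hgL] at h₁
      omega
    have hall : ∀ g' ∈ ins g, g' ∈ D → g' ∈ L := by
      intro g' hg' hD
      by_contra hL
      rcases (hmem g').1 hg' with ho | ho
      · exact h₂ ⟨g', ho, hD, hL⟩
      · exact h₃ ⟨g', ho, hD, hL⟩
    have := hst.append hgD hgL hall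
    have hc := h.count
    simp [hc]
    exact ⟨by omega, by omega, by omega, L ++ [g], this, by simp, by simp, by simp⟩
  · intro h₁
    refine hkeep (.inl ?_)
    by_contra hgL
    exact h₁ (by rw [h.mark, if_neg hgL, if_pos hgD])

/-- After `r` rounds at least `r` gates have been placed, because a round places every gate whose
inputs in the bag were placed before the round, and by acyclicity there is such a gate among the
missing ones. -/
theorem run_sortBag (hins : Inputs C ins) (hC : C.IsArityTwo) {M : Memory} {D : List (Fin n)}
    {s : ℕ} (hD : D.Nodup) (h₇ : M.wreg 7 = s) (h₈ : M.wreg 8 = D.length)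
    (hA₆ : ∀ (i : ℕ) (g : Fin n), D[i]? = some g → M.warr 6 (s + i) = g) (hA : HasInputs M ins)
    (hz : M.warr 11 0 = 2) (hm : ∀ g : Fin n, M.warr 11 (g + 1) = if g ∈ D then 1 else 0)
    (hw : s + D.length + 2 ≤ w) (hn : n ≤ w) :
    Run w β sortBag M (10 + D.length * (12 + D.length * 47)) fun M' =>
      ∃ L, IsSorted ins D.toFinset L ∧ SortState ins D s M M' L := by
  refine Run.step 2 (5 + D.length * ((5 + D.length * (40 + 7)) + 7)) (by decide)
    (by ring_nf; omega) ?_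
  simp only [Program.wp, WordExp.fits_ofNat, WordExp.val_ofNat]
  refine ⟨by omega, ?_⟩
  refine (Run.forLoop_const (K := D.length)
    (fun r M' => ∃ L, SortState ins D s M M' L ∧ r ≤ L.length)
    (by decide) (by decide) (by decide) (by simp [h₈]) (by omega) ?_ ?_).mono le_rfl ?_
  · refine ⟨[], ⟨by simp, by simp, by simp, by simp, by simp, by simp, by simpa using hz, ?_,
      by simp⟩, by simp⟩
    intro g; simpa using hm g
  · rintro r hr M' hs hM' h₈' ⟨L₀, hL₀, hrL⟩
    have e₇ : M'.wreg 7 = s := by rw [hs.wreg 7 (by decide)]; simpa using h₇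
    have e₆ : M'.warr 6 = M.warr 6 := hs.warr 6 (by decide)
    have eA : HasInputs M' ins := fun g => by
      rw [hs.warr 7 (by decide), hs.warr 8 (by decide)]; exact hA g
    refine (Run.forLoop_const (K := D.length)
      (fun i M'' => ∃ L, SortState ins D s M M'' L ∧ L₀ ⊆ L ∧ L₀.length ≤ L.length ∧
        ∀ g ∈ D.take i, (∀ g' ∈ ins g, g' ∈ D → g' ∈ L₀) → g ∈ L)
      (by decide) (by decide) (by decide) h₈' (by omega)
      ⟨L₀, hL₀.setW (by decide), by simp, le_rfl, by simp⟩ ?_).mono le_rfl ?_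
    · rintro i hi M'' hs' h₉ - ⟨L, hL, hsub, hle, hall⟩
      have e₇' : M''.wreg 7 = s := by rw [hs'.wreg 7 (by decide)]; exact e₇
      have e₆' : M''.warr 6 = M.warr 6 := by rw [hs'.warr 6 (by decide), e₆]
      have eA' : HasInputs M'' ins := fun g => by
        rw [hs'.warr 7 (by decide), hs'.warr 8 (by decide)]; exact eA g
      have hDi := List.getElem?_eq_getElem hi
      refine (run_tryPlace hins hC e₇' h₉ hDi (by rw [e₆']; exact hA₆ i _ hDi) eA' hL hw
        hn).mono le_rfl ?_
      rintro M₁ - ⟨L', h₁, h₂, h₃, h₄⟩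
      refine ⟨L', h₁.setW (by decide), fun _ h => h₂ (hsub h), hle.trans h₃, fun g hg hg' => ?_⟩
      rw [List.take_succ_eq_append_getElem hi, List.mem_append, List.mem_singleton] at hg
      rcases hg with hg | rfl
      · exact h₂ (hall g hg hg')
      · exact h₄ fun g' h₅ h₆ => hsub (hg' g' h₅ h₆)
    · rintro M'' - ⟨L, hL, hsub, hle, hall⟩
      refine ⟨L, hL.setW (by decide), ?_⟩
      -- If the round placed nothing new, the list still has the gates of `L₀`, and there are too
      -- few of them to exhaust the bag. A missing gate minimal along the wires has all its inputs
      -- in the bag placed, so the round did place it.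
      by_contra hlt
      have hlen : L.length = L₀.length := by omega
      have heq : ∀ g ∈ L, g ∈ L₀ := by
        have := (hL₀.nodup.subperm hsub).perm_of_length_le (by omega)
        exact fun g hg => this.mem_iff.2 hg
      have hex : ∃ g, g ∈ D ∧ g ∉ L₀ := by
        by_contra hno
        push Not at hno
        have := (hD.subperm (fun g hg => hno g hg)).length_le
        omega
      obtain ⟨g, ⟨hgD, hgL⟩, hmin⟩ := C.wires_wf.has_min {g | g ∈ D ∧ g ∉ L₀} hex
      refine hgL (heq g (hall g (by simpa using hgD) fun g' hg' hD' => ?_))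
      by_contra hL'
      exact hmin g' ⟨hD', hL'⟩ ((hins.mem g g').1 hg')
  · rintro M' - ⟨L, hL, hle⟩
    refine ⟨L, ⟨hL.nodup, ?_, ?_⟩, hL⟩
    · have := (hL.nodup.subperm hL.subset).perm_of_length_le hle
      ext g
      simp [this.mem_iff]
    · simpa using hL.sorted

theorem run_assignGates (hins : Inputs C ins) (hC : C.IsArityTwo) {M : Memory} {D : List (Fin n)}
    {s b : ℕ} (h₅ : M.wreg 5 = b) (h₇ : M.wreg 7 = s) (h₈ : M.wreg 8 = D.length)
    (hA₆ : ∀ (i : ℕ) (g : Fin n), D[i]? = some g → M.warr 6 (s + i) = g) (hA : HasInputs M ins)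
    (hz : M.warr 11 0 ≠ 0) (hm : ∀ g : Fin n, M.warr 11 (g + 1) = 0 ↔ g ∉ D)
    (hw : s + D.length + 2 ≤ w) (hb : b < w) :
    Run w β assignGates M (5 + D.length * 40) fun M' => ∀ g : Fin n,
      (g ∈ D ∧ (∀ g' ∈ ins g, g' ∈ D) → M'.warr 14 g = b + 1) ∧
      (¬ (g ∈ D ∧ ∀ g' ∈ ins g, g' ∈ D) → M'.warr 14 g = M.warr 14 g) := by
  have hp : ∀ o : Option (Fin n), M.warr 11 (pointer o) = 0 ↔ ∃ g, o = some g ∧ g ∉ D := by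
    rintro (_ | g) <;> simp [pointer, hz, hm]
  refine (Run.forLoop_const (T := 33) (K := D.length)
    (fun i M' => ∀ g : Fin n,
      (g ∈ D.take i ∧ (∀ g' ∈ ins g, g' ∈ D) → M'.warr 14 g = b + 1) ∧
      (¬ (g ∈ D.take i ∧ ∀ g' ∈ ins g, g' ∈ D) → M'.warr 14 g = M.warr 14 g))
    (by decide) (by decide) (by decide) h₈ (by omega) (by simp) ?_).mono
    (by omega) fun M' _ h => by simpa using h
  intro i hi M' hs h₉ _ hI
  have e₅ : M'.wreg 5 = b := by rw [hs.wreg 5 (by decide)]; exact h₅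
  have e₇ : M'.wreg 7 = s := by rw [hs.wreg 7 (by decide)]; exact h₇
  have e₆ : M'.warr 6 (s + i) = D[i] := by
    rw [hs.warr 6 (by decide)]; exact hA₆ i _ (List.getElem?_eq_getElem hi)
  have a₁₁ : M'.warr 11 = M.warr 11 := hs.warr 11 (by decide)
  have a₇ : M'.warr 7 D[i] = pointer (ins D[i])[0]? := by
    rw [hs.warr 7 (by decide)]; exact (hA _).1
  have a₈ : M'.warr 8 D[i] = pointer (ins D[i])[1]? := by
    rw [hs.warr 8 (by decide)]; exact (hA _).2
  have hmem := mem_iff_of_length_le_two (hins.length_le hC D[i])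
  have hkeep : ¬ (∀ g' ∈ ins D[i], g' ∈ D) → ∀ g : Fin n,
      (g ∈ D.take (i + 1) ∧ (∀ g' ∈ ins g, g' ∈ D) → M'.warr 14 g = b + 1) ∧
      (¬ (g ∈ D.take (i + 1) ∧ ∀ g' ∈ ins g, g' ∈ D) → M'.warr 14 g = M.warr 14 g) := by
    intro hno g
    have : (g ∈ D.take (i + 1) ∧ ∀ g' ∈ ins g, g' ∈ D) ↔
        (g ∈ D.take i ∧ ∀ g' ∈ ins g, g' ∈ D) := by
      rw [List.take_succ_eq_append_getElem hi, List.mem_append, List.mem_singleton]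
      constructor
      · rintro ⟨h | rfl, h'⟩
        · exact ⟨h, h'⟩
        · exact absurd h' hno
      · rintro ⟨h, h'⟩
        exact ⟨.inl h, h'⟩
    rw [this]
    exact hI g
  refine Run.straight (by decide) ?_
  simp only [Program.wp, WordExp.fits_get, WordExp.fits_add, WordExp.fits_reg,
    WordExp.val_get, WordExp.val_add, WordExp.val_reg, WordExp.fits_ofNat, WordExp.val_ofNat, e₇,
    h₉, e₆, Test.IsWord, Test.fits_eq, Test.holds_eq, Memory.wreg_setW, Memory.warr_setW, a₇, a₈,
    a₁₁, hp, true_and, if_true]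
  refine ⟨by omega, Nat.zero_le _, ?_, fun h₁ => ⟨Nat.zero_le _, ?_, fun h₂ => ⟨?_, ?_⟩⟩⟩
  · rintro ⟨g', ho, hg'⟩
    exact hkeep fun h => hg' (h g' ((hmem g').2 (.inl ho)))
  · rintro ⟨g', ho, hg'⟩
    exact hkeep fun h => hg' (h g' ((hmem g').2 (.inr ho)))
  · simp [e₅]; omega
  · have hall : ∀ g' ∈ ins D[i], g' ∈ D := by
      intro g' hg'
      by_contra hD
      rcases (hmem g').1 hg' with ho | ho
      · exact h₁ ⟨g', ho, hD⟩
      · exact h₂ ⟨g', ho, hD⟩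
    intro g
    rw [List.take_succ_eq_append_getElem hi, List.mem_append, List.mem_singleton]
    by_cases hgi : g = D[i]
    · subst hgi
      refine ⟨fun _ => by simp [e₅], fun h => absurd ⟨.inr rfl, hall⟩ h⟩
    · have : (g : ℕ) ≠ D[i] := fun h => hgi (Fin.ext h)
      simpa [hgi, this] using hI g

end Prepare

end ProbEval

/-! ### Preparation of all bags -/

namespace ProbEval

/-- Array `a` contains the lists `L b`, the list `L b` starting at address `st b`. -/
def HasLists {n m : ℕ} (M : Memory) (a : ℕ) (st : ℕ → ℕ) (L : Fin m → List (Fin n)) : Prop :=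
  ∀ (b : Fin m) (i : ℕ) (g : Fin n), (L b)[i]? = some g → M.warr a (st b + i) = g

theorem run_prepareBags {w β n m κ : ℕ} {C : Circuit (Fin n)} {ins : Fin n → List (Fin n)}
    (hins : Inputs C ins) (hC : C.IsArityTwo) {M : Memory} {st : ℕ → ℕ}
    {D : Fin m → List (Fin n)} {dom : Fin m → Finset (Fin n)}
    (hD : ∀ b, (D b).Nodup ∧ (D b).toFinset = dom b) (h₂ : M.wreg 2 = m)
    (h₅ : ∀ j ≤ m, M.warr 5 j = st j) (hst : ∀ b : Fin m, st (b + 1) = st b + (D b).length)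
    (h₆ : HasLists M 6 st D) (hA : HasInputs M ins) (h₁₁ : ∀ i, M.warr 11 i = 0)
    (h₁₄ : ∀ i, M.warr 14 i = 0) (hcov : ∀ g, ∃ b, g ∈ dom b ∧ ∀ g' ∈ ins g, g' ∈ dom b)
    (hκ : ∀ b, (D b).length ≤ κ) (hw : ∀ j ≤ m, st j + 2 ≤ w) (hn : n ≤ w) (hm : m < w) :
    Run w β prepareBags M (20 + m * (60 + κ * 82 + κ * κ * 47)) fun M' =>
      ∃ (L : Fin m → List (Fin n)) (asg : Fin n → Fin m),
        (∀ b, IsSorted ins (dom b) (L b)) ∧ HasLists M' 10 st L ∧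
        ∀ g : Fin n, M'.warr 14 g = asg g + 1 ∧ g ∈ dom (asg g) ∧ ∀ g' ∈ ins g, g' ∈ dom (asg g) := by
  -- The list of an earlier bag ends before the current one starts, so sorting the current bag
  -- leaves the earlier sorted lists intact.
  have hmono : ∀ j ≤ m, ∀ b : Fin m, (b : ℕ) < j → st b + (D b).length ≤ st j := by
    intro j
    induction j with
    | zero => intro _ b hb; omega
    | succ j ih =>
      intro hj b hb
      have := hst ⟨j, by omega⟩
      simp only at this
      by_cases hbj : (b : ℕ) = j
      · have hb' : (⟨j, by omega⟩ : Fin m) = b := Fin.ext hbj.symm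
        rw [hb'] at this
        rw [hbj]
        omega
      · have := ih (by omega) b (by omega)
        omega
  refine Run.step 3 (5 + m * ((53 + κ * 82 + κ * κ * 47) + 7)) (by decide) (by ring_nf; omega) ?_
  simp only [Program.wp, WordExp.fits_ofNat, WordExp.val_ofNat]
  refine ⟨⟨by omega, by have := hw 0 (Nat.zero_le _); omega⟩, ?_⟩
  refine (Run.forLoop_const (K := m)
    (fun j M' => M'.warr 11 0 = 2 ∧ (∀ i, M'.warr 11 (i + 1) = 0) ∧
      (∀ b : Fin m, (b : ℕ) < j → ∃ L, IsSorted ins (dom b) L ∧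
        ∀ (i : ℕ) (g : Fin n), L[i]? = some g → M'.warr 10 (st b + i) = g) ∧
      -- A gate may be reassigned by a later bag. It only matters that the last assignment is to a
      -- bag containing the gate and its inputs, and that a gate left unassigned has met no such
      -- bag.
      (∀ g : Fin n, (M'.warr 14 g = 0 ∧
          ∀ b : Fin m, (b : ℕ) < j → ¬ (g ∈ dom b ∧ ∀ g' ∈ ins g, g' ∈ dom b)) ∨
        ∃ b : Fin m, M'.warr 14 g = b + 1 ∧ g ∈ dom b ∧ ∀ g' ∈ ins g, g' ∈ dom b))
    (by decide) (by decide) (by decide) (by simpa using h₂) hm ?_ ?_).mono le_rfl ?_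
  · simp [h₁₁, h₁₄]
  · rintro j hj M₁ hs hr - ⟨hz, hmk, hL, hasg⟩
    obtain ⟨b, rfl⟩ : ∃ b : Fin m, (b : ℕ) = j := ⟨⟨j, hj⟩, rfl⟩
    have hmemD : ∀ g, g ∈ D b ↔ g ∈ dom b := fun g => by rw [← (hD b).2, List.mem_toFinset]
    have e₅ : M₁.warr 5 b = st b := by
      rw [hs.warr 5 (by decide)]; simpa using h₅ b b.isLt.le
    have e₅' : M₁.warr 5 (b + 1) = st b + (D b).length := by
      rw [hs.warr 5 (by decide), ← hst]; simpa using h₅ (b + 1) b.isLt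
    have e₆ : M₁.warr 6 = M.warr 6 := by rw [hs.warr 6 (by decide)]; funext i; simp
    have eA : HasInputs M₁ ins := fun g => by
      rw [hs.warr 7 (by decide), hs.warr 8 (by decide)]; simpa using hA g
    have hwb := hw (b + 1) b.isLt
    rw [hst] at hwb
    have hκb := hκ b
    have hκ₂ := Nat.mul_le_mul hκb hκb
    refine Run.step 10 (40 + κ * 82 + κ * κ * 47) (by decide) (by omega) ?_
    simp only [Program.wp, WordExp.fits_get, WordExp.fits_add, WordExp.fits_sub, WordExp.fits_reg,
      WordExp.val_get, WordExp.val_add, WordExp.val_sub, WordExp.val_reg, WordExp.fits_ofNat,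
      WordExp.val_ofNat, hr, Memory.wreg_setW, Memory.warr_setW, e₅]
    refine ⟨trivial, ⟨by simp; omega, trivial, by simp [e₅']; omega⟩, ?_⟩
    obtain ⟨M₂, hM₂⟩ : ∃ M₂, M₂ = (M₁.setW 7 (st b)).setW 8 (st b + (D b).length - st b) :=
      ⟨_, rfl⟩
    simp only [e₅', if_true, Nat.reduceEqDiff, if_false]
    rw [← hM₂]
    have f₇ : M₂.wreg 7 = st b := by simp [hM₂]
    have f₈ : M₂.wreg 8 = (D b).length := by simp [hM₂]
    have f₅ : M₂.wreg 5 = b := by simp [hM₂, hr]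
    have fa : M₂.warr = M₁.warr := by simp [hM₂]
    refine Run.andThen (35 + κ * 67 + κ * κ * 47 - 10) (run_mark (a := 11) (a' := 6) (s := 7) (N := 8) (v := 1) (L := D b)
      (by decide) (by decide) (by decide) f₈ (fun i g hi => by rw [fa, e₆, f₇]; exact h₆ b i g hi)
      (by omega) hn (by omega)) (by omega) ?_
    rintro M₃ hs₃ ⟨h₃, h₃'⟩
    refine Run.andThen (15 + κ * 55) (run_sortBag (s := st b) (D := D b) hins hC (hD b).1
      (by rw [hs₃.wreg 7 (by decide), f₇]) (by rw [hs₃.wreg 8 (by decide), f₈])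
      (fun i g hi => by rw [hs₃.warr 6 (by decide), fa, e₆]; exact h₆ b i g hi)
      (fun g => by rw [hs₃.warr 7 (by decide), hs₃.warr 8 (by decide), fa]; exact eA g)
      (by rw [h₃' 0 (by simp), fa, hz]) (fun g => ?_) (by omega) hn) ?_ ?_
    · by_cases hg : g ∈ D b
      · rw [if_pos hg, h₃ g hg]
      · rw [if_neg hg, h₃', fa, hmk]
        rintro g' hg' h
        exact hg (Fin.ext (by omega : (g : ℕ) = g') ▸ hg')
    · ring_nf at hκ₂ ⊢; omega
    rintro M₄ hs₄ ⟨L, hsort, hS⟩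
    rw [(hD b).2] at hsort
    have hmemL : ∀ g, g ∈ L ↔ g ∈ D b := fun g => by
      rw [hmemD, ← hsort.toFinset, List.mem_toFinset]
    have g₅ : M₄.wreg 5 = b := by rw [hs₄.wreg 5 (by decide), hs₃.wreg 5 (by decide), f₅]
    have g₇ : M₄.wreg 7 = st b := by rw [hs₄.wreg 7 (by decide), hs₃.wreg 7 (by decide), f₇]
    have g₈ : M₄.wreg 8 = (D b).length := by
      rw [hs₄.wreg 8 (by decide), hs₃.wreg 8 (by decide), f₈]
    have g₆ : ∀ (i : ℕ) (g : Fin n), (D b)[i]? = some g → M₄.warr 6 (st b + i) = g := by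
      intro i g hi
      rw [hs₄.warr 6 (by decide), hs₃.warr 6 (by decide), fa, e₆]; exact h₆ b i g hi
    have g₁₄ : M₄.warr 14 = M₁.warr 14 := by
      rw [hs₄.warr 14 (by decide), hs₃.warr 14 (by decide), fa]
    refine Run.andThen (5 + κ * 15) (run_assignGates (b := b) (s := st b) (D := D b) hins hC g₅ g₇
      g₈ g₆ (fun g => by
        rw [hs₄.warr 7 (by decide), hs₄.warr 8 (by decide), hs₃.warr 7 (by decide),
          hs₃.warr 8 (by decide), fa]
        exact eA g) (by rw [hS.zero]; decide) (fun g => ?_) (by omega)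
        (by have := b.isLt; omega)) (by omega) ?_
    · rw [hS.mark]
      by_cases hg : g ∈ D b
      · simp [hg, (hmemL g).2 hg]
      · have : g ∉ L := fun h => hg ((hmemL g).1 h)
        simp [hg, this]
    intro M₅ hs₅ h₅'
    refine (run_mark (a := 11) (a' := 6) (s := 7) (N := 8) (v := 0) (L := D b)
      (by decide) (by decide) (by decide) (by rw [hs₅.wreg 8 (by decide), g₈])
      (fun i g hi => by
        rw [hs₅.warr 6 (by decide), hs₅.wreg 7 (by decide), g₇]; exact g₆ i g hi)
      (by rw [hs₅.wreg 7 (by decide), g₇]; omega) hn (by omega)).mono (by omega) ?_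
    rintro M₆ hs₆ ⟨h₆₁, h₆₂⟩
    have k₁₀ : M₆.warr 10 = M₄.warr 10 := by
      rw [hs₆.warr 10 (by decide), hs₅.warr 10 (by decide)]
    have k₁₁ : M₅.warr 11 = M₄.warr 11 := hs₅.warr 11 (by decide)
    have k₁₄ : M₆.warr 14 = M₅.warr 14 := hs₆.warr 14 (by decide)
    refine ⟨?_, ?_, ?_, ?_⟩
    · rw [h₆₂ 0 (by simp), k₁₁, hS.zero]
    · intro i
      by_cases hi : ∃ g ∈ D b, i + 1 = (g : ℕ) + 1
      · obtain ⟨g, hg, hi⟩ := hi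
        rw [hi]
        exact h₆₁ g hg
      · rw [h₆₂ _ fun g hg h => hi ⟨g, hg, h⟩, k₁₁]
        by_cases hin : i < n
        · have hD' : (⟨i, hin⟩ : Fin n) ∉ D b := fun h => hi ⟨_, h, rfl⟩
          have := hS.mark ⟨i, hin⟩
          rw [if_neg fun h => hD' ((hmemL _).1 h), if_neg hD'] at this
          exact this
        · rw [hS.rest _ (by omega), h₃' _ fun g hg h => hi ⟨g, hg, h⟩, fa, hmk]
    · intro b' hb'
      by_cases hbb : b' = b
      · subst hbb
        exact ⟨L, hsort, fun i g hi => by rw [k₁₀]; exact hS.entry i g hi⟩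
      · have hlt : (b' : ℕ) < b := by
          have : (b' : ℕ) ≠ b := fun h => hbb (Fin.ext h)
          omega
        obtain ⟨L', hL', he⟩ := hL b' hlt
        refine ⟨L', hL', fun i g hi => ?_⟩
        have h₁ := (List.getElem?_eq_some_iff.1 hi).1
        have h₂ : L'.length = (D b').length := by
          rw [← List.toFinset_card_of_nodup hL'.nodup, ← List.toFinset_card_of_nodup (hD b').1,
            hL'.toFinset, (hD b').2]
        have h₃ := hmono b b.isLt.le b' hlt
        rw [k₁₀, hS.before _ (by omega), hs₃.warr 10 (by decide), fa]
        exact he i g hi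
    · intro g
      rw [k₁₄]
      have h₇ := h₅' g
      simp only [hmemD] at h₇
      by_cases hc : g ∈ dom b ∧ ∀ g' ∈ ins g, g' ∈ dom b
      · exact .inr ⟨b, h₇.1 hc, hc⟩
      · rw [h₇.2 hc, g₁₄]
        rcases hasg g with ⟨h₈, h₉⟩ | h
        · refine .inl ⟨h₈, fun b' hb' => ?_⟩
          by_cases hbb : b' = b
          · rw [hbb]; exact hc
          · have : (b' : ℕ) ≠ b := fun h => hbb (Fin.ext h)
            exact h₉ b' (by omega)
        · exact .inr h
  · rintro M' - ⟨-, -, hL, hasg⟩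
    choose L hL₁ hL₂ using fun b : Fin m => hL b b.isLt
    have : ∀ g : Fin n, ∃ b : Fin m,
        M'.warr 14 g = b + 1 ∧ g ∈ dom b ∧ ∀ g' ∈ ins g, g' ∈ dom b := by
      intro g
      rcases hasg g with ⟨-, h⟩ | h
      · obtain ⟨b, hb⟩ := hcov g
        exact absurd hb (h b b.isLt)
      · exact h
    choose asg hasg' using this
    exact ⟨L, asg, hL₁, hL₂, hasg'⟩

end ProbEval

namespace ProbEval

/-- A loop that doubles a table costs a constant per row of the final table; the fixed cost `A` of
each round is absorbed as well. -/
theorem sum_two_pow_mul_le (s A B : ℕ) :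
    ∑ i ∈ Finset.range s, (A + 2 ^ i * B) ≤ 2 ^ s * (A + B) := by
  induction s with
  | zero => simp
  | succ s ih =>
    rw [Finset.sum_range_succ, pow_succ]
    have := Nat.le_mul_of_pos_left A (Nat.two_pow_pos s)
    ring_nf at *
    omega

theorem getElem?_take_eq_some_iff {α : Type} {L : List α} {i j : ℕ} {a : α} :
    (L.take i)[j]? = some a ↔ j < i ∧ L[j]? = some a := by
  rw [List.getElem?_take]
  split <;> simp_all

theorem mem_take_succ_iff {α : Type} {L : List α} {i : ℕ} (hi : i < L.length) {a : α} :
    a ∈ L.take (i + 1) ↔ a ∈ L.take i ∨ a = L[i] := by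
  rw [List.take_succ_eq_append_getElem hi, List.mem_append, List.mem_singleton]

/-- The entries of the list `L` are at the addresses `s, s + 1, …` of array `10`. -/
def HasList {n : ℕ} (M : Memory) (s : ℕ) (L : List (Fin n)) : Prop :=
  ∀ (i : ℕ) (g : Fin n), L[i]? = some g → M.warr 10 (s + i) = g

/-! ## Weights of the gates of a bag -/

/-- Array `12` contains the weights of the gates in the list. -/
structure HasWeights {n : ℕ} (M : Memory) (L : List (Fin n)) : Prop where
  mem : ∀ (i : ℕ) (g : Fin n), L[i]? = some g → M.warr 12 (g + 1) = 2 ^ i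
  notMem : ∀ j : ℕ, (∀ g ∈ L, j ≠ g + 1) → M.warr 12 j = 0

theorem run_setWeights {w β n : ℕ} {M : Memory} {L : List (Fin n)} {s : ℕ} (hL : L.Nodup)
    (h₇ : M.wreg 7 = s) (h₈ : M.wreg 8 = L.length) (hA : HasList M s L)
    (hz : ∀ j, M.warr 12 j = 0) (hw : s + L.length < w) (hw' : 2 ^ L.length ≤ w) (hn : n ≤ w) :
    Run w β setWeights M (10 + L.length * 25) fun M' =>
      M'.wreg 12 = 2 ^ L.length ∧ HasWeights M' L := by
  refine Run.step 2 (5 + L.length * (18 + 7)) (by decide) (by omega) ?_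
  simp only [Program.wp, WordExp.fits_ofNat, WordExp.val_ofNat]
  refine ⟨by omega, ?_⟩
  refine (Run.forLoop_const (K := L.length)
    (fun i M' => M'.wreg 12 = 2 ^ i ∧ HasWeights M' (L.take i))
    (by decide) (by decide) (by decide) (by simpa using h₈) (by omega) ?_ ?_).mono le_rfl ?_
  · exact ⟨by simp, ⟨by simp, by simpa using hz⟩⟩
  · rintro i hi M' hs h₉ - ⟨h₁₂, hI⟩
    have e₇ : M'.wreg 7 = s := by rw [hs.wreg 7 (by decide)]; simpa using h₇
    have hLi := List.getElem?_eq_getElem hi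
    have e₁₀ : M'.warr 10 (s + i) = L[i] := by
      rw [hs.warr 10 (by decide)]; exact hA i _ hLi
    have hlt := L[i].isLt
    have hpow : 2 ^ i + 2 ^ i ≤ w := by
      rw [← two_mul, ← pow_succ']
      exact (Nat.pow_le_pow_right (by norm_num) hi).trans hw'
    refine Run.straight (by decide) ?_
    simp only [Program.wp, WordExp.fits_get, WordExp.fits_add, WordExp.fits_reg, WordExp.val_get,
      WordExp.val_add, WordExp.val_reg, WordExp.fits_ofNat, WordExp.val_ofNat, e₇, h₉, e₁₀, h₁₂,
      Memory.wreg_putW]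
    refine ⟨⟨⟨⟨trivial, trivial, by omega⟩, by omega, by omega⟩, trivial⟩,
      ⟨trivial, trivial, hpow⟩, by simp; ring, ⟨?_, ?_⟩⟩
    · intro j g hj
      obtain ⟨hj₁, hj₂⟩ := getElem?_take_eq_some_iff.1 hj
      rcases Nat.lt_succ_iff_lt_or_eq.1 hj₁ with hji | rfl
      · have hne : (g : ℕ) ≠ L[i] := by
          intro h
          rw [Fin.ext h, ← hLi] at hj₂
          exact hji.ne ((List.getElem?_inj (by omega) hL).1 hj₂)
        simpa [hne] using hI.mem j g (getElem?_take_eq_some_iff.2 ⟨hji, hj₂⟩)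
      · rw [hLi] at hj₂
        cases hj₂
        simp
    · intro j hj
      have h₁ : j ≠ L[i] + 1 := hj _ ((mem_take_succ_iff hi).2 (.inr rfl))
      simpa [h₁] using hI.notMem j fun g hg => hj g ((mem_take_succ_iff hi).2 (.inl hg))
  · rintro M' - ⟨h₁, h₂⟩
    rw [List.take_length] at h₂
    exact ⟨h₁, h₂⟩

/-! ## Keys of the rows -/

/-- Adding a gate to the list doubles the rows: the lower half keeps its keys, and the upper half
repeats them with the weight of the new gate added. So each key costs a constant time, whatever the
size of the bag. -/
theorem run_fillKeys {w β n : ℕ} {M : Memory} {L : List (Fin n)} {s : ℕ} (hL : L.Nodup)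
    (h₂₁ : M.wreg 21 = s) (h₂₂ : M.wreg 22 = L.length) (hA : HasList M s L) {wt : Fin n → ℕ}
    (hwt : ∀ g : Fin n, M.warr 12 (g + 1) * M.warr 13 (g + 1) = wt g)
    (hsum : ∑ g ∈ L.toFinset, wt g ≤ w) (hw : s + L.length < w) (hw' : 2 ^ L.length < w)
    (hn : n ≤ w) :
    Run w β fillKeys M (2 ^ L.length * 80) fun M' => M'.wreg 12 = 2 ^ L.length ∧
      ∀ x : Fin n → Bool, M'.warr 16 (code L x) = ∑ g ∈ L.toFinset, if x g then wt g else 0 := by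
  have hpos := Nat.two_pow_pos L.length
  refine Run.step 5 (5 + 2 ^ L.length * (45 + 18)) (by decide) (by omega) ?_
  simp only [Program.wp, WordExp.fits_ofNat, WordExp.val_ofNat]
  refine ⟨⟨by omega, by omega⟩, by omega, ?_⟩
  refine (Run.forLoop (K := L.length)
    (fun i M' => M'.wreg 12 = 2 ^ i ∧ ∀ x : Fin n → Bool, M'.warr 16 (code (L.take i) x) =
      ∑ g ∈ (L.take i).toFinset, if x g then wt g else 0)
    (fun i => 38 + 2 ^ i * 18)
    (by decide) (by decide) (by decide) (by simpa using h₂₂) (by omega) ?_ ?_).mono ?_ ?_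
  · exact ⟨by simp, by simp [code]⟩
  · rintro i hi M' hs h₉ - ⟨h₁₂, hI⟩
    have hLi := List.getElem?_eq_getElem hi
    have e₂₁ : M'.wreg 21 = s := by rw [hs.wreg 21 (by decide)]; simpa using h₂₁
    have e₁₀ : M'.warr 10 (s + i) = L[i] := by
      rw [hs.warr 10 (by decide)]; simpa using hA i _ hLi
    have ewt : M'.warr 12 (L[i] + 1) * M'.warr 13 (L[i] + 1) = wt L[i] := by
      rw [hs.warr 12 (by decide), hs.warr 13 (by decide)]; simpa using hwt L[i]
    have hlt := L[i].isLt
    have hpow : 2 ^ i + 2 ^ i ≤ 2 ^ L.length := by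
      rw [← two_mul, ← pow_succ']
      exact Nat.pow_le_pow_right (by norm_num) hi
    have hmemi : L[i] ∈ L.toFinset := by simp
    have hnot : L[i] ∉ (L.take i).toFinset := by
      rw [List.mem_toFinset]
      intro h
      obtain ⟨j, hj, hj'⟩ := List.getElem_of_mem h
      rw [List.length_take] at hj
      rw [List.getElem_take] at hj'
      have := (hL.getElem_inj_iff).1 hj'
      omega
    have hins : (L.take (i + 1)).toFinset = insert L[i] (L.take i).toFinset := by
      ext g
      rw [List.mem_toFinset, mem_take_succ_iff hi, Finset.mem_insert, List.mem_toFinset, or_comm]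
    have hsub : (L.take (i + 1)).toFinset ⊆ L.toFinset := fun g hg => by
      rw [List.mem_toFinset] at hg ⊢
      exact List.mem_of_mem_take hg
    have hsum' : (∑ g ∈ (L.take i).toFinset, wt g) + wt L[i] ≤ w := by
      rw [add_comm, ← Finset.sum_insert hnot, ← hins]
      exact (Finset.sum_le_sum_of_subset hsub).trans hsum
    have hle : ∀ x : Fin n → Bool, (∑ g ∈ (L.take i).toFinset, if x g then wt g else 0) ≤
        ∑ g ∈ (L.take i).toFinset, wt g := fun x =>
      Finset.sum_le_sum fun g _ => by split <;> simp
    have hcode : ∀ x : Fin n → Bool, code (L.take (i + 1)) x =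
        code (L.take i) x + 2 ^ i * (x L[i]).toNat := fun x => by
      rw [List.take_succ_eq_append_getElem hi, code_append_singleton, List.length_take,
        min_eq_left hi.le]
    have hclt : ∀ x : Fin n → Bool, code (L.take i) x < 2 ^ i := fun x => by
      simpa [min_eq_left hi.le] using code_lt (L.take i) x
    refine Run.step 16 (18 + 2 ^ i * (11 + 7)) (by decide) (by omega) ?_
    simp only [Program.wp, WordExp.fits_get, WordExp.fits_add, WordExp.fits_mul, WordExp.fits_reg,
      WordExp.val_get, WordExp.val_add, WordExp.val_mul, WordExp.val_reg, WordExp.fits_ofNat,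
      WordExp.val_ofNat, e₂₁, h₉, e₁₀, Memory.wreg_setW, Memory.warr_setW, if_true, ewt]
    refine ⟨⟨trivial, trivial, by omega⟩,
      ⟨⟨trivial, by omega, by omega⟩, ⟨trivial, by omega, by omega⟩, by omega⟩, ?_⟩
    obtain ⟨M₁, hM₁⟩ : ∃ M₁, M₁ = (M'.setW 11 L[i]).setW 13 (wt L[i]) := ⟨_, rfl⟩
    rw [← hM₁]
    have g₁₂ : M₁.wreg 12 = 2 ^ i := by simp [hM₁, h₁₂]
    have g₁₃ : M₁.wreg 13 = wt L[i] := by simp [hM₁]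
    have g₁₆ : M₁.warr 16 = M'.warr 16 := by simp [hM₁]
    refine Run.andThen 5 (Run.forLoop_const (K := 2 ^ i) (T := 11)
      (fun j M'' => (∀ j' < j, M''.warr 16 (2 ^ i + j') = M'.warr 16 j' + wt L[i]) ∧
        ∀ j' < 2 ^ i, M''.warr 16 j' = M'.warr 16 j')
      (by decide) (by decide) (by decide) g₁₂ (by omega) ⟨by simp, by simp [g₁₆]⟩ ?_) (by omega) ?_
    · rintro j hj M'' hs' h₁₀ h₁₂' ⟨hI₁, hI₂⟩
      have k₁₃ : M''.wreg 13 = wt L[i] := by rw [hs'.wreg 13 (by decide), g₁₃]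
      -- Every row already present is the code of an assignment, so its key is a partial sum of
      -- weights and stays within the word size after the addition.
      obtain ⟨x, -, hx⟩ := exists_code (hL.sublist (List.take_sublist i L)) (fun _ => false)
        (j := j) (by simpa [min_eq_left hi.le] using hj)
      have k₁₆ := hI₂ j hj
      have hbound : M'.warr 16 j + wt L[i] ≤ w := by
        rw [← hx, hI x]
        have := hle x
        omega
      refine Run.straight (by decide) ?_
      simp only [Program.wp, WordExp.fits_get, WordExp.fits_add, WordExp.fits_reg,
        WordExp.val_get, WordExp.val_add, WordExp.val_reg, h₁₀, h₁₂', k₁₃, k₁₆]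
      refine ⟨⟨⟨trivial, trivial, by omega⟩, trivial, trivial, hbound⟩, ?_, ?_⟩
      · intro j' hj'
        rcases Nat.lt_succ_iff_lt_or_eq.1 hj' with h | rfl
        · simpa [h.ne] using hI₁ j' h
        · simp
      · intro j' hj'
        have : j' ≠ 2 ^ i + j := by omega
        simpa [this] using hI₂ j' hj'
    · rintro M'' hs' ⟨hI₁, hI₂⟩
      have k₁₂ : M''.wreg 12 = 2 ^ i := by rw [hs'.wreg 12 (by decide), g₁₂]
      refine Run.straight (by decide) ?_
      simp only [Program.wp, WordExp.fits_add, WordExp.fits_reg, WordExp.val_add, WordExp.val_reg,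
        k₁₂]
      refine ⟨⟨trivial, trivial, by omega⟩, by simp; ring, fun x => ?_⟩
      have h₁ := hclt x
      rw [hins, Finset.sum_insert hnot, hcode]
      simp only [Memory.warr_setW]
      cases x L[i]
      · simpa using (hI₂ _ h₁).trans (hI x)
      · have := hI₁ _ h₁
        rw [hI x] at this
        simpa [add_comm] using this
  · have := sum_two_pow_mul_le L.length 45 18
    simp only [show ∀ i, 38 + 2 ^ i * 18 + 7 = 45 + 2 ^ i * 18 from fun i => by ring]
    omega
  · rintro M' - ⟨h₁, h₂⟩
    simp only [List.take_length] at h₂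
    exact ⟨h₁, h₂⟩

/-! ## Messages -/

/-- The bit bound is assumed for sums over all sets of rows, because the partial sums of the
accumulation are of this kind. -/
theorem run_sumRows {w β K o : ℕ} {M : Memory} (h₁₂ : M.wreg 12 = K) (h₁₈ : M.wreg 18 = o)
    (hβ : ∀ J ⊆ Finset.range K, ratBits (∑ j ∈ J, M.qarr 2 (o + j)) ≤ β) (hw : o + K < w) :
    Run w β sumRows M (10 + K * 35) fun M' => ∀ j < K, M'.qarr 3 (M.warr 16 j) =
      ∑ i ∈ Finset.range K with M.warr 16 i = M.warr 16 j, M.qarr 2 (o + i) := by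
  have hβ₀ : ratBits 0 ≤ β := by simpa using hβ ∅ (by simp)
  refine Run.andThen (5 + K * (14 + 7)) (Run.forLoop_const (T := 7) (K := K)
    (fun i M' => ∀ j < i, M'.qarr 3 (M.warr 16 j) = 0) (by decide) (by decide) (by decide) h₁₂
    (by omega) (by simp) ?_) (by omega) ?_
  · intro i hi M' hs h₉ _ hI
    have e₁₆ : M'.warr 16 = M.warr 16 := hs.warr 16 (by decide)
    refine Run.straight (by decide) ?_
    simp only [Program.wp, WordExp.fits_get, WordExp.fits_reg, WordExp.val_get, WordExp.val_reg,
      RatExp.fits_zero, RatExp.small_zero, RatExp.val_zero, h₉, e₁₆]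
    refine ⟨⟨trivial, trivial, hβ₀⟩, fun j hj => ?_⟩
    rcases Nat.lt_succ_iff_lt_or_eq.1 hj with h | rfl
    · have := hI j h
      simp only [Memory.qarr_setW, Memory.qarr_putQ, this, ite_self]
    · simp
  intro M₁ hs₁ h₀
  have f₁₂ : M₁.wreg 12 = K := by rw [hs₁.wreg 12 (by decide), h₁₂]
  have f₁₈ : M₁.wreg 18 = o := by rw [hs₁.wreg 18 (by decide), h₁₈]
  have f₁₆ : M₁.warr 16 = M.warr 16 := hs₁.warr 16 (by decide)
  have f₂ : M₁.qarr 2 = M.qarr 2 := hs₁.qarr 2 (by decide)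
  refine Run.forLoop_const (K := K)
    (fun i M' => ∀ j < K, M'.qarr 3 (M.warr 16 j) =
      ∑ i ∈ Finset.range i with M.warr 16 i = M.warr 16 j, M.qarr 2 (o + i))
    (by decide) (by decide) (by decide) f₁₂ (by omega) (by simpa using h₀) ?_
  intro i hi M' hs h₉ _ hI
  have e₁₆ : M'.warr 16 = M.warr 16 := by rw [hs.warr 16 (by decide), f₁₆]
  have e₁₈ : M'.wreg 18 = o := by rw [hs.wreg 18 (by decide), f₁₈]
  have e₂ : M'.qarr 2 = M.qarr 2 := by rw [hs.qarr 2 (by decide), f₂]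
  have hsub : ∀ i' ≤ K, ∀ j, (Finset.range i').filter (fun i => M.warr 16 i = M.warr 16 j) ⊆
      Finset.range K := fun i' hi' j =>
    (Finset.filter_subset _ _).trans (Finset.range_subset_range.2 hi')
  have hsucc : ∀ j, ∑ i ∈ Finset.range (i + 1) with M.warr 16 i = M.warr 16 j, M.qarr 2 (o + i) =
      (∑ i ∈ Finset.range i with M.warr 16 i = M.warr 16 j, M.qarr 2 (o + i)) +
        if M.warr 16 i = M.warr 16 j then M.qarr 2 (o + i) else 0 := by
    intro j
    rw [Finset.sum_filter, Finset.sum_range_succ, ← Finset.sum_filter]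
  refine Run.straight (by decide) ?_
  simp only [Program.wp, WordExp.fits_get, WordExp.fits_reg, WordExp.fits_add, WordExp.val_get,
    WordExp.val_reg, WordExp.val_add, RatExp.fits_add, RatExp.fits_get, RatExp.small_add,
    RatExp.small_get, RatExp.val_add, RatExp.val_get, h₉, e₁₆, e₁₈, e₂, hI i hi]
  refine ⟨⟨trivial, ⟨trivial, trivial, trivial, by omega⟩, hβ _ (hsub i hi.le i), ?_, ?_⟩, ?_⟩
  · simpa using hβ {i} (by simpa using hi)
  · have := hsucc i
    rw [if_pos rfl] at this
    rw [← this]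
    exact hβ _ (hsub (i + 1) hi i)
  · intro j hj
    rw [hsucc]
    by_cases h : M.warr 16 j = M.warr 16 i
    · simp [h]
    · simp [h, Ne.symm h, hI j hj]

theorem run_multiplyRows {w β K o : ℕ} {M : Memory} (h₁₂ : M.wreg 12 = K) (h₁₄ : M.wreg 14 = o)
    (hβ : ∀ j < K, ratBits (M.qarr 2 (o + j)) ≤ β ∧ ratBits (M.qarr 3 (M.warr 16 j)) ≤ β ∧
      ratBits (M.qarr 2 (o + j) * M.qarr 3 (M.warr 16 j)) ≤ β) (hw : o + K < w) :
    Run w β multiplyRows M (5 + K * 25) fun M' =>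
      (∀ j < K, M'.qarr 2 (o + j) = M.qarr 2 (o + j) * M.qarr 3 (M.warr 16 j)) ∧
      ∀ a < o, M'.qarr 2 a = M.qarr 2 a := by
  refine (Run.forLoop_const (T := 18) (K := K)
    (fun i M' => (∀ j < i, M'.qarr 2 (o + j) = M.qarr 2 (o + j) * M.qarr 3 (M.warr 16 j)) ∧
      (∀ a < o, M'.qarr 2 a = M.qarr 2 a) ∧ ∀ j, i ≤ j → M'.qarr 2 (o + j) = M.qarr 2 (o + j))
    (by decide) (by decide) (by decide) h₁₂ (by omega) (by simp) ?_).mono (by omega) ?_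
  · rintro i hi M' hs h₉ - ⟨hI₁, hI₂, hI₃⟩
    have e₁₆ : M'.warr 16 = M.warr 16 := hs.warr 16 (by decide)
    have e₁₄ : M'.wreg 14 = o := by rw [hs.wreg 14 (by decide), h₁₄]
    have e₃ : M'.qarr 3 = M.qarr 3 := hs.qarr 3 (by decide)
    have e₂ := hI₃ i le_rfl
    refine Run.straight (by decide) ?_
    simp only [Program.wp, WordExp.fits_get, WordExp.fits_reg, WordExp.fits_add, WordExp.val_get,
      WordExp.val_reg, WordExp.val_add, RatExp.fits_mul, RatExp.fits_get, RatExp.small_mul,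
      RatExp.small_get, RatExp.val_mul, RatExp.val_get, h₉, e₁₆, e₁₄, e₂, e₃]
    refine ⟨⟨⟨trivial, trivial, by omega⟩, ⟨⟨trivial, trivial, by omega⟩, trivial⟩, hβ i hi⟩,
      ?_, ?_, ?_⟩
    · intro j hj
      rcases Nat.lt_succ_iff_lt_or_eq.1 hj with h | rfl
      · simpa [h.ne] using hI₁ j h
      · simp
    · intro a ha
      have : a ≠ o + i := by omega
      simpa [this] using hI₂ a ha
    · intro j hj
      have : j ≠ i := by omega
      simpa [this] using hI₃ j (by omega)
  · rintro M' - ⟨h₁, h₂, -⟩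
    exact ⟨h₁, h₂⟩

end ProbEval

namespace ProbEval

/-! ### The factor of one gate in one row -/

section Local

variable {w n m : ℕ} {C : Circuit (Fin n)} {ins : Fin n → List (Fin n)} {π : ProbValuation C}
  {asg : Fin n → Fin m}

/-- The memory describes the gates of the circuit and their bags. -/
structure GateData (M : Memory) (ins : Fin n → List (Fin n)) (π : ProbValuation C)
    (asg : Fin n → Fin m) : Prop where
  kind : ∀ g : Fin n, M.warr 0 g = (C.kind g).code
  inputs : HasInputs M ins
  bag : ∀ g : Fin n, M.warr 14 g = asg g + 1
  prob : ∀ (g : Fin n) (h : C.kind g = .inp),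
    M.qarr 0 g = π.prob ⟨g, h⟩ false ∧ M.qarr 1 g = π.prob ⟨g, h⟩ true
  out : M.wreg 3 = C.out

theorem GateData.congr {M M' : Memory} (h : GateData M ins π asg) (h₀ : M'.warr 0 = M.warr 0)
    (h₇ : M'.warr 7 = M.warr 7) (h₈ : M'.warr 8 = M.warr 8) (h₁₄ : M'.warr 14 = M.warr 14)
    (h₀' : M'.qarr 0 = M.qarr 0) (h₁ : M'.qarr 1 = M.qarr 1) (h₃ : M'.wreg 3 = M.wreg 3) :
    GateData M' ins π asg :=
  ⟨by rw [h₀]; exact h.kind, by rw [HasInputs, h₇, h₈]; exact h.inputs, by rw [h₁₄]; exact h.bag,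
    by rw [h₀', h₁]; exact h.prob, by rw [h₃]; exact h.out⟩

/-- The factor of the gate `g` in the table of the bag `b`. -/
def bagWeight (ins : Fin n → List (Fin n)) (π : ProbValuation C) (asg : Fin n → Fin m) (b : Fin m)
    (g : Fin n) (v : Bool) (x : Fin n → Bool) : ℚ :=
  if asg g = b then gateWeight ins π g v x else 1

theorem run_expectedValue {β : ℕ} {M : Memory} {g : Fin n} {v₁ v₂ : Bool}
    (hk : M.warr 0 g = (C.kind g).code) (h₁₁ : M.wreg 11 = g) (hg : C.kind g ≠ .inp)
    (h₁ : M.wreg 10 / M.warr 12 (M.warr 7 g) % 2 = v₁.toNat)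
    (h₂ : M.wreg 10 / M.warr 12 (M.warr 8 g) % 2 = v₂.toNat) (hw : 5 ≤ w)
    (hw' : M.wreg 10 ≤ w) :
    Run w β expectedValue M 50 fun M' => M'.wreg 13 = ((C.kind g).expected v₁ v₂).toNat := by
  have hdiv : ∀ d, M.wreg 10 / d ≤ w := fun d => (Nat.div_le_self _ _).trans hw'
  have hb₁ := v₁.toNat_le
  have hb₂ := v₂.toNat_le
  refine Run.straight (by decide) ?_
  simp only [expectedValue, Program.wp, WordExp.fits_get, WordExp.fits_reg, WordExp.fits_div,
    WordExp.fits_mod, WordExp.fits_ofNat, WordExp.val_get, WordExp.val_reg, WordExp.val_div,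
    WordExp.val_mod, WordExp.val_ofNat, WordExp.fits_add, WordExp.fits_sub, WordExp.fits_mul,
    WordExp.val_add, WordExp.val_sub, WordExp.val_mul, Test.IsWord, Test.fits_eq, Test.holds_eq,
    Memory.wreg_setW, Memory.warr_setW, Nat.reduceEqDiff, if_true, if_false, h₁₁, h₁, h₂, hk]
  refine ⟨⟨⟨trivial, trivial, hdiv _⟩, by omega, by omega⟩,
    ⟨⟨trivial, trivial, hdiv _⟩, by omega, by omega⟩, ?_⟩
  cases hkind : C.kind g
  · exact absurd hkind hg
  all_goals
    cases v₁ <;> cases v₂ <;> simp [GateKind.code, GateKind.expected] <;> omega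

theorem run_gateFactor {M : Memory} {b : Fin m} {g : Fin n} {l : List (Fin n)} {x : Fin n → Bool}
    (hM : GateData M ins π asg) (h₆ : M.wreg 6 = b) (h₁₁ : M.wreg 11 = g)
    (h₁₀ : M.wreg 10 = code l x) (hl : M.warr 12 0 = 0 ∧
      ∀ (p : ℕ) (g' : Fin n), l[p]? = some g' → M.warr 12 (g' + 1) = 2 ^ p)
    (hsub : asg g = b → ∀ g' ∈ ins g, g' ∈ l) (hw : 5 ≤ w) (hm : m ≤ w)
    (hw' : 2 ^ l.length ≤ w) :
    Run w (bitBound π) gateFactor M 100 fun M' =>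
      M'.qreg 2 = bagWeight ins π asg b g false x ∧ M'.qreg 3 = bagWeight ins π asg b g true x := by
  have hx := (code_lt l x).le.trans hw'
  have hz := ratBits_zero_le π
  have ho := ratBits_one_le π
  have hb := hM.bag g
  have hbw := b.isLt
  refine (Run.cond (T := 92) (T' := 6) ?_ ?_ (fun h => ?_) fun h => ?_).mono (by decide)
    fun _ _ h => h
  · trivial
  · simp [h₆]; omega
  swap
  · have hne : asg g ≠ b := by
      rintro rfl
      simp [h₁₁, h₆, hb] at h
    refine Run.straight (by decide) ?_
    simp [Program.wp, bagWeight, hne, ho]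
  have hasg : asg g = b := by
    simp [h₁₁, h₆, hb] at h
    exact Fin.ext h
  -- An existing input of a gate charged to the bag is a bit of the row. For a missing one, division
  -- by the weight 0 gives 0, in accordance with the default `false` of `valueAt`.
  have hbit : ∀ i : ℕ, M.wreg 10 / M.warr 12 (pointer (ins g)[i]?) % 2 =
      (valueAt x (ins g)[i]?).toNat := by
    intro i
    rw [h₁₀]
    cases h' : (ins g)[i]? with
    | none => simp [pointer, hl.1, valueAt]
    | some g' =>
      obtain ⟨p, hp, rfl⟩ := List.getElem_of_mem (hsub hasg g' (List.mem_of_getElem? h'))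
      have := hl.2 p _ (List.getElem?_eq_getElem hp)
      simp only [pointer, this, valueAt, Option.elim]
      exact code_div_mod l x p hp
  have hk := hM.kind g
  simp only [bagWeight, hasg, if_true]
  -- At the output gate the factor for `false` is not correct yet; the final test replaces it by 0.
  refine Run.andThen (T₁ := 80) 12 (Q := fun M' =>
    M'.qreg 3 = gateWeight ins π g true x ∧
    (g ≠ C.out → M'.qreg 2 = gateWeight ins π g false x)) ?_ (by decide) ?_
  · refine (Run.cond (T := 8) (T' := 70) ?_ ?_ (fun h => ?_) fun h => ?_).mono (by decide)
      fun _ _ h => h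
    · trivial
    · simp
    · have hkind : C.kind g = .inp := by
        simp only [Test.holds_eq, WordExp.val_get, WordExp.val_reg, h₁₁, hk,
          WordExp.val_ofNat] at h
        cases h' : C.kind g <;> simp [h', GateKind.code] at h ⊢
      refine Run.straight (by decide) ?_
      have hp := hM.prob g hkind
      simp [Program.wp, h₁₁, hp, ratBits_prob_le, gateWeight, hkind]
      intro h₁ h₂
      exact absurd h₂ h₁
    · have hkind : C.kind g ≠ .inp := by
        intro h'
        simp [h₁₁, hk, h', GateKind.code] at h
      refine Run.andThen 10 (run_expectedValue hk h₁₁ hkind (by rw [(hM.inputs g).1]; exact hbit 0)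
        (by rw [(hM.inputs g).2]; exact hbit 1) hw (by omega)) (by decide) ?_
      intro M' hs h₁₃
      refine Run.straight (by decide) ?_
      simp only [gateWeight, hkind, dif_neg, not_false_eq_true]
      cases hv : (C.kind g).expected (valueAt x (ins g)[0]?) (valueAt x (ins g)[1]?) <;>
        simp [Program.wp, Test.IsWord, h₁₃, hv, hz, ho]
  · rintro M' hs ⟨h₃, h₂⟩
    have e₁₁ : M'.wreg 11 = g := by rw [hs.wreg 11 (by decide), h₁₁]
    have e₃ : M'.wreg 3 = C.out := by rw [hs.wreg 3 (by decide), hM.out]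
    refine Run.straight (by decide) ?_
    by_cases hgo : g = C.out
    · have : (g : ℕ) = C.out := congrArg _ hgo
      simp [Program.wp, Test.IsWord, e₁₁, e₃, this, h₃, hz]
      simp [gateWeight, hgo]
    · have : (g : ℕ) ≠ C.out := fun h => hgo (Fin.ext h)
      simp [Program.wp, Test.IsWord, e₁₁, e₃, this, h₃, h₂ hgo]

end Local
end ProbEval

namespace ProbEval

/-! ### The product of the factors charged to a bag -/

section Local

variable {w n m : ℕ} {C : Circuit (Fin n)} {ins : Fin n → List (Fin n)} {π : ProbValuation C}
  {asg : Fin n → Fin m}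

/-- After `i` gates the table holds the product of the factors charged to `b` among them, one row
for each assignment of these gates. The next gate splits each row in two, and its factor is
determined by the row and its own value because its inputs precede it. -/
theorem run_localTable {M : Memory} {b : Fin m} {s o : ℕ} {dom : Finset (Fin n)}
    {L : List (Fin n)} (hM : GateData M ins π asg) (h₆ : M.wreg 6 = b) (h₇ : M.wreg 7 = s)
    (h₈ : M.wreg 8 = L.length) (h₁₄ : M.wreg 14 = o) (hA : HasList M s L)
    (hW : HasWeights M L) (hL : IsSorted ins dom L)
    (hasg : ∀ g, asg g = b → g ∈ dom ∧ ∀ g' ∈ ins g, g' ∈ dom) (hw : s + L.length < w)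
    (hw' : o + 2 ^ L.length < w) (hw₅ : 5 ≤ w) (hm : m ≤ w) :
    Run w (bitBound π) localTable M (2 ^ L.length * 200) fun M' =>
      M'.wreg 12 = 2 ^ L.length ∧
      (∀ x, M'.qarr 2 (o + code L x) = prodOf asg (factor ins π) {b} x) ∧
      ∀ a < o, M'.qarr 2 a = M.qarr 2 a := by
  have hpos := Nat.two_pow_pos L.length
  have ho := ratBits_one_le π
  obtain ⟨pp, hpp⟩ : ∃ pp : List (Fin n) → (Fin n → Bool) → ℚ,
      pp = fun l x => ∏ g ∈ l.toFinset with asg g = b, factor ins π g x := ⟨_, rfl⟩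
  have hppb : ∀ l x, ratBits (pp l x) ≤ bitBound π := fun l x => by
    rw [hpp]
    exact ((isFrac_prod π _ x).mono Nat.one_le_two_pow).ratBits_le_bitBound π
  refine Run.step 5 (5 + 2 ^ L.length * (21 + 147)) (by decide) (by omega) ?_
  simp only [Program.wp, WordExp.fits_ofNat, WordExp.val_ofNat, WordExp.fits_reg, WordExp.val_reg,
    RatExp.fits_one, RatExp.small_one, RatExp.val_one, h₁₄]
  refine ⟨⟨trivial, trivial, ho⟩, by omega, ?_⟩
  refine (Run.forLoop (K := L.length)
    (fun i M' => M'.wreg 12 = 2 ^ i ∧ (∀ x, M'.qarr 2 (o + code (L.take i) x) = pp (L.take i) x) ∧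
      ∀ a < o, M'.qarr 2 a = M.qarr 2 a)
    (fun i => 14 + 2 ^ i * 147)
    (by decide) (by decide) (by decide) (by simpa using h₈) (by omega) ?_ ?_).mono ?_ ?_
  · refine ⟨by simp, by simp [code, hpp], fun a ha => ?_⟩
    simp [ha.ne]
  · rintro i hi M' hs h₉ - ⟨h₁₂, hI, hI'⟩
    have hLi := List.getElem?_eq_getElem hi
    have e₇ : M'.wreg 7 = s := by rw [hs.wreg 7 (by decide)]; simpa using h₇
    have e₁₀ : M'.warr 10 (s + i) = L[i] := by
      rw [hs.warr 10 (by decide)]; simpa using hA i _ hLi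
    have e₆ : M'.wreg 6 = b := by rw [hs.wreg 6 (by decide)]; simpa using h₆
    have e₁₄ : M'.wreg 14 = o := by rw [hs.wreg 14 (by decide)]; simpa using h₁₄
    have e₁₂ : M'.warr 12 = M.warr 12 := by rw [hs.warr 12 (by decide)]; rfl
    have eM : GateData M' ins π asg := hM.congr (hs.warr 0 (by decide)) (hs.warr 7 (by decide))
      (hs.warr 8 (by decide)) (hs.warr 14 (by decide))
      ((hs.qarr 0 (by decide)).trans (by funext a; simp))
      ((hs.qarr 1 (by decide)).trans (by funext a; simp)) (hs.wreg 3 (by decide))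
    have hlen : (L.take i).length = i := by rw [List.length_take]; omega
    have hpow : 2 ^ i + 2 ^ i ≤ 2 ^ L.length := by
      rw [← two_mul, ← pow_succ']
      exact Nat.pow_le_pow_right (by norm_num) hi
    have hnot : L[i] ∉ L.take i := by
      intro h
      obtain ⟨j, hj, hj'⟩ := List.getElem_of_mem h
      rw [List.getElem_take] at hj'
      have := (hL.nodup.getElem_inj_iff).1 hj'
      omega
    have hcode : ∀ x : Fin n → Bool, code (L.take (i + 1)) x =
        code (L.take i) x + 2 ^ i * (x L[i]).toNat := fun x => by
      rw [List.take_succ_eq_append_getElem hi, code_append_singleton, hlen]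
    have hclt : ∀ x : Fin n → Bool, code (L.take i) x < 2 ^ i := fun x => by
      simpa [hlen] using code_lt (L.take i) x
    -- A gate charged to `b` has all its inputs in the bag, so the topological order puts all of
    -- them before the gate.
    have hsub : asg L[i] = b → ∀ g' ∈ ins L[i], g' ∈ L.take i := fun h g' hg' =>
      hL.sorted i _ g' hLi hg' ((hasg _ h).2 g' hg')
    have hppsucc : ∀ x, pp (L.take (i + 1)) x =
        pp (L.take i) x * bagWeight ins π asg b L[i] (x L[i]) x := by
      intro x
      have hins : (L.take (i + 1)).toFinset = insert L[i] (L.take i).toFinset := by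
        ext g
        rw [List.mem_toFinset, mem_take_succ_iff hi, Finset.mem_insert, List.mem_toFinset, or_comm]
      simp only [hpp]
      rw [hins, Finset.filter_insert]
      by_cases h : asg L[i] = b
      · rw [if_pos h, Finset.prod_insert (by simp [hnot]), bagWeight, if_pos h, mul_comm]
        rfl
      · rw [if_neg h, bagWeight, if_neg h, mul_one]
    have hwcongr : ∀ v x y, code (L.take i) x = code (L.take i) y →
        bagWeight ins π asg b L[i] v x = bagWeight ins π asg b L[i] v y := by
      intro v x y hxy
      unfold bagWeight
      split
      · rename_i h
        exact gateWeight_congr π _ v fun g' hg' => eq_of_code_eq hxy g' (hsub h g' hg')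
      · rfl
    refine Run.step 5 (9 + 2 ^ i * (140 + 7)) (by decide) (by omega) ?_
    simp only [Program.wp, WordExp.fits_get, WordExp.fits_add, WordExp.fits_reg,
      WordExp.val_get, WordExp.val_add, WordExp.val_reg, e₇, h₉, e₁₀]
    refine ⟨⟨trivial, trivial, by omega⟩, ?_⟩
    obtain ⟨M₁, hM₁⟩ : ∃ M₁, M₁ = M'.setW 11 L[i] := ⟨_, rfl⟩
    rw [← hM₁]
    have g₁₁ : M₁.wreg 11 = L[i] := by simp [hM₁]
    have g₁₂ : M₁.wreg 12 = 2 ^ i := by simp [hM₁, h₁₂]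
    have g₁₄ : M₁.wreg 14 = o := by simp [hM₁, e₁₄]
    have g₆ : M₁.wreg 6 = b := by simp [hM₁, e₆]
    have gM : GateData M₁ ins π asg := by
      rw [hM₁]; exact eM.congr rfl rfl rfl rfl rfl rfl (by simp)
    have gq : M₁.qarr = M'.qarr := by rw [hM₁]; rfl
    have gw : M₁.warr = M'.warr := by rw [hM₁]; rfl
    refine Run.andThen 4 (Run.forLoop_const (K := 2 ^ i) (T := 140)
      (fun j M'' => (∀ x, code (L.take i) x < j →
          M''.qarr 2 (o + code (L.take i) x) =
            pp (L.take i) x * bagWeight ins π asg b L[i] false x ∧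
          M''.qarr 2 (o + 2 ^ i + code (L.take i) x) =
            pp (L.take i) x * bagWeight ins π asg b L[i] true x) ∧
        (∀ x, j ≤ code (L.take i) x → M''.qarr 2 (o + code (L.take i) x) = pp (L.take i) x) ∧
        ∀ a < o, M''.qarr 2 a = M.qarr 2 a)
      (by decide) (by decide) (by decide) g₁₂ (by omega)
      ⟨by simp, by simpa [gq] using hI, by simpa [gq] using hI'⟩ ?_) (by omega) ?_
    · rintro j hj M'' hs' h₁₀ h₁₂' ⟨hI₁, hI₂, hI₃⟩
      obtain ⟨x, -, hx⟩ := exists_code (hL.nodup.sublist (List.take_sublist i L))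
        (fun _ => false) (j := j) (by simpa [hlen] using hj)
      have k₁₂ : M''.warr 12 = M.warr 12 := by rw [hs'.warr 12 (by decide), gw, e₁₂]
      have kM : GateData M'' ins π asg := gM.congr (hs'.warr 0 (by decide))
        (hs'.warr 7 (by decide)) (hs'.warr 8 (by decide)) (hs'.warr 14 (by decide))
        (hs'.qarr 0 (by decide)) (hs'.qarr 1 (by decide)) (hs'.wreg 3 (by decide))
      refine Run.andThen 30 (run_gateFactor (b := b) (g := L[i]) (l := L.take i) (x := x) kM
        (by rw [hs'.wreg 6 (by decide), g₆]) (by rw [hs'.wreg 11 (by decide), g₁₁])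
        (by rw [h₁₀, hx]) ⟨by rw [k₁₂]; exact hW.notMem 0 (by simp), fun p g' hp => by
          rw [k₁₂]; exact hW.mem p g' (getElem?_take_eq_some_iff.1 hp).2⟩ hsub hw₅ hm
        (by rw [hlen]; omega)) (by decide) ?_
      rintro N hsN ⟨hq₂, hq₃⟩
      have n₁₀ : N.wreg 10 = j := by rw [hsN.wreg 10 (by decide), h₁₀]
      have n₁₂ : N.wreg 12 = 2 ^ i := by rw [hsN.wreg 12 (by decide), h₁₂']
      have n₁₄ : N.wreg 14 = o := by
        rw [hsN.wreg 14 (by decide), hs'.wreg 14 (by decide), g₁₄]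
      have nq : N.qarr 2 = M''.qarr 2 := hsN.qarr 2 (by decide)
      have nj : N.qarr 2 (o + j) = pp (L.take i) x := by
        rw [nq, ← hx]; exact hI₂ x hx.ge
      have hbits : ∀ v, ratBits (pp (L.take i) x * bagWeight ins π asg b L[i] v x) ≤
          bitBound π ∧ ratBits (bagWeight ins π asg b L[i] v x) ≤ bitBound π := by
        intro v
        -- The value `v` need not be the one in `x`. Changing `x` at the new gate leaves the row
        -- unchanged and exhibits the new entry as a genuine partial product, to which the bit bound
        -- applies.
        have hc : code (L.take i) (Function.update x L[i] v) = code (L.take i) x :=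
          code_congr fun g hg =>
            Function.update_of_ne (fun h : g = L[i] => hnot (h ▸ hg)) _ _
        have h₁ : pp (L.take i) x = pp (L.take i) (Function.update x L[i] v) := by
          rw [← hI₂ x hx.ge, ← hI₂ _ (hc.trans hx).ge, hc]
        have h₂ := hwcongr v _ _ hc
        have h₃ := hppsucc (Function.update x L[i] v)
        rw [Function.update_self] at h₃
        constructor
        · rw [h₁, ← h₂, ← h₃]
          exact hppb _ _
        · rw [← h₂, bagWeight]
          split
          · have := isFrac_prod (ins := ins) π {L[i]} (Function.update x L[i] v)
            rw [Finset.prod_singleton, factor, Function.update_self] at this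
            exact (this.mono Nat.one_le_two_pow).ratBits_le_bitBound π
          · exact ho
      refine Run.straight (by decide) ?_
      simp only [Program.wp, WordExp.fits_reg, WordExp.fits_add,
        WordExp.val_reg, WordExp.val_add, RatExp.fits_mul, RatExp.fits_get, RatExp.fits_reg,
        RatExp.small_mul, RatExp.small_get, RatExp.small_reg, RatExp.val_mul, RatExp.val_get,
        RatExp.val_reg, Memory.wreg_putQ, Memory.qreg_putQ, n₁₀, n₁₂, n₁₄, nj, hq₂, hq₃,
        Memory.qarr_putQ, true_and, if_neg (show ¬ o + j = o + 2 ^ i + j by omega)]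
      refine ⟨⟨⟨by omega, by omega⟩, ⟨by omega, trivial⟩, hppb _ _, (hbits true).2,
        (hbits true).1⟩, ⟨by omega, ⟨by omega, trivial⟩, hppb _ _, (hbits false).2,
        (hbits false).1⟩, ?_, ?_, ?_⟩
      · intro y hy
        have hyi := hclt y
        rcases Nat.lt_succ_iff_lt_or_eq.1 hy with h | h
        · have h₁ : o + 2 ^ i + code (L.take i) y ≠ o + j := by omega
          have h₂ : o + code (L.take i) y ≠ o + 2 ^ i + j := by omega
          simpa [h.ne, h₁, h₂, nq] using hI₁ y h
        · have hxy : code (L.take i) x = code (L.take i) y := by omega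
          have h₁ : pp (L.take i) y = pp (L.take i) x := by
            rw [← hI₂ x hx.ge, ← hI₂ y h.ge, hxy]
          rw [← hwcongr false x y hxy, ← hwcongr true x y hxy, h₁, h]
          simp
      · intro y hy
        have hyi := hclt y
        have h₁ : code (L.take i) y ≠ j := by omega
        have h₂ : o + code (L.take i) y ≠ o + 2 ^ i + j := by omega
        simpa [h₁, h₂, nq] using hI₂ y (by omega)
      · intro a ha
        have h₁ : a ≠ o + j := by omega
        have h₂ : a ≠ o + 2 ^ i + j := by omega
        simpa [h₁, h₂, nq] using hI₃ a ha
    · rintro M'' hs' ⟨hI₁, -, hI₃⟩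
      have k₁₂ : M''.wreg 12 = 2 ^ i := by rw [hs'.wreg 12 (by decide), g₁₂]
      refine Run.straight (by decide) ?_
      simp only [Program.wp, WordExp.fits_add, WordExp.fits_reg, WordExp.val_add, WordExp.val_reg,
        k₁₂]
      refine ⟨⟨trivial, trivial, by omega⟩, by simp; ring, fun x => ?_, by simpa using hI₃⟩
      obtain ⟨h₁, h₂⟩ := hI₁ x (hclt x)
      rw [hcode, hppsucc]
      simp only [Memory.qarr_setW]
      cases x L[i]
      · simpa using h₁
      · rw [← h₂]
        congr 1
        simp
        omega
  · have := sum_two_pow_mul_le L.length 21 147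
    simp only [show ∀ i, 14 + 2 ^ i * 147 + 7 = 21 + 2 ^ i * 147 from fun i => by ring]
    omega
  · rintro M' - ⟨h₁, h₂, h₃⟩
    simp only [List.take_length] at h₂
    refine ⟨h₁, fun x => ?_, h₃⟩
    rw [h₂, hpp, prodOf]
    refine Finset.prod_congr (Finset.ext fun g => ?_) fun _ _ => rfl
    simp only [Finset.mem_filter, List.mem_toFinset, Finset.mem_univ, true_and,
      Finset.mem_singleton, and_iff_right_iff_imp]
    intro hg
    rw [← List.mem_toFinset, hL.toFinset]
    exact (hasg g hg).1

end Local

end ProbEval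

namespace ProbEval

/-! ### Multiplication by the message of a child -/

section Absorb

variable {w β n : ℕ}

/-- Summing over all child assignments that agree with `x` on the shared gates is the same as
summing out the unshared ones; this is how grouping by keys computes a message. -/
theorem sumOver_filter {α : Type} [Fintype α] [DecidableEq α] (U U' : Finset α)
    (f : (α → Bool) → ℚ) (x : α → Bool) (p : (α → Bool) → Prop) [DecidablePred p]
    (hp : ∀ z, p z ↔ ∀ g ∈ U, g ∈ U' → z g = x g) :
    sumOver U (fun z => if p z then f z else 0) x = sumOver (U \ U') f x := by
  rw [sumOver, sumOver, ← Finset.sum_filter, Finset.filter_filter]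
  refine Finset.sum_congr (Finset.filter_congr fun z _ => ?_) fun _ _ => rfl
  rw [hp]
  simp only [Finset.mem_sdiff, not_and, not_not]
  constructor
  · rintro ⟨h₁, h₂⟩ g hg
    by_cases h : g ∈ U
    · exact h₂ g h (hg h)
    · exact h₁ g h
  · intro h
    exact ⟨fun g hg => h g fun h' => absurd h' hg, fun g _ hg' => h g fun _ => hg'⟩

/-- Two rows have equal keys exactly when they agree on the gates that both bags contain. Moreover,
any assignment `x` gives a parent row and a child row with the same key, so each cell read in the
multiplication has been initialized. -/
theorem run_absorbBag {M : Memory} {c s s' o o' H : ℕ} {L L' : List (Fin n)}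
    {τ cur : (Fin n → Bool) → ℚ} (hL : L.Nodup) (hL' : L'.Nodup)
    (h₁₅ : M.wreg 15 = c) (h₇ : M.wreg 7 = s) (h₈ : M.wreg 8 = L.length) (h₁₄ : M.wreg 14 = o)
    (h₅ : M.warr 5 c = s') (h₅' : M.warr 5 (c + 1) = s' + L'.length) (ha₁₅ : M.warr 15 c = o')
    (hA : HasList M s L) (hA' : HasList M s' L') (hW : HasWeights M L)
    (hz : ∀ j, M.warr 13 j = 0) (hτ : ∀ x, M.qarr 2 (o' + code L' x) = τ x)
    (hcur : ∀ x, M.qarr 2 (o + code L x) = cur x) (hoo : o' + 2 ^ L'.length ≤ o)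
    (hβ : ∀ J ⊆ Finset.range (2 ^ L'.length), ratBits (∑ j ∈ J, M.qarr 2 (o' + j)) ≤ β)
    (hβ₁ : ∀ x, ratBits (cur x) ≤ β)
    (hβ₂ : ∀ x, ratBits (cur x * sumOver (L'.toFinset \ L.toFinset) τ x) ≤ β)
    (hH : 2 ^ L.length ≤ H) (hH' : 2 ^ L'.length ≤ H) (hw : s + L.length < w)
    (hw' : s' + L'.length < w) (hwo : o + 2 ^ L.length < w) (hn : n ≤ w) (hc : c < w) :
    Run w β absorbBag M (H * 400) fun M' => M'.wreg 12 = 2 ^ L.length ∧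
      (∀ x, M'.qarr 2 (o + code L x) =
        cur x * sumOver (L'.toFinset \ L.toFinset) τ x) ∧
      (∀ a < o, M'.qarr 2 a = M.qarr 2 a) ∧ ∀ j, M'.warr 13 j = 0 := by
  have hpos := Nat.two_pow_pos L.length
  have hpos' := Nat.two_pow_pos L'.length
  have hlen' : L'.length ≤ H := Nat.lt_two_pow_self.le.trans hH'
  obtain ⟨pw, hpw⟩ : ∃ pw : Fin n → ℕ, pw = fun g : Fin n => M.warr 12 (g + 1) := ⟨_, rfl⟩
  obtain ⟨wt, hwt⟩ : ∃ wt : Fin n → ℕ, wt = fun g => if g ∈ L' then pw g else 0 := ⟨_, rfl⟩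
  have hpw₀ : ∀ g ∉ L, pw g = 0 := by
    intro g hg
    rw [hpw]
    exact hW.notMem _ fun g' hg' h => hg (Fin.ext (by omega : (g : ℕ) = g') ▸ hg')
  have hpw₁ : ∀ (p : ℕ) (hp : p < L.length), pw L[p] = 2 ^ p := fun p hp => by
    rw [hpw]; exact hW.mem p _ (List.getElem?_eq_getElem hp)
  obtain ⟨key, hkey⟩ : ∃ key : (Fin n → Bool) → ℕ,
      key = fun x => ∑ g ∈ L.toFinset, if x g then wt g else 0 := ⟨_, rfl⟩
  -- The weights vanish outside the shared gates, so summing over the parent or over the child gives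
  -- the same key.
  have hkey' : ∀ x, key x = ∑ g ∈ L'.toFinset, if x g then wt g else 0 := by
    intro x
    have h₁ : key x = ∑ g, if x g then wt g else 0 := by
      rw [hkey]
      refine Finset.sum_subset (Finset.subset_univ _) fun g _ hg => ?_
      have : wt g = 0 := by simp [hwt, hpw₀ g (by simpa using hg)]
      simp [this]
    rw [h₁]
    symm
    refine Finset.sum_subset (Finset.subset_univ _) fun g _ hg => ?_
    have : wt g = 0 := by
      have : g ∉ L' := by simpa using hg
      simp [hwt, this]
    simp [this]
  -- The key is the parent row in which all unshared gates are reset to `false`. This makes it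
  -- injective on shared values and bounds it by the number of parent rows.
  have hkeyc : ∀ x, key x = code L (fun g => x g && decide (g ∈ L')) := by
    intro x
    rw [code_eq_sum hL _ pw hpw₁, hkey]
    refine Finset.sum_congr rfl fun g _ => ?_
    by_cases h : g ∈ L' <;> simp [hwt, h]
  have hkeyeq : ∀ z x, key z = key x ↔ ∀ g ∈ L'.toFinset, g ∈ L.toFinset → z g = x g := by
    intro z x
    rw [hkeyc, hkeyc]
    constructor
    · intro h g hg hg'
      have := eq_of_code_eq h g (by simpa using hg')
      simpa [List.mem_toFinset.1 hg] using this
    · intro h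
      refine code_congr fun g hg => ?_
      by_cases hg' : g ∈ L'
      · simp [h g (by simpa using hg') (by simpa using hg)]
      · simp [hg']
  have hsumL : ∑ g ∈ L.toFinset, wt g ≤ w := by
    have h₁ := hkeyc fun _ => true
    have h₂ := code_lt L fun g => true && decide (g ∈ L')
    rw [← h₁, hkey] at h₂
    simp only [if_true] at h₂
    omega
  have hsumL' : ∑ g ∈ L'.toFinset, wt g ≤ w := by
    have h₁ := hkey' fun _ => true
    rw [hkey] at h₁
    simp only [if_true] at h₁
    omega
  refine Run.step 25 (H * 375) (by decide) (by omega) ?_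
  simp only [Program.wp, WordExp.fits_get, WordExp.fits_add, WordExp.fits_sub, WordExp.fits_reg,
    WordExp.val_get, WordExp.val_add, WordExp.val_sub, WordExp.val_reg, WordExp.fits_ofNat,
    WordExp.val_ofNat, Memory.wreg_setW, Memory.warr_setW, Nat.reduceEqDiff, if_true, if_false,
    h₁₅, h₅, h₅', ha₁₅, Nat.add_sub_cancel_left]
  refine ⟨trivial, ⟨⟨trivial, by omega, by omega⟩, trivial, by omega⟩, trivial, trivial, trivial,
    ?_⟩
  obtain ⟨M₁, hM₁⟩ : ∃ M₁, M₁ = ((((M.setW 16 s').setW 17 L'.length).setW 18 o').setW 21 s').setW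
    22 L'.length := ⟨_, rfl⟩
  rw [← hM₁]
  have a₁ : M₁.warr = M.warr := by rw [hM₁]; rfl
  have q₁ : M₁.qarr = M.qarr := by rw [hM₁]; rfl
  refine Run.andThen (H * 355) (run_mark (a := 13) (a' := 10) (s := 16) (N := 17) (v := 1)
    (L := L') (by decide) (by decide) (by decide) (by simp [hM₁])
    (fun i g hi => by rw [a₁]; simpa [hM₁] using hA' i g hi) (by simp [hM₁]; omega) hn
    (by omega)) (by omega) ?_
  rintro M₂ hs₂ ⟨hm₁, hm₂⟩
  have hwt₂ : ∀ g : Fin n, M₂.warr 12 (g + 1) * M₂.warr 13 (g + 1) = wt g := by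
    intro g
    rw [hs₂.warr 12 (by decide), a₁, hwt, hpw]
    by_cases hg : g ∈ L'
    · simp [hm₁ g hg, hg]
    · rw [hm₂ ((g : ℕ) + 1) fun g' hg' h => hg (Fin.ext (by omega : (g : ℕ) = g') ▸ hg'), a₁, hz]
      simp [hg]
  have hA₂ : HasList M₂ s' L' := fun i g hi => by
    rw [hs₂.warr 10 (by decide), a₁]; exact hA' i g hi
  refine Run.andThen (H * 275) (run_fillKeys hL' (by rw [hs₂.wreg 21 (by decide)]; simp [hM₁])
    (by rw [hs₂.wreg 22 (by decide)]; simp [hM₁]) hA₂ hwt₂ hsumL' hw' (by omega) hn)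
    (by omega) ?_
  rintro M₃ hs₃ ⟨h₃, hk₃⟩
  have q₃ : M₃.qarr 2 = M.qarr 2 := by rw [hs₃.qarr 2 (by decide), hs₂.qarr 2 (by decide), q₁]
  refine Run.andThen (H * 230) (run_sumRows (o := o') h₃
    (by rw [hs₃.wreg 18 (by decide), hs₂.wreg 18 (by decide)]; simp [hM₁])
    (by rw [q₃]; exact hβ) (by omega)) (by omega) ?_
  rintro M₄ hs₄ h₄
  have hmsg : ∀ x, M₄.qarr 3 (key x) = sumOver (L'.toFinset \ L.toFinset) τ x ∧
      ratBits (M₄.qarr 3 (key x)) ≤ β := by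
    intro x
    have h := h₄ (code L' x) (code_lt L' x)
    rw [hk₃, ← hkey', q₃] at h
    refine ⟨?_, by rw [h]; exact hβ _ (Finset.filter_subset _ _)⟩
    rw [h, Finset.sum_filter, sum_code hL' _ x, ← sumOver_filter _ _ τ x (fun z => key z = key x)
      fun z => hkeyeq z x]
    congr 1
    funext z
    rw [hk₃, ← hkey', hτ]
  refine Run.step 4 (H * 225) (by decide) (by omega) ?_
  simp only [Program.wp, WordExp.fits_reg, WordExp.val_reg, Memory.wreg_setW, Nat.reduceEqDiff,
    if_false]
  refine ⟨trivial, trivial, ?_⟩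
  obtain ⟨M₅, hM₅⟩ : ∃ M₅, M₅ = (M₄.setW 21 (M₄.wreg 7)).setW 22 (M₄.wreg 8) := ⟨_, rfl⟩
  rw [← hM₅]
  have a₅ : M₅.warr = M₄.warr := by rw [hM₅]; rfl
  have q₅ : M₅.qarr = M₄.qarr := by rw [hM₅]; rfl
  have r₇ : M₄.wreg 7 = s := by
    rw [hs₄.wreg 7 (by decide), hs₃.wreg 7 (by decide), hs₂.wreg 7 (by decide)]
    simp [hM₁, h₇]
  have r₈ : M₄.wreg 8 = L.length := by
    rw [hs₄.wreg 8 (by decide), hs₃.wreg 8 (by decide), hs₂.wreg 8 (by decide)]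
    simp [hM₁, h₈]
  refine Run.andThen (H * 145) (run_fillKeys (s := s) (L := L) (wt := wt) hL (by simp [hM₅, r₇])
    (by simp [hM₅, r₈])
    (fun i g hi => by
      rw [a₅, hs₄.warr 10 (by decide), hs₃.warr 10 (by decide), hs₂.warr 10 (by decide), a₁]
      exact hA i g hi)
    (fun g => by
      rw [a₅, hs₄.warr 12 (by decide), hs₃.warr 12 (by decide), hs₄.warr 13 (by decide),
        hs₃.warr 13 (by decide)]
      exact hwt₂ g) hsumL hw (by omega) hn) (by omega) ?_
  rintro M₆ hs₆ ⟨h₆, hk₆⟩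
  have q₆ : M₆.qarr 2 = M.qarr 2 := by
    rw [hs₆.qarr 2 (by decide), q₅, hs₄.qarr 2 (by decide), q₃]
  have q₆' : M₆.qarr 3 = M₄.qarr 3 := by rw [hs₆.qarr 3 (by decide), q₅]
  have hk : ∀ x, M₆.warr 16 (code L x) = key x := fun x => by rw [hk₆, hkey]
  refine Run.andThen (H * 20) (run_multiplyRows (o := o) h₆
    (by
      rw [hs₆.wreg 14 (by decide), hM₅]
      simp only [Memory.wreg_setW, Nat.reduceEqDiff, if_false]
      rw [hs₄.wreg 14 (by decide), hs₃.wreg 14 (by decide), hs₂.wreg 14 (by decide)]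
      simp [hM₁, h₁₄])
    (fun j hj => by
      obtain ⟨x, -, rfl⟩ := exists_code hL (fun _ => false) hj
      rw [q₆, q₆', hk, hcur, (hmsg x).1]
      exact ⟨hβ₁ x, (hmsg x).1 ▸ (hmsg x).2, hβ₂ x⟩) hwo) (by omega) ?_
  rintro M₇ hs₇ ⟨h₇', h₇''⟩
  have w₁₆ : M₇.wreg 16 = s' := by
    rw [hs₇.wreg 16 (by decide), hs₆.wreg 16 (by decide), hM₅]
    simp only [Memory.wreg_setW, Nat.reduceEqDiff, if_false]
    rw [hs₄.wreg 16 (by decide), hs₃.wreg 16 (by decide), hs₂.wreg 16 (by decide)]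
    simp [hM₁]
  have w₁₇ : M₇.wreg 17 = L'.length := by
    rw [hs₇.wreg 17 (by decide), hs₆.wreg 17 (by decide), hM₅]
    simp only [Memory.wreg_setW, Nat.reduceEqDiff, if_false]
    rw [hs₄.wreg 17 (by decide), hs₃.wreg 17 (by decide), hs₂.wreg 17 (by decide)]
    simp [hM₁]
  have a₇ : ∀ a, a = 10 ∨ a = 13 → M₇.warr a = M₂.warr a := by
    rintro a (rfl | rfl)
    · rw [hs₇.warr 10 (by decide), hs₆.warr 10 (by decide), a₅, hs₄.warr 10 (by decide),
        hs₃.warr 10 (by decide)]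
    · rw [hs₇.warr 13 (by decide), hs₆.warr 13 (by decide), a₅, hs₄.warr 13 (by decide),
        hs₃.warr 13 (by decide)]
  refine (run_mark (a := 13) (a' := 10) (s := 16) (N := 17) (v := 0)
    (L := L') (by decide) (by decide) (by decide) w₁₇
    (fun i g hi => by rw [w₁₆, a₇ 10 (.inl rfl)]; exact hA₂ i g hi) (by omega) hn
    (by omega)).mono (by omega) ?_
  rintro M₈ hs₈ ⟨h₈₁, h₈₂⟩
  have q₈ : M₈.qarr 2 = M₇.qarr 2 := hs₈.qarr 2 (by decide)
  refine ⟨?_, fun x => ?_, fun a ha => ?_, fun j => ?_⟩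
  · rw [hs₈.wreg 12 (by decide), hs₇.wreg 12 (by decide), h₆]
  · rw [q₈, h₇' _ (code_lt L x), q₆, q₆', hk, hcur, (hmsg x).1]
  · rw [q₈, h₇'' a ha, q₆]
  · by_cases hj : ∃ g ∈ L', j = (g : ℕ) + 1
    · obtain ⟨g, hg, rfl⟩ := hj
      exact h₈₁ g hg
    · rw [h₈₂ j fun g hg h => hj ⟨g, hg, h⟩, a₇ 13 (.inr rfl),
        hm₂ j fun g hg h => hj ⟨g, hg, h⟩, a₁, hz]

end Absorb

end ProbEval

namespace ProbEval

/-! ### The table of a bag -/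

section Bags

variable {w n m H : ℕ} {C : Circuit (Fin n)} {ins : Fin n → List (Fin n)} {π : ProbValuation C}
  {T : TreeDecomposition C.encoding (Fin m)} {asg : Fin n → Fin m} {L : Fin m → List (Fin n)}
  {st : ℕ → ℕ}

/-- The sorted lists `L` of the bags, starting at the addresses `st`, and the assignment `asg` of
the gates to the bags, for a machine with maximal word `w` and tables with at most `H` rows. -/
structure Layout (T : TreeDecomposition C.encoding (Fin m)) (ins : Fin n → List (Fin n))
    (asg : Fin n → Fin m) (L : Fin m → List (Fin n)) (st : ℕ → ℕ) (w H : ℕ) : Prop where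
  sorted : ∀ b, IsSorted ins (T.dom b) (L b)
  start : ∀ b : Fin m, st (b + 1) = st b + (L b).length
  start_lt : ∀ j ≤ m, st j < w
  home : ∀ g, g ∈ T.dom (asg g) ∧ ∀ g' ∈ ins g, g' ∈ T.dom (asg g)
  rows : ∀ b, 2 ^ (L b).length ≤ H
  gates : n ≤ w
  bags : m < w
  five : 5 ≤ w

theorem Layout.lt (h : Layout T ins asg L st w H) (b : Fin m) : st b + (L b).length < w :=
  h.start b ▸ h.start_lt _ b.isLt

/-- The data that the computation of the tables reads. -/
structure BagData (M : Memory) (T : TreeDecomposition C.encoding (Fin m))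
    (ins : Fin n → List (Fin n)) (π : ProbValuation C) (asg : Fin n → Fin m)
    (L : Fin m → List (Fin n)) (st : ℕ → ℕ) : Prop extends GateData M ins π asg where
  left : ∀ b : Fin m, M.warr 3 b = pointer (T.left b)
  right : ∀ b : Fin m, M.warr 4 b = pointer (T.right b)
  start : ∀ j ≤ m, M.warr 5 j = st j
  lists : HasLists M 10 st L

theorem BagData.congr {M M' : Memory} (h : BagData M T ins π asg L st)
    (ha : ∀ a ∈ [0, 3, 4, 5, 7, 8, 10, 14], M'.warr a = M.warr a)
    (h₀ : M'.qarr 0 = M.qarr 0) (h₁ : M'.qarr 1 = M.qarr 1) (h₃ : M'.wreg 3 = M.wreg 3) :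
    BagData M' T ins π asg L st where
  toGateData := h.toGateData.congr (ha 0 (by decide)) (ha 7 (by decide)) (ha 8 (by decide))
    (ha 14 (by decide)) h₀ h₁ h₃
  left := by rw [ha 3 (by decide)]; exact h.left
  right := by rw [ha 4 (by decide)]; exact h.right
  start := by rw [ha 5 (by decide)]; exact h.start
  lists := by rw [HasLists, ha 10 (by decide)]; exact h.lists

theorem BagData.same {P : Program} {M M' : Memory} (h : BagData M T ins π asg L st)
    (hs : Same P M M') (ha : ∀ a ∈ [0, 3, 4, 5, 7, 8, 10, 14], a ∉ P.wrA) (h₀ : 0 ∉ P.wrR)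
    (h₁ : 1 ∉ P.wrR) (h₃ : 3 ∉ P.wrW) : BagData M' T ins π asg L st :=
  h.congr (fun a h' => hs.warr a (ha a h')) (hs.qarr 0 h₀) (hs.qarr 1 h₁) (hs.wreg 3 h₃)

/-- The rows of the table `τ` of the bag `c` with the list `L` are stored below address `top`. -/
structure HasTable (M : Memory) (L : List (Fin n)) (τ : (Fin n → Bool) → ℚ) (c top : ℕ) :
    Prop where
  le : M.warr 15 c + 2 ^ L.length ≤ top
  row : ∀ x, M.qarr 2 (M.warr 15 c + code L x) = τ x

/-- Tables are stacked upwards in memory, so later work, which writes only from the top on,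
preserves them. -/
theorem HasTable.congr {M M' : Memory} {L : List (Fin n)} {τ : (Fin n → Bool) → ℚ}
    {c top top' : ℕ} (h : HasTable M L τ c top) (h₁₅ : M'.warr 15 c = M.warr 15 c)
    (hq : ∀ a < top, M'.qarr 2 a = M.qarr 2 a) (htop : top ≤ top') : HasTable M' L τ c top' where
  le := by rw [h₁₅]; exact h.le.trans htop
  row x := by
    have := h.le
    have := code_lt L x
    rw [h₁₅, hq _ (by omega)]
    exact h.row x

theorem ratBits_sumOver_le (A : Finset (Fin m)) (U : Finset (Fin n)) (x : Fin n → Bool) :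
    ratBits (sumOver U (prodOf asg (factor ins π) A) x) ≤ bitBound π :=
  ((isFrac_sumOver π asg A U x).mono (Nat.pow_le_pow_right (by norm_num)
    (by omega))).ratBits_le_bitBound π

theorem ratBits_prodOf_le (A : Finset (Fin m)) (x : Fin n → Bool) :
    ratBits (prodOf asg (factor ins π) A x) ≤ bitBound π := by
  simpa [sumOver_empty] using ratBits_sumOver_le (π := π) (ins := ins) (asg := asg) A ∅ x

/-- At most `2 ^ n` rows are added, each of value at most `2 ^ n`; this is where `2 ^ (2 * n)` in
the bit bound comes from. -/
theorem ratBits_sum_rows_le {b : Fin m} {l : List (Fin n)} (hl : l.Nodup) {f : ℕ → ℚ}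
    (hf : ∀ x, f (code l x) = table T asg (factor ins π) b x) {J : Finset ℕ}
    (hJ : J ⊆ Finset.range (2 ^ l.length)) : ratBits (∑ j ∈ J, f j) ≤ bitBound π := by
  have hlen : l.length ≤ n := by simpa using hl.length_le_card
  refine ((IsFrac.sum (N := 2 ^ n) fun j hj => ?_).mono ?_).ratBits_le_bitBound π
  · obtain ⟨x, -, rfl⟩ := exists_code hl (fun _ => false) (Finset.mem_range.1 (hJ hj))
    rw [hf]
    exact isFrac_sumOver π asg _ _ x
  · rw [two_mul, pow_add]
    refine Nat.mul_le_mul_right _ ((Finset.card_le_card hJ).trans ?_)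
    rw [Finset.card_range]
    exact Nat.pow_le_pow_right (by norm_num) hlen

theorem run_absorbChild {M : Memory} {a o : ℕ} {b : Fin m} {oc : Option (Fin m)}
    {cur : (Fin n → Bool) → ℚ} (hG : Layout T ins asg L st w H)
    (hD : BagData M T ins π asg L st) (h₆ : M.wreg 6 = b) (h₇ : M.wreg 7 = st b)
    (h₈ : M.wreg 8 = (L b).length) (h₁₂ : M.wreg 12 = 2 ^ (L b).length) (h₁₄ : M.wreg 14 = o)
    (ha : M.warr a b = pointer oc) (hW : HasWeights M (L b)) (hz : ∀ j, M.warr 13 j = 0)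
    (hc : ∀ c ∈ oc, HasTable M (L c) (table T asg (factor ins π) c) c o)
    (hcur : ∀ x, M.qarr 2 (o + code (L b) x) = cur x) (hβ : ∀ x, ratBits (cur x) ≤ bitBound π)
    (hβ' : ∀ c ∈ oc, ∀ x, ratBits (cur x *
      sumOver (T.dom c \ T.dom b) (table T asg (factor ins π) c) x) ≤ bitBound π)
    (hw : o + 2 ^ (L b).length < w) :
    Run w (bitBound π) (absorbChild a) M (H * 409) fun M' => M'.wreg 12 = 2 ^ (L b).length ∧
      (∀ x, M'.qarr 2 (o + code (L b) x) = oc.elim (cur x) fun c => cur x *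
        sumOver (T.dom c \ T.dom b) (table T asg (factor ins π) c) x) ∧
      (∀ a < o, M'.qarr 2 a = M.qarr 2 a) ∧ ∀ j, M'.warr 13 j = 0 := by
  have hpos := (Nat.two_pow_pos _).trans_le (hG.rows b)
  have hm := hG.bags
  refine (Run.cond (T := 5 + H * 400) (T' := 1) ?_ ?_ (fun h => ?_) fun h => ?_).mono
    (show 4 + _ ≤ _ by omega) fun _ _ h => h
  · trivial
  · exact ⟨Nat.zero_le _, trivial⟩
  · obtain - | c := oc
    · simp [h₆, ha, pointer] at h
    have hcm := c.isLt
    refine Run.step 5 (H * 400) le_rfl le_rfl ?_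
    simp only [Program.wp, WordExp.fits_get, WordExp.fits_sub, WordExp.fits_reg, WordExp.val_get,
      WordExp.val_sub, WordExp.val_reg, WordExp.fits_ofNat, WordExp.val_ofNat, h₆, ha, pointer,
      Nat.add_sub_cancel]
    refine ⟨⟨trivial, by omega, by omega⟩, ?_⟩
    obtain ⟨M₁, hM₁⟩ : ∃ M₁, M₁ = M.setW 15 c := ⟨_, rfl⟩
    rw [← hM₁]
    have a₁ : M₁.warr = M.warr := by rw [hM₁]; rfl
    have q₁ : M₁.qarr = M.qarr := by rw [hM₁]; rfl
    have hT := hc c rfl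
    have e₁ : (L c).toFinset \ (L b).toFinset = T.dom c \ T.dom b := by
      rw [(hG.sorted c).toFinset, (hG.sorted b).toFinset]
    refine (run_absorbBag (H := H) (c := c) (s := st b) (s' := st c) (o := o)
      (o' := M.warr 15 c) (L := L b) (L' := L c) (cur := cur)
      (τ := table T asg (factor ins π) c) (hG.sorted b).nodup
      (hG.sorted c).nodup (by simp [hM₁]) (by simp [hM₁, h₇]) (by simp [hM₁, h₈])
      (by simp [hM₁, h₁₄]) (by rw [a₁]; exact hD.start c hcm.le)
      (by rw [a₁, ← hG.start]; exact hD.start _ hcm) (by rw [a₁])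
      (by rw [HasList, a₁]; exact hD.lists b) (by rw [HasList, a₁]; exact hD.lists c)
      ⟨by rw [a₁]; exact hW.mem, by rw [a₁]; exact hW.notMem⟩ (by rw [a₁]; exact hz)
      (by rw [q₁]; exact hT.row) (by rw [q₁]; exact hcur) hT.le
      (fun J hJ => by
        rw [q₁]
        exact ratBits_sum_rows_le (f := fun j => M.qarr 2 (M.warr 15 c + j)) (hG.sorted c).nodup
          hT.row hJ)
      hβ (by rw [e₁]; exact hβ' c rfl) (hG.rows b) (hG.rows c) (hG.lt b) (hG.lt c) hw hG.gates
      (by omega)).mono le_rfl ?_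
    rintro M₂ - ⟨g₁, g₂, g₃, g₄⟩
    rw [e₁] at g₂
    rw [q₁] at g₃
    exact ⟨g₁, g₂, g₃, g₄⟩
  · obtain - | c := oc
    · exact Run.straight le_rfl ⟨h₁₂, hcur, fun _ _ => rfl, hz⟩
    · simp [h₆, ha, pointer] at h

/-- The successive contents of the table are the local product, its product with the left message,
and that times the right message. Each is again a `sumOver` of a `prodOf`, hence within the bit
bound. Arrays `12` and `13` return to zero for the next bag. -/
theorem run_processBag {M : Memory} {top : ℕ} {b : Fin m} (hG : Layout T ins asg L st w H)
    (hD : BagData M T ins π asg L st) (h₆ : M.wreg 6 = b) (h₂₀ : M.wreg 20 = top)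
    (hz : ∀ j, M.warr 12 j = 0) (hz' : ∀ j, M.warr 13 j = 0)
    (hc : ∀ c : Fin m, T.Child b c → HasTable M (L c) (table T asg (factor ins π) c) c top)
    (hw : top + H < w) :
    Run w (bitBound π) processBag M (H * 1092) fun M' => M'.wreg 14 = top ∧
      M'.wreg 12 = 2 ^ (L b).length ∧ M'.wreg 20 = top + 2 ^ (L b).length ∧ M'.warr 15 b = top ∧
      (∀ c : ℕ, c ≠ b → M'.warr 15 c = M.warr 15 c) ∧
      (∀ x, M'.qarr 2 (top + code (L b) x) = table T asg (factor ins π) b x) ∧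
      (∀ a < top, M'.qarr 2 a = M.qarr 2 a) ∧ (∀ j, M'.warr 12 j = 0) ∧
      ∀ j, M'.warr 13 j = 0 := by
  have hH := hG.rows b
  have hpos := (Nat.two_pow_pos _).trans_le hH
  have hlen : (L b).length ≤ H := Nat.lt_two_pow_self.le.trans hH
  have hm := hG.bags
  have hb := b.isLt
  have hlt := hG.lt b
  have hs := hG.sorted b
  have hloc : Local T asg (factor ins π) := local_factor π hG.home
  refine Run.step 15 (H * 1077) (by decide) (by omega) ?_
  simp only [Program.wp, WordExp.fits_get, WordExp.fits_add, WordExp.fits_sub, WordExp.fits_reg,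
    WordExp.val_get, WordExp.val_add, WordExp.val_sub, WordExp.val_reg, WordExp.fits_ofNat,
    WordExp.val_ofNat, Memory.wreg_setW, Memory.wreg_putW, Memory.warr_setW, Nat.reduceEqDiff,
    if_true, if_false, h₆, h₂₀, hD.start b hb.le, hD.start _ hb, hG.start, Nat.add_sub_cancel_left]
  refine ⟨trivial, ⟨⟨trivial, by omega, by omega⟩, trivial, by omega⟩, ⟨trivial, trivial⟩, trivial,
    ?_⟩
  obtain ⟨M₁, hM₁⟩ : ∃ M₁, M₁ = (((M.setW 7 (st b)).setW 8 (L b).length).putW 15 b top).setW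
    14 top := ⟨_, rfl⟩
  rw [← hM₁]
  have a₁ : ∀ a ≠ 15, M₁.warr a = M.warr a := fun a ha => by
    rw [hM₁]; funext j; simp [ha]
  have q₁ : M₁.qarr = M.qarr := by rw [hM₁]; rfl
  have r₁ : M₁.wreg 7 = st b ∧ M₁.wreg 8 = (L b).length ∧ M₁.wreg 6 = b ∧ M₁.wreg 14 = top ∧
      M₁.wreg 20 = top ∧ M₁.wreg 3 = M.wreg 3 := by simp [hM₁, h₆, h₂₀]
  have d₁ : BagData M₁ T ins π asg L st := hD.congr
    (fun a ha => a₁ a (by rintro rfl; revert ha; decide)) (by rw [q₁]) (by rw [q₁]) r₁.2.2.2.2.2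
  have f₁ : M₁.warr 15 b = top := by simp [hM₁]
  have f₁' : ∀ c : ℕ, c ≠ b → M₁.warr 15 c = M.warr 15 c := fun c hc => by simp [hM₁, hc]
  have t₁ : ∀ c : Fin m, T.Child b c →
      HasTable M₁ (L c) (table T asg (factor ins π) c) c top := fun c h =>
    (hc c h).congr (f₁' c fun h' => FullBinTree.not_transGen_self b
      (.single (Fin.ext h' ▸ h))) (fun _ _ => by rw [q₁]) le_rfl
  refine Run.andThen (H * 1042) (run_setWeights (L := L b) hs.nodup r₁.1 r₁.2.1 (d₁.lists b)
    (by rw [a₁ 12 (by decide)]; exact hz) hlt (by omega) hG.gates) (by omega) ?_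
  rintro M₂ hs₂ ⟨w₂, hW₂⟩
  refine Run.step 4 (H * 1038) (by decide) (by omega) ?_
  have r₂ : M₂.wreg 20 = top := by rw [hs₂.wreg 20 (by decide)]; exact r₁.2.2.2.2.1
  simp only [Program.wp, WordExp.fits_add, WordExp.fits_reg, WordExp.val_add, WordExp.val_reg, r₂,
    w₂]
  refine ⟨⟨trivial, trivial, by omega⟩, ?_⟩
  obtain ⟨M₃, hM₃⟩ : ∃ M₃, M₃ = M₂.setW 20 (top + 2 ^ (L b).length) := ⟨_, rfl⟩
  rw [← hM₃]
  have a₃ : M₃.warr = M₂.warr := by rw [hM₃]; rfl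
  have q₃ : M₃.qarr = M₂.qarr := by rw [hM₃]; rfl
  have r₃ : ∀ i ≠ 20, M₃.wreg i = M₂.wreg i := fun i hi => by simp [hM₃, hi]
  have d₂ : BagData M₂ T ins π asg L st :=
    d₁.same hs₂ (by decide) (by decide) (by decide) (by decide)
  have d₃ : BagData M₃ T ins π asg L st := d₂.congr (fun a _ => by rw [a₃]) (by rw [q₃])
    (by rw [q₃]) (r₃ 3 (by decide))
  have hq₃ : M₃.qarr 2 = M.qarr 2 := by rw [q₃, hs₂.qarr 2 (by decide), q₁]
  refine Run.andThen (H * 838) (run_localTable (o := top) (L := L b) d₃.toGateData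
    (b := b) (dom := T.dom b)
    (by rw [r₃ 6 (by decide), hs₂.wreg 6 (by decide)]; exact r₁.2.2.1)
    (by rw [r₃ 7 (by decide), hs₂.wreg 7 (by decide)]; exact r₁.1)
    (by rw [r₃ 8 (by decide), hs₂.wreg 8 (by decide)]; exact r₁.2.1)
    (by rw [r₃ 14 (by decide), hs₂.wreg 14 (by decide)]; exact r₁.2.2.2.1)
    (d₃.lists b) ⟨by rw [a₃]; exact hW₂.mem, by rw [a₃]; exact hW₂.notMem⟩ hs
    (fun g hg => hg ▸ hG.home g) hlt (by omega) hG.five hm.le) (by omega) ?_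
  rintro M₄ hs₄ ⟨w₄, q₄, q₄'⟩
  have d₄ : BagData M₄ T ins π asg L st :=
    d₃.same hs₄ (by decide) (by decide) (by decide) (by decide)
  have hW₄ : HasWeights M₄ (L b) := by
    constructor <;> rw [hs₄.warr 12 (by decide), a₃]
    exacts [hW₂.mem, hW₂.notMem]
  have r₄ : ∀ i, i = 6 ∨ i = 7 ∨ i = 8 ∨ i = 14 → M₄.wreg i = M₁.wreg i := by
    rintro i (rfl | rfl | rfl | rfl)
    · rw [hs₄.wreg 6 (by decide), r₃ 6 (by decide), hs₂.wreg 6 (by decide)]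
    · rw [hs₄.wreg 7 (by decide), r₃ 7 (by decide), hs₂.wreg 7 (by decide)]
    · rw [hs₄.wreg 8 (by decide), r₃ 8 (by decide), hs₂.wreg 8 (by decide)]
    · rw [hs₄.wreg 14 (by decide), r₃ 14 (by decide), hs₂.wreg 14 (by decide)]
  have hq₄ : ∀ a < top, M₄.qarr 2 a = M₁.qarr 2 a := fun a ha => by
    rw [q₄' a ha, hq₃, q₁]
  have f₄ : M₄.warr 15 = M₁.warr 15 := by
    rw [hs₄.warr 15 (by decide), a₃, hs₂.warr 15 (by decide)]
  have z₄ : M₄.warr 13 = M.warr 13 := by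
    rw [hs₄.warr 13 (by decide), a₃, hs₂.warr 13 (by decide), a₁ 13 (by decide)]
  refine Run.andThen (H * 429) (run_absorbChild (o := top) (b := b) (oc := T.left b) (H := H) hG
    d₄ (by rw [r₄ 6 (by decide)]; exact r₁.2.2.1) (by rw [r₄ 7 (by decide)]; exact r₁.1)
    (by rw [r₄ 8 (by decide)]; exact r₁.2.1) w₄ (by rw [r₄ 14 (by decide)]; exact r₁.2.2.2.1)
    (d₄.left b) hW₄ (by rw [z₄]; exact hz') (fun c h => (t₁ c (.inl h)).congr
      (by rw [f₄]) hq₄ le_rfl) q₄ (ratBits_prodOf_le _)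
    (fun c h x => by rw [prodOf_mul_message hloc (.inl h)]; exact ratBits_sumOver_le _ _ x)
    (by omega)) (by omega) ?_
  rintro M₅ hs₅ ⟨w₅, q₅, q₅', z₅⟩
  have d₅ : BagData M₅ T ins π asg L st :=
    d₄.same hs₅ (by decide) (by decide) (by decide) (by decide)
  have hW₅ : HasWeights M₅ (L b) := by
    constructor <;> rw [hs₅.warr 12 (by decide)]
    exacts [hW₄.mem, hW₄.notMem]
  have r₅ : ∀ i, i = 6 ∨ i = 7 ∨ i = 8 ∨ i = 14 → M₅.wreg i = M₁.wreg i := by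
    intro i hi
    rw [← r₄ i hi]
    rcases hi with rfl | rfl | rfl | rfl
    · rw [hs₅.wreg 6 (by decide)]
    · rw [hs₅.wreg 7 (by decide)]
    · rw [hs₅.wreg 8 (by decide)]
    · rw [hs₅.wreg 14 (by decide)]
  have hq₅ : ∀ a < top, M₅.qarr 2 a = M₁.qarr 2 a := fun a ha => by rw [q₅' a ha, hq₄ a ha]
  have f₅ : M₅.warr 15 = M₁.warr 15 := by rw [hs₅.warr 15 (by decide), f₄]
  refine Run.andThen (H * 20) (run_absorbChild (o := top) (b := b) (oc := T.right b) (H := H) hG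
    d₅ (by rw [r₅ 6 (by decide)]; exact r₁.2.2.1) (by rw [r₅ 7 (by decide)]; exact r₁.1)
    (by rw [r₅ 8 (by decide)]; exact r₁.2.1) w₅ (by rw [r₅ 14 (by decide)]; exact r₁.2.2.2.1)
    (d₅.right b) hW₅ z₅ (fun c h => (t₁ c (.inr h)).congr
      (by rw [f₅]) hq₅ le_rfl) q₅
    (fun x => by
      cases hl : T.left b with
      | none => exact ratBits_prodOf_le _ x
      | some l =>
        simp only [Option.elim]
        rw [prodOf_mul_message hloc (.inl hl)]
        exact ratBits_sumOver_le _ _ x)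
    (fun r hr x => by
      cases hl : T.left b with
      | none => exact absurd ((T.full b).1 hl) (by simp [Option.mem_def.1 hr])
      | some l =>
        simp only [Option.elim]
        rw [table_of_children hloc hl hr]
        exact ratBits_sumOver_le _ _ x)
    (by omega)) (by omega) ?_
  rintro M₆ hs₆ ⟨w₆, q₆, q₆', z₆⟩
  have d₆ : BagData M₆ T ins π asg L st :=
    d₅.same hs₆ (by decide) (by decide) (by decide) (by decide)
  have r₆ : ∀ i, i = 7 ∨ i = 8 ∨ i = 14 → M₆.wreg i = M₁.wreg i := by
    intro i hi
    rw [← r₅ i (.inr hi)]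
    rcases hi with rfl | rfl | rfl
    · rw [hs₆.wreg 7 (by decide)]
    · rw [hs₆.wreg 8 (by decide)]
    · rw [hs₆.wreg 14 (by decide)]
  refine (run_mark (a := 12) (a' := 10) (s := 7) (N := 8) (v := 0) (L := L b) (by decide)
    (by decide) (by decide) (by rw [r₆ 8 (by decide)]; exact r₁.2.1)
    (fun i g hi => by rw [r₆ 7 (by decide), r₁.1]; exact d₆.lists b i g hi)
    (by rw [r₆ 7 (by decide), r₁.1]; omega) hG.gates (Nat.zero_le _)).mono (by omega) ?_
  rintro M₇ hs₇ ⟨m₁, m₂⟩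
  have q₇ : M₇.qarr 2 = M₆.qarr 2 := hs₇.qarr 2 (by decide)
  have f₇ : M₇.warr 15 = M₁.warr 15 := by
    rw [hs₇.warr 15 (by decide), hs₆.warr 15 (by decide), f₅]
  refine ⟨?_, ?_, ?_, ?_, fun c hc => ?_, fun x => ?_, fun a ha => ?_, fun j => ?_, fun j => ?_⟩
  · rw [hs₇.wreg 14 (by decide), r₆ 14 (by decide)]; exact r₁.2.2.2.1
  · rw [hs₇.wreg 12 (by decide), w₆]
  · rw [hs₇.wreg 20 (by decide), hs₆.wreg 20 (by decide), hs₅.wreg 20 (by decide),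
      hs₄.wreg 20 (by decide), hM₃]
    simp
  · rw [f₇, f₁]
  · rw [f₇, f₁' c hc]
  · rw [q₇, q₆]
    cases hl : T.left b with
    | none =>
      have hr := (T.full b).1 hl
      rw [hr, table_of_leaf fun c hc => by simp [FullBinTree.Child, hl, hr] at hc]
      rfl
    | some l =>
      cases hr : T.right b with
      | none => exact absurd ((T.full b).2 hr) (by simp [hl])
      | some r => exact table_of_children hloc hl hr x
  · rw [q₇, q₆' a ha, hq₅ a ha, q₁]
  · by_cases hj : ∃ g ∈ L b, j = (g : ℕ) + 1
    · obtain ⟨g, hg, rfl⟩ := hj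
      exact m₁ g hg
    · rw [m₂ j fun g hg h => hj ⟨g, hg, h⟩, hs₆.warr 12 (by decide)]
      exact hW₅.notMem j fun g hg h => hj ⟨g, hg, h⟩
  · rw [hs₇.warr 13 (by decide)]; exact z₆ j

end Bags

end ProbEval

namespace ProbEval

/-! ### All tables and the final sum -/

section Tables

variable {w n m H : ℕ} {C : Circuit (Fin n)} {ins : Fin n → List (Fin n)} {π : ProbValuation C}
  {T : TreeDecomposition C.encoding (Fin m)} {asg : Fin n → Fin m} {L : Fin m → List (Fin n)}
  {st : ℕ → ℕ}

/-- The tables of the last `t` bags of the order `Q` have been computed, and registers `14` and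
`12` describe the most recent one. -/
structure TablesState (M : Memory) (T : TreeDecomposition C.encoding (Fin m))
    (ins : Fin n → List (Fin n)) (π : ProbValuation C) (asg : Fin n → Fin m)
    (L : Fin m → List (Fin n)) (Q : List (Fin m)) (H t : ℕ) : Prop where
  top : M.wreg 20 ≤ t * H
  tables : ∀ (i : ℕ) (b : Fin m), Q[i]? = some b → m ≤ i + t →
    HasTable M (L b) (table T asg (factor ins π) b) b (M.wreg 20)
  last : ∀ (i : ℕ) (b : Fin m), Q[i]? = some b → m = i + t →
    M.wreg 14 = M.warr 15 b ∧ M.wreg 12 = 2 ^ (L b).length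
  weights : ∀ j, M.warr 12 j = 0
  marks : ∀ j, M.warr 13 j = 0

theorem run_processBags {M : Memory} {Q : List (Fin m)} (hG : Layout T ins asg L st w H)
    (hD : BagData M T ins π asg L st) (hQ : IsOrder T.toFullBinTree Q)
    (h₉ : ∀ (i : ℕ) (b : Fin m), Q[i]? = some b → M.warr 9 i = b) (h₂ : M.wreg 2 = m)
    (h₂₀ : M.wreg 20 = 0) (hz : ∀ j, M.warr 12 j = 0) (hz' : ∀ j, M.warr 13 j = 0)
    (hw : m * H < w) :
    Run w (bitBound π) processBags M (5 + m * (H * 1092 + 17)) fun M' =>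
      TablesState M' T ins π asg L Q H m := by
  have hm := hG.bags
  refine (Run.forLoop_const (T := H * 1092 + 10) (K := m)
    (fun t M' => TablesState M' T ins π asg L Q H t) (by decide) (by decide) (by decide) h₂ hm
    ⟨by simp [h₂₀], fun i b hi h => ?_, fun i b hi h => ?_, by simpa using hz, by simpa using hz'⟩
    ?_).mono le_rfl fun _ _ h => h
  · have := (List.getElem?_eq_some_iff.1 hi).1
    have := hQ.length
    omega
  · have := (List.getElem?_eq_some_iff.1 hi).1
    have := hQ.length
    omega
  rintro t ht M' hs h₅ h₂' hI
  have hlt : m - 1 - t < Q.length := by rw [hQ.length]; omega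
  obtain ⟨b, hb⟩ : ∃ b, Q[m - 1 - t]? = some b := ⟨_, List.getElem?_eq_getElem hlt⟩
  have e₉ : M'.warr 9 (m - 1 - t) = b := by rw [hs.warr 9 (by decide)]; exact h₉ _ b hb
  refine Run.step 8 (H * 1092) (by decide) (by omega) ?_
  simp only [Program.wp, WordExp.fits_get, WordExp.fits_sub, WordExp.fits_reg, WordExp.val_get,
    WordExp.val_sub, WordExp.val_reg, WordExp.fits_ofNat, WordExp.val_ofNat, h₅, h₂', e₉]
  refine ⟨⟨⟨trivial, by omega, by omega⟩, trivial, by omega⟩, ?_⟩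
  have hd : BagData M' T ins π asg L st :=
    hD.same hs (by decide) (by decide) (by decide) (by decide)
  have htop := hI.top
  have hH : (t + 1) * H ≤ m * H := Nat.mul_le_mul_right _ ht
  rw [add_mul, one_mul] at hH
  refine (run_processBag (M := M'.setW 6 b) (b := b) (top := M'.wreg 20) hG (hd.congr (fun _ _ => rfl) rfl rfl
    (by simp)) (by simp) (by simp) (by simpa using hI.weights) (by simpa using hI.marks)
    (fun c hc => ?_) (by omega)).mono le_rfl ?_
  -- A child stands later in the order than its parent, and the order is traversed backwards, so its
  -- table is already available.
  · obtain ⟨j, hj, hj'⟩ := hQ.child _ b c hb hc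
    exact (hI.tables j c hj' (by omega)).congr rfl (fun _ _ => rfl) le_rfl
  · rintro M'' - ⟨g₁₄, g₁₂, g₂₀, g₁₅, g₁₅', gb, gq, gw, gm⟩
    have hrow := hG.rows b
    refine ⟨?_, fun i c hi hit => ?_, fun i c hi hit => ?_, gw, gm⟩
    · simp only [Memory.wreg_setW, Nat.reduceEqDiff, if_false, g₂₀]
      rw [add_mul, one_mul]
      omega
    · simp only [Memory.wreg_setW, Nat.reduceEqDiff, if_false, g₂₀]
      by_cases hib : i = m - 1 - t
      · obtain rfl : b = c := by rw [hib, hb] at hi; exact Option.some.inj hi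
        exact ⟨by rw [Memory.warr_setW, g₁₅], by
          rw [Memory.warr_setW, Memory.qarr_setW, g₁₅]; exact gb⟩
      · have hcb : (c : ℕ) ≠ b := by
          intro h
          obtain rfl : c = b := Fin.ext h
          exact hib ((List.getElem?_inj (List.getElem?_eq_some_iff.1 hi).1 hQ.nodup).1
            (hi.trans hb.symm))
        exact (hI.tables i c hi (by omega)).congr (g₁₅' c hcb) gq (by simp)
    · obtain rfl : i = m - 1 - t := by omega
      obtain rfl : b = c := Option.some.inj (hb.symm.trans hi)
      simp only [Memory.wreg_setW, Memory.warr_setW, Nat.reduceEqDiff, if_false]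
      exact ⟨g₁₄.trans g₁₅.symm, g₁₂⟩

/-- The complement has the same denominator, and nonnegativity makes its numerator a natural number.
-/
theorem ratBits_one_sub_le {N : ℕ} {q : ℚ} (h : IsFrac (commonDen π) N q) (hq : 0 ≤ 1 - q) :
    ratBits (1 - q) ≤ bitBound π := by
  obtain ⟨a, ha, -⟩ := h
  have hD : (0 : ℚ) < commonDen π := by exact_mod_cast commonDen_pos π
  have hle : a ≤ commonDen π := by
    have : (a : ℚ) ≤ commonDen π := by rw [← ha]; nlinarith
    exact_mod_cast this
  refine IsFrac.ratBits_le_bitBound π ⟨commonDen π - a, ?_, ?_⟩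
  · rw [Nat.cast_sub hle, ← ha]; ring
  · exact (Nat.sub_le _ _).trans (Nat.le_mul_of_pos_left _ (Nat.two_pow_pos _))

theorem run_sumTable {M : Memory} {o : ℕ} (hins : Inputs C ins) (hC : C.IsArityTwo)
    (hG : Layout T ins asg L st w H) (h₁₄ : M.wreg 14 = o)
    (h₁₂ : M.wreg 12 = 2 ^ (L T.root).length)
    (hrow : ∀ x, M.qarr 2 (o + code (L T.root) x) = table T asg (factor ins π) T.root x)
    (h₁ : M.qreg 1 = 0) (hw : o + 2 ^ (L T.root).length < w) :
    Run w (bitBound π) sumTable M (H * 30) fun M' =>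
      M'.qreg 0 = π.outProb false ∧ M'.qreg 1 = π.outProb true := by
  have hH := hG.rows T.root
  have hpos := Nat.two_pow_pos (L T.root).length
  have hnd := (hG.sorted T.root).nodup
  have hβ : ∀ J ⊆ Finset.range (2 ^ (L T.root).length),
      ratBits (∑ j ∈ J, M.qarr 2 (o + j)) ≤ bitBound π := fun J hJ =>
    ratBits_sum_rows_le (f := fun j => M.qarr 2 (o + j)) hnd hrow hJ
  have hsum : ∑ j ∈ Finset.range (2 ^ (L T.root).length), M.qarr 2 (o + j) =
      sumOver (T.dom T.root) (table T asg (factor ins π) T.root) fun _ => false := by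
    rw [sum_code hnd (fun j => M.qarr 2 (o + j)) fun _ => false, (hG.sorted T.root).toFinset]
    simp only [hrow]
  have hout : ∑ j ∈ Finset.range (2 ^ (L T.root).length), M.qarr 2 (o + j) =
      π.outProb true := by
    rw [hsum, sumOver_table_root (fun g => ⟨_, (hG.home g).1⟩), sum_prod_factor π hins hC]
  refine Run.andThen 4 (Run.forLoop_const (T := 8) (K := 2 ^ (L T.root).length)
    (fun i M' => M'.qreg 1 = ∑ j ∈ Finset.range i, M.qarr 2 (o + j)) (by decide) (by decide)
    (by decide) h₁₂ (by omega) (by simpa using h₁) ?_) (by omega) ?_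
  · rintro i hi M' hs h₉ - hI
    have e₂ : M'.qarr 2 = M.qarr 2 := hs.qarr 2 (by decide)
    have e₁₄ : M'.wreg 14 = o := by rw [hs.wreg 14 (by decide), h₁₄]
    refine Run.straight (by decide) ?_
    simp only [Program.wp, RatExp.fits_add, RatExp.fits_reg, RatExp.fits_get, WordExp.fits_add,
      WordExp.fits_reg, WordExp.val_add, WordExp.val_reg, RatExp.small_add, RatExp.small_reg,
      RatExp.small_get, RatExp.val_add, RatExp.val_reg, RatExp.val_get, h₉, e₁₄, e₂, hI,
      ← Finset.sum_range_succ]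
    refine ⟨⟨⟨trivial, trivial, trivial, by omega⟩, hβ _ ?_, ?_, hβ _ ?_⟩, by simp⟩
    · exact Finset.range_subset_range.2 hi.le
    · simpa using hβ {i} (by simpa using hi)
    · exact Finset.range_subset_range.2 hi
  · rintro M' - hI
    rw [hout] at hI
    have hb : ratBits (π.outProb true) ≤ bitBound π := hout ▸ hβ _ subset_rfl
    have hf := IsFrac.sum (s := Finset.univ) fun x _ => isFrac_prod (ins := ins) π Finset.univ x
    rw [sum_prod_factor π hins hC] at hf
    have h₀ := outProb_nonneg π false
    rw [outProb_false] at h₀ ⊢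
    refine Run.straight (by decide) ?_
    simp only [Program.wp, RatExp.fits_sub, RatExp.fits_reg, RatExp.fits_one, RatExp.small_sub,
      RatExp.small_reg, RatExp.small_one, RatExp.val_sub, RatExp.val_reg, RatExp.val_one, hI]
    exact ⟨⟨⟨trivial, trivial⟩, ratBits_one_le π, hb, ratBits_one_sub_le hf h₀⟩, by simp [hI]⟩

end Tables

end ProbEval

namespace ProbEval

/-! ## The whole computation -/

theorem flatten_getElem? {α : Type} {l : List (List α)} {b i : ℕ} {d : List α} {a : α}
    (hb : l[b]? = some d) (hi : d[i]? = some a) :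
    l.flatten[((l.take b).map List.length).sum + i]? = some a := by
  induction l generalizing b with
  | nil => simp at hb
  | cons e l ih =>
    cases b with
    | zero =>
      obtain rfl : e = d := by simpa using hb
      have := (List.getElem?_eq_some_iff.1 hi).1
      simpa [List.getElem?_append_left this] using hi
    | succ b =>
      rw [List.flatten_cons, List.take_succ_cons, List.map_cons, List.sum_cons, add_assoc,
        List.getElem?_append_right (by omega), Nat.add_sub_cancel_left]
      exact ih (by simpa using hb)

section Eval

variable {n m k : ℕ} {C : Circuit (Fin n)} {T : TreeDecomposition C.encoding (Fin m)}
  {π : ProbValuation C}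

/-- The bound also holds when the truncated subtraction in the width takes effect, since then all
bags are empty. -/
theorem card_dom_le (hT : T.width = k) (b : Fin m) : (T.dom b).card ≤ k + 1 := by
  have := Finset.le_sup (f := fun b => (T.dom b).card) (Finset.mem_univ b)
  rw [TreeDecomposition.width] at hT
  omega

theorem cellSize_le_bitSize : π.cellSize ≤ π.bitSize := by
  rw [ProbValuation.cellSize, ProbValuation.bitSize, mul_comm, ← Finset.card_univ,
    ← smul_eq_mul, ← Finset.sum_const]
  refine Finset.sum_le_sum fun g _ => ?_
  rw [Fintype.sum_bool, ratBits, ratBits]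
  omega

/-- It absorbs the quadratic cost of sorting a bag of at most `k + 1` gates. -/
theorem succ_sq_le_two_pow (k : ℕ) : (k + 1) * (k + 1) ≤ 4 * 2 ^ k := by
  induction k with
  | zero => norm_num
  | succ k ih =>
    have : k + 1 ≤ 2 ^ k := Nat.lt_two_pow_self
    rcases Nat.lt_or_ge k 2 with h | h
    · interval_cases k <;> norm_num
    · rw [pow_succ]
      nlinarith

theorem run_evalProgram {w : ℕ} {M : Memory} (hC : C.IsArityTwo) (hT : T.width = k)
    (hM : Encodes M C T π) (hw : 10 * (2 ^ k * m + C.size) ≤ w) :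
    Run w (bitBound π) evalProgram M (3000 * (2 ^ k * m + C.size)) fun M' =>
      M'.qreg 0 = π.outProb false ∧ M'.qreg 1 = π.outProb true := by
  obtain ⟨W, d, hWn, hW, hd, hr, a₀, a₁, a₂, a₃, a₄, a₅, a₆, a₇, hq, hp, -⟩ := hM
  have hins := inputs_sources hWn hW
  have hcov := exists_cover hins hC T
  have hn : 0 < n := C.out.pos
  have hm : 0 < m := T.root.pos
  have hsize : C.size = n + W.length := by
    rw [Circuit.size, Fintype.card_fin, ← hW, List.toFinset_card_of_nodup hWn]
  have hk : k + 1 ≤ 2 ^ k := Nat.lt_two_pow_self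
  have hkm : (k + 1) * m ≤ 2 ^ k * m := Nat.mul_le_mul_right m hk
  have hkm' : m ≤ (k + 1) * m := Nat.le_mul_of_pos_left m (Nat.succ_pos k)
  obtain ⟨X, hX⟩ : ∃ X, X = 2 ^ k * m := ⟨_, rfl⟩
  rw [hsize, ← hX] at hw ⊢
  rw [← hX] at hkm
  obtain ⟨st, hst⟩ : ∃ st : ℕ → ℕ, st = fun j => (((List.ofFn d).take j).map List.length).sum :=
    ⟨_, rfl⟩
  have hdlen : ∀ b, (d b).length = (T.dom b).card := fun b => by
    rw [← (hd b).2, List.toFinset_card_of_nodup (hd b).1]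
  have hdk : ∀ b, (d b).length ≤ k + 1 := fun b => hdlen b ▸ card_dom_le hT b
  have hst' : ∀ b : Fin m, st (b + 1) = st b + (d b).length := fun b => by
    rw [hst]
    simp only
    rw [List.take_succ_eq_append_getElem (by simp)]
    simp
  have hstle : ∀ j ≤ m, st j ≤ (k + 1) * j := by
    intro j
    induction j with
    | zero => simp [hst]
    | succ j ih =>
      intro hj
      have h₁ := hst' ⟨j, hj⟩
      have h₂ := hdk ⟨j, hj⟩
      have h₃ := ih (by omega)
      simp only at h₁
      rw [h₁, mul_add]
      omega
  have hstX : ∀ j ≤ m, st j ≤ X := fun j hj =>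
    (hstle j hj).trans ((Nat.mul_le_mul_left _ hj).trans hkm)
  have h₅ : ∀ j ≤ m, M.warr 5 j = st j := fun j hj => by
    rw [a₅, hst]
    exact arrayOf_eq (by rw [List.getElem?_map, List.getElem?_range (by omega)]; rfl)
  have h₆ : HasLists M 6 st d := fun b i g hi => by
    rw [a₆, hst]
    refine arrayOf_eq ?_
    rw [List.getElem?_map, flatten_getElem? (d := d b) (a := g) (by simp) hi]
    rfl
  have h₀ : ∀ g : Fin n, M.warr 0 g = (C.kind g).code := fun g => by
    rw [a₀]; exact arrayOf_eq (by simp)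
  have h₃ : ∀ b : Fin m, M.warr 3 b = pointer (T.left b) := fun b => by
    rw [a₃]; exact arrayOf_eq (by simp)
  have h₄ : ∀ b : Fin m, M.warr 4 b = pointer (T.right b) := fun b => by
    rw [a₄]; exact arrayOf_eq (by simp)
  have hz : ∀ a, 7 ≤ a → ∀ i, M.warr a i = 0 := fun a ha i => by rw [a₇ a ha]
  have r₁ : M.wreg 1 = W.length := by rw [hr]; rfl
  have r₂ : M.wreg 2 = m := by rw [hr]; rfl
  have r₃ : M.wreg 3 = C.out := by rw [hr]; rfl
  have r₄ : M.wreg 4 = T.root := by rw [hr]; rfl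
  have r₂₀ : M.wreg 20 = 0 := by rw [hr]; rfl
  have hsq : m * ((k + 1) * (k + 1)) ≤ 4 * X := by
    have := Nat.mul_le_mul_left m (succ_sq_le_two_pow k)
    rw [hX]
    linarith
  -- All tables together occupy at most this many cells, which keeps their addresses within the word
  -- size.
  have hH : m * 2 ^ (k + 1) = 2 * X := by rw [hX, pow_succ]; ring
  have hH' : 2 ^ (k + 1) ≤ 2 * X := hH ▸ Nat.le_mul_of_pos_left _ hm
  refine Run.andThen (2960 * X + 2950 * n) (run_collectInputs (n := n) r₁ a₁ a₂ (a₇ 7 le_rfl)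
    (a₇ 8 (by norm_num)) (by omega) (by omega)) (by omega) ?_
  rintro M₁ hs₁ hin₁
  refine Run.andThen (2900 * X + 2940 * n) (run_orderBags (T := T.toFullBinTree)
    (by rw [hs₁.wreg 2 (by decide)]; exact r₂) (by rw [hs₁.wreg 4 (by decide)]; exact r₄)
    (by rw [hs₁.warr 3 (by decide)]; exact h₃) (by rw [hs₁.warr 4 (by decide)]; exact h₄)
    (by omega)) (by omega) ?_
  rintro M₂ hs₂ ⟨Q, hQ, h₉⟩
  have e₂ : ∀ a, a ≠ 7 → a ≠ 8 → a ≠ 9 → M₂.warr a = M.warr a := fun a h h' h'' => by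
    rw [hs₂.warr a, hs₁.warr a]
    · simp [collectInputs, forLoop, Program.wrA, h, h']
    · simp [orderBags, forLoop, Program.wrA, h'']
  refine Run.andThen (2400 * X + 2900 * n) (run_prepareBags (κ := k + 1) (D := d) (dom := T.dom)
    (st := st) hins hC hd
    (by rw [hs₂.wreg 2 (by decide), hs₁.wreg 2 (by decide)]; exact r₂)
    (by rw [e₂ 5 (by decide) (by decide) (by decide)]; exact h₅) hst'
    (by rw [HasLists, e₂ 6 (by decide) (by decide) (by decide)]; exact h₆)
    (by rw [HasInputs, hs₂.warr 7 (by decide), hs₂.warr 8 (by decide)]; exact hin₁)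
    (by rw [e₂ 11 (by decide) (by decide) (by decide)]; exact hz 11 (by decide))
    (by rw [e₂ 14 (by decide) (by decide) (by decide)]; exact hz 14 (by decide))
    hcov hdk (fun j hj => by have := hstX j hj; omega) (by omega) (by omega)) ?_ ?_
  · rw [show m * (60 + (k + 1) * 82 + (k + 1) * (k + 1) * 47) =
      m * 60 + (k + 1) * m * 82 + m * ((k + 1) * (k + 1)) * 47 by ring]
    omega
  rintro M₃ hs₃ ⟨L, asg, hL, hl, hasg⟩
  have hLlen : ∀ b, (L b).length = (d b).length := fun b => by
    rw [hdlen, ← (hL b).toFinset, List.toFinset_card_of_nodup (hL b).nodup]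
  have e₃ : ∀ a, a ≠ 7 → a ≠ 8 → a ≠ 9 → a ≠ 10 → a ≠ 11 → a ≠ 14 → M₃.warr a = M.warr a := by
    intro a h h' h'' g g' g''
    rw [hs₃.warr a, e₂ a h h' h'']
    simp [prepareBags, markBag, sortBag, tryPlace, assignGates, unmarkBag, forLoop, Program.wrA,
      g, g', g'']
  have er₃ : ∀ i, i = 2 ∨ i = 3 ∨ i = 20 → M₃.wreg i = M.wreg i := by
    rintro i (rfl | rfl | rfl)
    · rw [hs₃.wreg 2 (by decide), hs₂.wreg 2 (by decide), hs₁.wreg 2 (by decide)]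
    · rw [hs₃.wreg 3 (by decide), hs₂.wreg 3 (by decide), hs₁.wreg 3 (by decide)]
    · rw [hs₃.wreg 20 (by decide), hs₂.wreg 20 (by decide), hs₁.wreg 20 (by decide)]
  have eq₃ : M₃.qarr = M.qarr := by
    funext a
    rw [hs₃.qarr a (by simp [show prepareBags.wrR = [] from rfl]),
      hs₂.qarr a (by simp [show orderBags.wrR = [] from rfl]),
      hs₁.qarr a (by simp [show collectInputs.wrR = [] from rfl])]
  have hG : Layout T (sources W) asg L st w (2 ^ (k + 1)) :=
    { sorted := hL
      start := fun b => by rw [hLlen]; exact hst' b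
      start_lt := fun j hj => by have := hstX j hj; omega
      home := fun g => (hasg g).2
      rows := fun b => Nat.pow_le_pow_right (by norm_num) (hLlen b ▸ hdk b)
      gates := by omega
      bags := by omega
      five := by omega }
  have hD : BagData M₃ T (sources W) π asg L st :=
    { kind := by rw [e₃ 0] <;> first | exact h₀ | decide
      inputs := by
        rw [HasInputs, hs₃.warr 7 (by decide), hs₃.warr 8 (by decide), hs₂.warr 7 (by decide),
          hs₂.warr 8 (by decide)]
        exact hin₁
      bag := fun g => (hasg g).1
      prob := by rw [eq₃]; exact hp
      out := by rw [er₃ 3 (by decide)]; exact r₃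
      left := by rw [e₃ 3] <;> first | exact h₃ | decide
      right := by rw [e₃ 4] <;> first | exact h₄ | decide
      start := by rw [e₃ 5] <;> first | exact h₅ | decide
      lists := hl }
  refine Run.andThen (100 * X) (run_processBags hG hD hQ
    (by rw [hs₃.warr 9 (by decide)]; exact h₉) ((er₃ 2 (by decide)).trans r₂)
    ((er₃ 20 (by decide)).trans r₂₀)
    (by rw [e₃ 12] <;> first | exact hz 12 (by decide) | decide)
    (by rw [e₃ 13] <;> first | exact hz 13 (by decide) | decide) (by omega)) ?_ ?_
  · rw [show m * (2 ^ (k + 1) * 1092 + 17) = m * 2 ^ (k + 1) * 1092 + m * 17 by ring, hH]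
    omega
  rintro M₄ hs₄ hI
  obtain ⟨g₁₄, g₁₂⟩ := hI.last 0 _ hQ.root (by omega)
  have hroot := hI.tables 0 _ hQ.root (by omega)
  have htop := hI.top
  rw [hH] at htop
  have hle := hroot.le
  refine (run_sumTable hins hC hG g₁₄ g₁₂ hroot.row ?_ (by omega)).mono (by omega) fun _ _ h => h
  rw [hs₄.qreg 1 (by decide), hs₃.qreg 1 (by decide), hs₂.qreg 1 (by decide),
    hs₁.qreg 1 (by decide), hq]

end Eval

end ProbEval

open ProbEval in
theorem mainTheorem11 :
    ∃ (P : Program) (c : ℕ) (p : Polynomial ℕ),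
      ∀ (n m : ℕ) (C : Circuit (Fin n)) (_ : C.IsArityTwo)
        (T : TreeDecomposition C.encoding (Fin m)) (k : ℕ) (_ : T.width = k)
        (π : ProbValuation C) (M : Memory) (_ : Encodes M C T π),
        ∃ (t r : ℕ) (M' : Memory),
          Exec (c * (2 ^ k * m + π.cellSize + C.size)) P M t r M' ∧
          M'.qreg 0 = π.outProb false ∧ M'.qreg 1 = π.outProb true ∧
          t ≤ c * (2 ^ k * m + π.cellSize + C.size) ∧
          r ≤ p.eval (2 ^ k * m + π.bitSize + C.size) := by
  refine ⟨evalProgram, 3000,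
    -- With `β` equal to `bitBound`, `2 + 2 * β` is `8 + 4 * (n + π.bitSize)`, and `n` is at most
    -- the size of the circuit; the last factor bounds the number of steps.
    (Polynomial.C 8 + Polynomial.C 4 * Polynomial.X) ^ 2 * (Polynomial.C 3000 * Polynomial.X), ?_⟩
  intro n m C hC T k hT π M hM
  have hcell : π.cellSize ≤ π.bitSize := cellSize_le_bitSize
  have hn : n ≤ C.size := by rw [Circuit.size, Fintype.card_fin]; omega
  obtain ⟨t, r, M', hE, ht, hr, h₀, h₁⟩ := run_evalProgram
    (w := 3000 * (2 ^ k * m + π.cellSize + C.size)) hC hT hM (by omega)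
  refine ⟨t, r, M', hE, h₀, h₁, by omega, hr.trans ?_⟩
  simp only [Polynomial.eval_mul, Polynomial.eval_pow, Polynomial.eval_add, Polynomial.eval_C,
    Polynomial.eval_X]
  refine Nat.mul_le_mul (Nat.pow_le_pow_left ?_ 2) (by omega)
  rw [bitBound]
  omega
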